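/- Notation. For $s,x\in\{0,1\}^n$ let $s\cdot x=\sum_i s_ix_i \bmod 2$. For a probability distribution $\mathcal D$ on $\{0,1\}^n\times\{0,1\}$ with input marginal $\mathcal D_X$ and conditional label expectation $\varphi(z)=\mathbb P_{(x,b)\sim\mathcal D}[b=1\mid x=z]$, let $F_{\mathcal D}$ be the distribution of a random function $f:\{0,1\}^n\to\{0,1\}$ whose values $f(z)$ are independent with $\mathbb P[f(z)=1]=\varphi(z)$. The mixture-of-superpositions example of $\mathcal D$ is the $(n+1)$-qubit state $$\rho_{\mathcal D}=\mathbb E_{f\sim F_{\mathcal D}}\big[|\psi_f\rangle\langle\psi_f|\big],\qquad |\psi_f\rangle=\sum_{x}\sqrt{\mathcal D_X(x)}\,|x,f(x)\rangle .$$ For $\delta,\varepsilon\in(0,1)$ put $M=\log\!\big(\tfrac1{\delta\varepsilon^2}\big)/\varepsilon^4$. Statement. There are a single quantum algorithm (a finite classical program, of multitape Turing machine type with unit cost per step, which can request copies of $\rho_{\mathcal D}$, apply single-qubit gates and measure single qubits in the computational basis, and whose input consists of $n$ in unary and of $\lceil 1/\varepsilon\rceil$, $\lceil 1/\delta\rceil$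 in binary) and constants $C>0$, $a\in\mathbb N$ such that the following holds for all $n$, all $\delta,\varepsilon\in(0,1)$ with $\varepsilon>2^{-(n/2-2)}$, and all $\mathcal D$ with uniform input marginal. For all measurement outcomes, the algorithm uses - at most $C\,M$ copies of $\rho_{\mathcal D}$, - at most $C\,n\,M$ single-qubit gates, - computation time at most $C\,n\max(1,M)\,\big(\log(2+M)\big)^a=\tilde{\mathcal O}(n\max(1,M))$, - classical memory at most $C\,n\max(1,M)\,\big(\log(2+M)\big)^a=\tilde{\mathcal O}(n\max(1,M))$, and with probability at least $1-\delta$ it outputs a string $s\in\{0,1\}^n$ with $$\mathbb P_{(x,b)\sim\mathcal D}[b\ne s\cdot x]\le\min_{t\in\{0,1\}^n}\mathbb P_{(x,b)\sim\mathcal D}[b\ne t\cdot x]+\varepsilon .$$ Thus, for these accuracies, the algorithm is a distributional proper $1$-agnostic learner of parities with respect to uniform input marginal: for every $\mathcal D$ with uniform input marginal it outputs, with probability at least $1-\delta$, a parity function whose error is at most $1\cdot\mathrm{opt}_{\mathcal D}(\text{parities})+\varepsilon$. -/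

import Mathlib

noncomputable section

namespace AgnosticParity

open scoped Matrix

/-! ### Bit strings, labelled distributions, parities and misclassification error -/

/-- Bit strings of length `n`. -/
abbrev Cube (n : ℕ) : Type := Fin n → Bool

/-- The parity function `x ↦ s · x = ∑ i, s i * x i mod 2`. -/
def parity {n : ℕ} (s x : Cube n) : Bool :=
  decide ((∑ i, (s i && x i).toNat) % 2 = 1)

/-- The class of all parity functions on `n` bits. -/
def parityClass (n : ℕ) : Set (Cube n → Bool) := Set.range parity

/-- The misclassification probability `P_{(x,b) ∼ D}[b ≠ h x]`. -/
def err {n : ℕ} (D : PMF (Cube n × Bool)) (h : Cube n → Bool) : ℝ :=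
  (D.toOuterMeasure {z | z.2 ≠ h z.1}).toReal

/-- The optimal error over a benchmark class. -/
def opt {n : ℕ} (D : PMF (Cube n × Bool)) (B : Set (Cube n → Bool)) : ℝ :=
  sInf (err D '' B)

/-- The marginal on the inputs. -/
def marginal {n : ℕ} (D : PMF (Cube n × Bool)) : PMF (Cube n) := D.map Prod.fst

/-- The distributions whose input marginal is uniform. -/
def uniformMarginal (n : ℕ) : Set (PMF (Cube n × Bool)) :=
  {D | marginal D = PMF.uniformOfFintype (Cube n)}

/-- The conditional label expectation `φ(z) = P[b = 1 | x = z]`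
(the value at inputs of probability `0` is irrelevant for the states below). -/
def labelExp {n : ℕ} (D : PMF (Cube n × Bool)) (z : Cube n) : ℝ :=
  (D (z, true) / marginal D z).toReal

/-! ### Mixture-of-superpositions quantum examples -/

/-- Operators on `N` qubits, in the computational basis. -/
abbrev QOp (N : ℕ) : Type := Matrix (Cube N) (Cube N) ℂ

/-- The probability of `f` when every label `f z` is drawn independently from the conditional
label distribution at `z`. -/
def funProb {n : ℕ} (D : PMF (Cube n × Bool)) (f : Cube n → Bool) : ℝ :=
  ∏ z, if f z then labelExp D z else 1 - labelExp D z

/-- The amplitudes of the superposition state `∑ x, √p(x) |x, f x⟩`;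
the last of the `n + 1` qubits carries the label. -/
def superposition {n : ℕ} (p : PMF (Cube n)) (f : Cube n → Bool) : Cube (n + 1) → ℂ :=
  fun w => if w (Fin.last n) = f (Fin.init w) then ((Real.sqrt (p (Fin.init w)).toReal : ℝ) : ℂ)
    else 0

/-- The mixture-of-superpositions example: the average of the projectors `|ψ_f⟩⟨ψ_f|`. -/
def mixtureExample {n : ℕ} (D : PMF (Cube n × Bool)) : QOp (n + 1) :=
  ∑ f : Cube n → Bool, ((funProb D f : ℝ) : ℂ) •
    Matrix.vecMulVec (superposition (marginal D) f) (star (superposition (marginal D) f))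

/-! ### Quantum algorithms: a classical machine that controls a register of qubits

The classical part is a fixed finite program over finitely many stacks with three symbols, that is,
a multitape Turing machine up to constant factors; every step has cost one.  The quantum part is a
register of `n + 1` qubits that holds at most one example at a time, with a cyclic head.  The only
quantum operations are: loading a fresh example, a single-qubit gate at the head, and a
computational basis measurement of the qubit at the head. -/

/-- Stack symbols: the two bits and a separator. -/
inductive Sym where
  | bit (b : Bool)
  | sep

/-- The elementary gates: the Hadamard gate and the `T` gate, which generate a dense set of
single-qubit unitaries (up to phase). -/
inductive Gate where
  | H
  | T

/-- The unitary matrix of a gate. -/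
def Gate.mat : Gate → Matrix Bool Bool ℂ
  | .H => Matrix.of fun a b => (if a && b then (-1 : ℂ) else 1) / ((Real.sqrt 2 : ℝ) : ℂ)
  | .T => Matrix.diagonal fun a => if a then Complex.exp (Complex.I * Real.pi / 4) else 1

/-- Programs with `k + 1` stacks. Branching and looping test the top of a stack
(`none` when the stack is empty). -/
inductive Cmd (k : ℕ) where
  /-- do nothing -/
  | skip
  /-- sequential composition -/
  | seq (p q : Cmd k)
  /-- push a symbol -/
  | push (i : Fin (k + 1)) (a : Sym)
  /-- remove the top symbol, if there is one -/
  | pop (i : Fin (k + 1))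
  /-- conditional -/
  | ite (i : Fin (k + 1)) (test : Option Sym → Bool) (p q : Cmd k)
  /-- loop as long as the test succeeds -/
  | loop (i : Fin (k + 1)) (test : Option Sym → Bool) (p : Cmd k)
  /-- replace the content of the quantum register by a fresh example -/
  | query
  /-- apply a gate to the qubit at the head -/
  | gate (g : Gate)
  /-- measure the qubit at the head and push the outcome -/
  | measure (i : Fin (k + 1))
  /-- move the head to the next qubit, cyclically -/
  | advance

/-- The operator on `N` qubits that acts as `U` on qubit `i` and as the identity elsewhere. -/
def onQubit {N : ℕ} (i : Fin N) (U : Matrix Bool Bool ℂ) : QOp N :=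
  Matrix.of fun w v => if ∀ j, j ≠ i → w j = v j then U (w i) (v i) else 0

/-- The projector `|b⟩⟨b|`. -/
def proj (b : Bool) : Matrix Bool Bool ℂ := Matrix.single b b 1

/-- A configuration of the machine on one branch of the measurement outcomes. The matrix `reg` is
the subnormalised state of the quantum register: its trace is the probability of the branch, and
`reg` divided by its trace is the state of the register on that branch. -/
structure Config (n k : ℕ) where
  /-- the commands still to be executed; the machine has halted when there are none -/
  code : List (Cmd k)
  stk : Fin (k + 1) → List Sym
  reg : QOp (n + 1)
  head : Fin (n + 1)
  /-- number of examples used so far -/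
  copies : ℕ
  /-- number of gates applied so far -/
  gates : ℕ

/-- The number of stack cells in use. -/
def Config.space {n k : ℕ} (c : Config n k) : ℕ := ∑ i, (c.stk i).length

/-- The probability of the branch. -/
def Config.weight {n k : ℕ} (c : Config n k) : ℝ := c.reg.trace.re

/-- One step of the machine when the examples are copies of `ρ`: the list of its possible results,
two for a measurement and one otherwise. -/
def step {n k : ℕ} (ρ : QOp (n + 1)) (c : Config n k) : List (Config n k) :=
  match c.code with
  | [] => [c]
  | .skip :: r => [{ c with code := r }]
  | .seq p q :: r => [{ c with code := p :: q :: r }]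
  | .push i a :: r =>
      [{ c with code := r, stk := Function.update c.stk i (a :: c.stk i) }]
  | .pop i :: r =>
      [{ c with code := r, stk := Function.update c.stk i (c.stk i).tail }]
  | .ite i test p q :: r =>
      [{ c with code := (if test (c.stk i).head? then p else q) :: r }]
  | .loop i test p :: r =>
      [{ c with code := if test (c.stk i).head? then p :: .loop i test p :: r else r }]
  | .query :: r =>
      [{ c with code := r, reg := c.reg.trace • ρ, copies := c.copies + 1 }]
  | .gate g :: r =>
      [{ c with
          code := r
          reg := onQubit c.head g.mat * c.reg * (onQubit c.head g.mat)ᴴ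
          gates := c.gates + 1 }]
  | .measure i :: r =>
      [false, true].map fun b =>
        { c with
          code := r
          stk := Function.update c.stk i (.bit b :: c.stk i)
          reg := onQubit c.head (proj b) * c.reg * onQubit c.head (proj b) }
  | .advance :: r => [{ c with code := r, head := c.head + 1 }]

/-- All branches after `t` steps. -/
def branches {n k : ℕ} (ρ : QOp (n + 1)) : ℕ → Config n k → List (Config n k)
  | 0, c => [c]
  | t + 1, c => (step ρ c).flatMap (branches ρ t)

/-- A bit string as a stack content. -/
def encode (l : List Bool) : List Sym := l.map .bit

/-- The input: `n` in unary, then `⌈1/ε⌉` and `⌈1/δ⌉` in binary, least significant bit first. -/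
def inputStack (n : ℕ) (ε δ : ℝ) : List Sym :=
  encode (List.replicate n true) ++ .sep ::
    (encode (Nat.bits ⌈1 / ε⌉₊) ++ .sep :: encode (Nat.bits ⌈1 / δ⌉₊))

/-- The initial configuration: the input on stack `0`, all other stacks empty, and the register in
the state `|0…0⟩`. -/
def initial {k : ℕ} (P : Cmd k) (n : ℕ) (ε δ : ℝ) : Config n k where
  code := [P]
  stk := fun i => if i = 0 then inputStack n ε δ else []
  reg := Matrix.single (fun _ => false) (fun _ => false) 1
  head := 0
  copies := 0
  gates := 0

/-- The machine has halted with the bit string `s`, and nothing else, on stack `0`. -/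
def Config.Outputs {n k : ℕ} (c : Config n k) (s : Cube n) : Prop :=
  c.code = [] ∧ c.stk 0 = encode (List.ofFn s)

open Classical in
/-- The probability that after `T` steps the machine has halted with an output in `S`. -/
def outputProb {n k : ℕ} (P : Cmd k) (ε δ : ℝ) (ρ : QOp (n + 1)) (T : ℕ) (S : Set (Cube n)) : ℝ :=
  ((branches ρ T (initial P n ε δ)).map fun c =>
    if ∃ s ∈ S, c.Outputs s then c.weight else 0).sum

/-! ### Agnostic learning -/

/-- The `α`-agnostic learning criterion at accuracy `ε` and confidence `δ`, for the benchmark class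
`B`, the model class `M` and the distribution class `𝔇`; here `law D S` is the probability that the
learner, with access to the oracle for `D`, outputs a model in `S`. -/
def IsAgnosticLearner {n : ℕ} (α ε δ : ℝ) (B M : Set (Cube n → Bool))
    (𝔇 : Set (PMF (Cube n × Bool)))
    (law : PMF (Cube n × Bool) → Set (Cube n → Bool) → ℝ) : Prop :=
  ∀ D ∈ 𝔇, 1 - δ ≤ law D {m | m ∈ M ∧ err D m ≤ α * opt D B + ε}

/-- A proper learner: the models belong to the benchmark class. -/
def IsProperAgnosticLearner {n : ℕ} (α ε δ : ℝ) (B : Set (Cube n → Bool))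
    (𝔇 : Set (PMF (Cube n × Bool)))
    (law : PMF (Cube n × Bool) → Set (Cube n → Bool) → ℝ) : Prop :=
  ∃ M, M ⊆ B ∧ IsAgnosticLearner α ε δ B M 𝔇 law

/-- The complexity parameter `log(1/(δ ε²)) / ε⁴`. -/
def cplx (ε δ : ℝ) : ℝ := Real.log (1 / (δ * ε ^ 2)) / ε ^ 4

end AgnosticParity

end

open AgnosticParity

noncomputable section

namespace AgnosticParity

open scoped Matrix

/-! ### Reachability and deterministic fragments -/

/-! Write c(s) = 1 - 2 err(s) for the correlation of the labels with the parity s. If every qubit of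
|ψ_f⟩ gets a Hadamard gate and is then measured, the outcome (s, 1) has probability f̂(s)²/2. Since
c(s) is the mean of f̂(s) over f, Jensen's inequality gives the mixture at least c(s)²/2 on (s, 1)
(`half_corr_sq_le`). These probabilities sum to at most 1, so ∑ c(s)² ≤ 2 (`sum_corr_sq_le`).
Measuring without gates yields an ordinary labelled example of D (`outcomeProb_false`).

Let ε < 1/2, let k be `numEntries`, which lies between 4/ε² and 12/ε², and let m be `numSamples`, of
order log(1/(δε²))/ε². The learner feeds m Fourier outcomes to a Misra-Gries summary with k
counters, which retains every string of frequency above 1/(k+1) (`MGInv.mem`). It then tests the k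
surviving candidates on m labelled examples and outputs one with the most agreements. Let t be an
optimal parity. If c(t) ≥ ε, then t has probability at least ε²/2 in each Fourier sample and
survives with high probability. If c(t) < ε, every parity has error above (1-ε)/2, and among any k ≥
4/ε² distinct candidates some u has c(u)² ≤ 2/k ≤ ε²/2, hence error close to 1/2. Either way some
candidate is within 7ε/8 of optimal (`exists_good_entry`), and estimating all candidates to within
ε/16 costs at most another ε/8 (`err_learn_le`). Chernoff bounds and a union bound over the k
candidates give confidence 1-δ (`learn_prob`, `failure_le`).

Retaining k candidates instead of all m outcomes keeps the work at n·k·m up to the width of a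
counter, which is linear in log(1/δ): k·m is of order M, and a counter has O(log(2+M)) bits
(`work_le`, `size_numSamples_le`). The condition on ε gives 12/ε² < 2^n, so that the table can start
with k distinct keys. For ε ≥ 1/2 the parameters k and m vanish and a fixed parity is output; this
suffices because under a uniform marginal two parities differ with probability at most 1/2
(`err_parity_le`).

The rest is a verification of an explicit program. `Det` is a Hoare-style rule for stretches that
leave the quantum register alone, and `Prob` is its probabilistic counterpart, in which a branch
carries its weight and an abstract outcome. Sequencing composes expectations (`Prob.seq`), so the
output probability of the machine equals an iterated expectation over independent samples
(`run_learner`), to which the probabilistic analysis applies. -/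

/-- Within at most `t` steps along every branch, the configuration `c` evolves into the
configurations of the list. -/
def Reach {n k : ℕ} (ρ : QOp (n + 1)) : ℕ → Config n k → List (Config n k) → Prop
  | 0, c, L => L = [c]
  | t + 1, c, L => L = [c] ∨
      ∃ Ls : List (List (Config n k)), List.Forall₂ (Reach ρ t) (step ρ c) Ls ∧ L = Ls.flatten

section

variable {n k : ℕ} {ρ : QOp (n + 1)}

theorem Reach.refl (t : ℕ) (c : Config n k) : Reach ρ t c [c] := by
  cases t with
  | zero => rfl
  | succ t => exact Or.inl rfl

theorem Reach.succ {t : ℕ} : ∀ {c : Config n k} {L : List (Config n k)}, Reach ρ t c L →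
    Reach ρ (t + 1) c L := by
  induction t with
  | zero => intro c L h; exact Or.inl h
  | succ t ih =>
    rintro c L (h | ⟨Ls, h, rfl⟩)
    · exact Or.inl h
    · exact Or.inr ⟨Ls, h.imp fun _ _ => ih, rfl⟩

theorem Reach.mono {t t' : ℕ} {c : Config n k} {L : List (Config n k)} (h : Reach ρ t c L)
    (ht : t ≤ t') : Reach ρ t' c L := by
  induction ht with
  | refl => exact h
  | step _ ih => exact ih.succ

theorem forall₂_flatten_split {α β : Type*} {R : α → β → Prop} : ∀ {Ls : List (List α)}
    {M : List β}, List.Forall₂ R Ls.flatten M →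
    ∃ Ms : List (List β), List.Forall₂ (List.Forall₂ R) Ls Ms ∧ Ms.flatten = M
  | [], M, h => by
    cases h
    exact ⟨[], .nil, rfl⟩
  | l :: Ls, M, h => by
    obtain ⟨M₁, M₂, h1, h2, rfl⟩ : ∃ M₁ M₂, List.Forall₂ R l M₁ ∧ List.Forall₂ R Ls.flatten M₂ ∧
        M = M₁ ++ M₂ :=
      ⟨M.take l.length, M.drop l.length, by simpa using List.forall₂_take l.length h,
        by simpa using List.forall₂_drop l.length h, (List.take_append_drop _ _).symm⟩
    obtain ⟨Ms, h3, rfl⟩ := forall₂_flatten_split h2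
    exact ⟨M₁ :: Ms, .cons h1 h3, rfl⟩

/-- Branches may need different numbers of steps; only uniform bounds are added. The continuations
of all leaves are regrouped along the children of the root by `forall₂_flatten_split`, which lets
the induction run. -/
theorem Reach.trans {t t' : ℕ} : ∀ {c : Config n k} {L : List (Config n k)}
    {Ms : List (List (Config n k))}, Reach ρ t c L → List.Forall₂ (Reach ρ t') L Ms →
    Reach ρ (t + t') c Ms.flatten := by
  induction t with
  | zero =>
    rintro c L Ms rfl h
    obtain ⟨M, Ms, h, ⟨⟩, rfl⟩ := List.forall₂_cons_left_iff.1 h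
    simpa using h
  | succ t ih =>
    rintro c L Ms (rfl | ⟨Ls, hL, rfl⟩) h
    · obtain ⟨M, Ms, h', ⟨⟩, rfl⟩ := List.forall₂_cons_left_iff.1 h
      simpa using Reach.mono h' (by omega)
    · obtain ⟨Ns, h1, rfl⟩ := forall₂_flatten_split h
      rw [show t + 1 + t' = t + t' + 1 by omega]
      refine Or.inr ⟨Ns.map List.flatten, ?_, by simp [List.flatten_flatten]⟩
      clear h
      generalize AgnosticParity.step ρ c = cs at hL
      induction hL generalizing Ns with
      | nil => cases h1; exact .nil
      | cons a _ ih' =>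
        obtain ⟨N, Ns, h2, h3, rfl⟩ := List.forall₂_cons_left_iff.1 h1
        exact .cons (ih a h2) (ih' _ h3)

theorem Reach.det {t : ℕ} {c c' : Config n k} {L : List (Config n k)}
    (hs : AgnosticParity.step ρ c = [c']) (h : Reach ρ t c' L) : Reach ρ (t + 1) c L :=
  Or.inr ⟨[L], by rw [hs]; exact .cons h .nil, by simp⟩

theorem Reach.trans_single {t t' : ℕ} {c c' : Config n k} {L : List (Config n k)}
    (h : Reach ρ t c [c']) (h' : Reach ρ t' c' L) : Reach ρ (t + t') c L := by
  simpa using h.trans (.cons h' .nil)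

theorem branches_halted {c : Config n k} (hc : c.code = []) (T : ℕ) : branches ρ T c = [c] := by
  induction T with
  | zero => rfl
  | succ T ih => simp [branches, step, hc, ih]

/-- A halted configuration steps to itself, so branches that finish early simply wait, and an upper
bound on the time may be read as an exact time. -/
theorem Reach.branches_eq {t : ℕ} : ∀ {c : Config n k} {L : List (Config n k)}, Reach ρ t c L →
    (∀ c' ∈ L, c'.code = []) → branches ρ t c = L := by
  induction t with
  | zero => rintro c L rfl _; rfl
  | succ t ih =>
    rintro c L (rfl | ⟨Ls, h, rfl⟩) hL
    · exact branches_halted (hL c (by simp)) _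
    · simp only [branches]
      generalize AgnosticParity.step ρ c = cs at h
      induction h with
      | nil => rfl
      | cons a _ ih' =>
        rw [List.flatMap_cons, List.flatten_cons, ih a fun d hd => hL d (by simp [hd]),
          ih' fun d hd => hL d (by rw [List.flatten_cons]; exact List.mem_append_right _ hd)]

/-! ### Memory in terms of time. -/

theorem space_update_le (S : Fin (k + 1) → List Sym) (i : Fin (k + 1)) (l : List Sym)
    (hl : l.length ≤ (S i).length + 1) :
    ∑ j, (Function.update S i l j).length ≤ (∑ j, (S j).length) + 1 := by
  classical
  rw [← Finset.add_sum_erase _ _ (Finset.mem_univ i),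
    ← Finset.add_sum_erase _ (fun j => (S j).length) (Finset.mem_univ i)]
  have : ∑ j ∈ Finset.univ.erase i, (Function.update S i l j).length
      = ∑ j ∈ Finset.univ.erase i, (S j).length :=
    Finset.sum_congr rfl fun j hj => by rw [Function.update_of_ne (Finset.ne_of_mem_erase hj)]
  rw [this, Function.update_self]
  omega

theorem space_step_le {c c' : Config n k} (h : c' ∈ step ρ c) : c'.space ≤ c.space + 1 := by
  obtain ⟨code, S, reg, head, cp, g⟩ := c
  rcases code with _ | ⟨p, r⟩
  · simp only [step, List.mem_singleton] at h
    subst h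
    exact Nat.le_succ _
  cases p <;> simp only [step, List.mem_singleton, List.mem_map] at h
  case measure i =>
    obtain ⟨b, _, rfl⟩ := h
    exact space_update_le _ _ _ (by simp)
  case push i a => subst h; exact space_update_le _ _ _ (by simp)
  case pop i => subst h; exact space_update_le _ _ _ (by simp only [List.length_tail]; omega)
  all_goals subst h; exact Nat.le_succ _

/-- No separate analysis of the memory is needed: it is at most the length of the input plus the
running time. -/
theorem space_branches_le (t : ℕ) : ∀ {c c' : Config n k}, c' ∈ branches ρ t c →
    c'.space ≤ c.space + t := by
  induction t with
  | zero => intro c c' h; simp only [branches, List.mem_singleton] at h; subst h; exact le_rfl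
  | succ t ih =>
    intro c c' h
    obtain ⟨d, hd, hc'⟩ := List.mem_flatMap.1 h
    have := ih hc'
    have := space_step_le hd
    omega

end

/-- The program turns the stacks `S` into `S'` within `t` steps, without touching the register. -/
def Det {k : ℕ} (p : Cmd k) (S S' : Fin (k + 1) → List Sym) (t : ℕ) : Prop :=
  ∀ (n : ℕ) (ρ : QOp (n + 1)) (r : List (Cmd k)) (reg : QOp (n + 1)) (head : Fin (n + 1))
    (cp g : ℕ), Reach ρ t ⟨p :: r, S, reg, head, cp, g⟩ [⟨r, S', reg, head, cp, g⟩]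

section

variable {k : ℕ} {S S' S'' : Fin (k + 1) → List Sym} {p q : Cmd k} {t t' : ℕ}

theorem Det.of_eq (h : Det p S S' t) (hS : S' = S'') (ht : t ≤ t') : Det p S S'' t' := by
  subst hS
  exact fun n ρ r reg head cp g => (h n ρ r reg head cp g).mono ht

theorem Det.mono (h : Det p S S' t) (ht : t ≤ t') : Det p S S' t' := h.of_eq rfl ht

theorem det_skip : Det .skip S S 1 := fun _ _ _ _ _ _ _ => Reach.det rfl (Reach.refl 0 _)

theorem det_push (i : Fin (k + 1)) (a : Sym) :
    Det (.push i a) S (Function.update S i (a :: S i)) 1 :=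
  fun _ _ _ _ _ _ _ => Reach.det rfl (Reach.refl 0 _)

theorem det_pop (i : Fin (k + 1)) : Det (.pop i) S (Function.update S i (S i).tail) 1 :=
  fun _ _ _ _ _ _ _ => Reach.det rfl (Reach.refl 0 _)

theorem Det.seq (hp : Det p S S' t) (hq : Det q S' S'' t') : Det (.seq p q) S S'' (t + t' + 1) :=
  fun n ρ r reg head cp g => Reach.det rfl
    ((hp n ρ (q :: r) reg head cp g).trans_single (hq n ρ r reg head cp g))

theorem Det.ite_true {i : Fin (k + 1)} {test : Option Sym → Bool} (h : test (S i).head? = true)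
    (hp : Det p S S' t) : Det (.ite i test p q) S S' (t + 1) :=
  fun n ρ r reg head cp g => Reach.det (by simp only [step, h, if_true])
    (hp n ρ r reg head cp g)

theorem Det.ite_false {i : Fin (k + 1)} {test : Option Sym → Bool} (h : test (S i).head? = false)
    (hq : Det q S S' t) : Det (.ite i test p q) S S' (t + 1) :=
  fun n ρ r reg head cp g => Reach.det (by simp only [step, h]; rfl)
    (hq n ρ r reg head cp g)

theorem reach_loop_done {n : ℕ} {ρ : QOp (n + 1)} {i : Fin (k + 1)} {test : Option Sym → Bool}
    (h : test (S i).head? = false) (r : List (Cmd k)) (reg : QOp (n + 1)) (head : Fin (n + 1))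
    (cp g : ℕ) : Reach ρ 1 ⟨.loop i test p :: r, S, reg, head, cp, g⟩ [⟨r, S, reg, head, cp, g⟩] :=
  Reach.det (by simp only [step, h]; rfl) (Reach.refl 0 _)

theorem Reach.loop_step {n : ℕ} {ρ : QOp (n + 1)} {i : Fin (k + 1)} {test : Option Sym → Bool}
    (h : test (S i).head? = true) {r : List (Cmd k)} {reg : QOp (n + 1)} {head : Fin (n + 1)}
    {cp g : ℕ} {L : List (Config n k)}
    (hL : Reach ρ t ⟨p :: .loop i test p :: r, S, reg, head, cp, g⟩ L) :
    Reach ρ (t + 1) ⟨.loop i test p :: r, S, reg, head, cp, g⟩ L :=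
  Reach.det (by simp only [step, h, if_true]) hL

theorem det_loop_done {i : Fin (k + 1)} {test : Option Sym → Bool}
    (h : test (S i).head? = false) : Det (.loop i test p) S S 1 :=
  fun _ _ r reg head cp g => reach_loop_done h r reg head cp g

theorem Det.loop_step {i : Fin (k + 1)} {test : Option Sym → Bool}
    (h : test (S i).head? = true) (hp : Det p S S' t) (hl : Det (.loop i test p) S' S'' t') :
    Det (.loop i test p) S S'' (t + t' + 1) :=
  fun n ρ r reg head cp g => Reach.loop_step h
    ((hp n ρ (.loop i test p :: r) reg head cp g).trans_single (hl n ρ r reg head cp g))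

/-! ### Elementary stack programs -/

/-- The stack is nonempty. -/
def tSome : Option Sym → Bool := Option.isSome

/-- The top symbol is a bit. -/
def tBit : Option Sym → Bool
  | some (.bit _) => true
  | _ => false

/-- The top symbol is the bit `b`. -/
def tIs (b : Bool) : Option Sym → Bool
  | some (.bit c) => c == b
  | _ => false

/-- Push a copy of the top of `i`, a nonempty stack, on `j`. -/
def dup (i j : Fin (k + 1)) : Cmd k :=
  .ite i (tIs true) (.push j (.bit true))
    (.ite i (tIs false) (.push j (.bit false)) (.push j .sep))

/-- Move the top of the nonempty stack `i` to `j`. -/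
def move (i j : Fin (k + 1)) : Cmd k := .seq (dup i j) (.pop i)

theorem det_dup {i j : Fin (k + 1)} {a : Sym} {l : List Sym} (h : S i = a :: l) :
    Det (dup i j) S (Function.update S j (a :: S j)) 3 := by
  rcases a with b | _
  · cases b
    · exact (Det.ite_false (by simp [h, tIs]) (Det.ite_true (by simp [h, tIs]) (det_push j _)))
    · exact (Det.ite_true (by simp [h, tIs]) (det_push j _)).mono (by omega)
  · exact (Det.ite_false (by simp [h, tIs]) (Det.ite_false (by simp [h, tIs]) (det_push j _)))

theorem det_move {i j : Fin (k + 1)} (hij : i ≠ j) {a : Sym} {l : List Sym} (h : S i = a :: l) :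
    Det (move i j) S (Function.update (Function.update S i l) j (a :: S j)) 5 :=
  ((det_dup h).seq (det_pop i)).of_eq
    (by rw [Function.update_of_ne hij, h, List.tail_cons, Function.update_comm hij]) (by omega)

/-- Move symbols from `i` to `j` as long as the test succeeds. -/
def moveWhile (test : Option Sym → Bool) (i j : Fin (k + 1)) : Cmd k := .loop i test (move i j)

/-- Move symbols from `i` to `j` as long as the test succeeds, with a second copy on `o`. -/
def moveDup (test : Option Sym → Bool) (i j o : Fin (k + 1)) : Cmd k :=
  .loop i test (.seq (dup i o) (move i j))

/-- Remove symbols from `i` as long as the test succeeds. -/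
def clearWhile (test : Option Sym → Bool) (i : Fin (k + 1)) : Cmd k := .loop i test (.pop i)

theorem det_moveWhile {test : Option Sym → Bool} {i j : Fin (k + 1)} (hij : i ≠ j)
    {l r : List Sym} (hl : ∀ a ∈ l, test (some a) = true) (hr : test r.head? = false)
    (h : S i = l ++ r) :
    Det (moveWhile test i j) S
      (Function.update (Function.update S i r) j (l.reverse ++ S j)) (6 * l.length + 1) := by
  induction l generalizing S with
  | nil =>
    refine (det_loop_done (by simpa [h] using hr)).of_eq ?_ (by simp)
    simp only [List.nil_append] at h
    simp [← h]
  | cons a l ih =>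
    refine (Det.loop_step (by simpa [h] using hl a (by simp)) (det_move hij h)
      (ih (fun b hb => hl b (by simp [hb])) (by simp [Function.update_of_ne hij]))).of_eq ?_
      (by simp; omega)
    rw [Function.update_comm hij.symm]
    simp

theorem det_moveDup {test : Option Sym → Bool} {i j o : Fin (k + 1)} (hij : i ≠ j) (hio : i ≠ o)
    (hjo : j ≠ o) {l r : List Sym} (hl : ∀ a ∈ l, test (some a) = true)
    (hr : test r.head? = false) (h : S i = l ++ r) :
    Det (moveDup test i j o) S
      (Function.update (Function.update (Function.update S i r) j (l.reverse ++ S j)) o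
        (l.reverse ++ S o)) (10 * l.length + 1) := by
  induction l generalizing S with
  | nil =>
    refine (det_loop_done (by simpa [h] using hr)).of_eq ?_ (by simp)
    simp only [List.nil_append] at h
    simp [← h]
  | cons a l ih =>
    refine (Det.loop_step (by simpa [h] using hl a (by simp))
      ((det_dup h).seq (det_move hij (by rw [Function.update_of_ne hio]; exact h)))
      (ih (fun b hb => hl b (by simp [hb])) (by simp [Function.update_of_ne hij]))).of_eq ?_
      (by simp; omega)
    funext x
    simp only [Function.update_apply, List.reverse_cons, List.append_assoc, List.singleton_append]
    have := hij.symm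
    have := hio.symm
    have := hjo.symm
    split_ifs <;> simp_all

theorem det_clearWhile {test : Option Sym → Bool} {i : Fin (k + 1)}
    {l r : List Sym} (hl : ∀ a ∈ l, test (some a) = true) (hr : test r.head? = false)
    (h : S i = l ++ r) :
    Det (clearWhile test i) S (Function.update S i r) (2 * l.length + 1) := by
  induction l generalizing S with
  | nil =>
    refine (det_loop_done (by simpa [h] using hr)).of_eq ?_ (by simp)
    simp only [List.nil_append] at h
    simp [← h]
  | cons a l ih =>
    refine (Det.loop_step (by simpa [h] using hl a (by simp)) (det_pop i)
      (ih (fun b hb => hl b (by simp [hb])) (by simp [h]))).of_eq ?_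
      (by simp; omega)
    simp

theorem tSome_some (a : Sym) : tSome (some a) = true := rfl

theorem tBit_of_mem_encode {l : List Bool} : ∀ a ∈ encode l, tBit (some a) = true := by
  intro a ha
  obtain ⟨b, _, rfl⟩ := List.mem_map.1 ha
  rfl

/-- Move the whole stack `i` to `j`. -/
def moveAll (i j : Fin (k + 1)) : Cmd k := moveWhile tSome i j

theorem det_moveAll {i j : Fin (k + 1)} (hij : i ≠ j) :
    Det (moveAll i j) S (Function.update (Function.update S i []) j ((S i).reverse ++ S j))
      (6 * (S i).length + 1) :=
  det_moveWhile hij (fun a _ => tSome_some a) rfl (by simp)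

theorem det_clear {i : Fin (k + 1)} :
    Det (clearWhile tSome i) S (Function.update S i []) (2 * (S i).length + 1) :=
  det_clearWhile (fun a _ => tSome_some a) rfl (by simp)

/-- Replace the top of `i` by the bit `b`. -/
def setBit (i : Fin (k + 1)) (b : Bool) : Cmd k := .seq (.pop i) (.push i (.bit b))

theorem det_setBit {i : Fin (k + 1)} {b : Bool} :
    Det (setBit i b) S (Function.update S i (.bit b :: (S i).tail)) 3 :=
  ((det_pop i).seq (det_push i _)).of_eq (by simp) (by omega)

/-- Push `c` copies of the bit `true`. -/
def pushN (i : Fin (k + 1)) : ℕ → Cmd k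
  | 0 => .skip
  | c + 1 => .seq (.push i (.bit true)) (pushN i c)

/-- A unary number. -/
def unary (c : ℕ) : List Sym := List.replicate c (.bit true)

theorem unary_succ (c : ℕ) : unary (c + 1) = .bit true :: unary c := rfl

theorem unary_add (a b : ℕ) : unary (a + b) = unary a ++ unary b := by
  simp [unary]

theorem reverse_unary (c : ℕ) : (unary c).reverse = unary c := by simp [unary]

theorem length_unary (c : ℕ) : (unary c).length = c := by simp [unary]

theorem det_pushN {i : Fin (k + 1)} (c : ℕ) :
    Det (pushN i c) S (Function.update S i (unary c ++ S i)) (2 * c + 1) := by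
  induction c generalizing S with
  | zero => exact det_skip.of_eq (by simp [unary]) (by omega)
  | succ c ih =>
    refine ((det_push i _).seq ih).of_eq ?_ (by omega)
    rw [unary_add]
    simp [unary]

/-- For each symbol of `i`, which is consumed, and each symbol of `j`, push `c` symbols on `o`;
the stack `l` is used to restore `j`. -/
def mulStacks (i j l o : Fin (k + 1)) (c : ℕ) : Cmd k :=
  .loop i tSome (.seq (.pop i)
    (.seq (.loop j tSome (.seq (move j l) (pushN o c))) (moveAll l j)))

theorem det_mulStacks_inner {j l o : Fin (k + 1)} (hjl : j ≠ l) (hjo : j ≠ o) (hlo : l ≠ o)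
    {b : ℕ} (c : ℕ) (h : S j = unary b) :
    Det (.loop j tSome (.seq (move j l) (pushN o c))) S
      (Function.update (Function.update (Function.update S j []) l (unary b ++ S l)) o
        (unary (b * c) ++ S o)) (b * (2 * c + 8) + 1) := by
  induction b generalizing S with
  | zero =>
    refine (det_loop_done (by simp [h, unary, tSome])).of_eq ?_ (by simp)
    have : Function.update S j [] = S := Function.update_eq_self_iff.2 (by simp [h, unary])
    simp [unary, this]
  | succ b ih =>
    refine (Det.loop_step (by simp [h, unary_succ, tSome])
      ((det_move hjl h).seq (det_pushN c))
      (ih (by simp [Function.update_of_ne hjl, Function.update_of_ne hjo, unary]))).of_eq ?_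
      (le_of_eq (by ring))
    have e1 : unary ((b + 1) * c) = unary (b * c) ++ unary c := by rw [Nat.succ_mul, unary_add]
    have e2 : unary (b + 1) = unary b ++ [.bit true] := by rw [unary_add]; rfl
    funext x
    simp only [Function.update_apply, e1, e2, List.append_assoc, List.singleton_append]
    have := hjl.symm
    have := hjo.symm
    have := hlo.symm
    split_ifs <;> simp_all

theorem det_mulStacks {i j l o : Fin (k + 1)} (hij : i ≠ j) (hil : i ≠ l) (hio : i ≠ o)
    (hjl : j ≠ l) (hjo : j ≠ o) (hlo : l ≠ o)
    {a b : ℕ} (c : ℕ) (hi : S i = unary a) (hj : S j = unary b) (hl : S l = []) :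
    Det (mulStacks i j l o c) S
      (Function.update (Function.update S i []) o (unary (a * b * c) ++ S o))
      (a * (b * (2 * c + 14) + 6) + 1) := by
  induction a generalizing S with
  | zero =>
    refine (det_loop_done (by simp [hi, unary, tSome])).of_eq ?_ (by simp)
    have : Function.update S i [] = S := Function.update_eq_self_iff.2 (by simp [hi, unary])
    simp [unary, this]
  | succ a ih =>
    have hj' : Function.update S i (S i).tail j = unary b := by
      rw [Function.update_of_ne hij.symm, hj]
    refine (Det.loop_step (by simp [hi, unary_succ, tSome])
      ((det_pop i).seq ((det_mulStacks_inner hjl hjo hlo c hj').seq (det_moveAll hjl.symm)))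
      (ih ?_ ?_ ?_)).of_eq ?_ ?_
    · simp [Function.update_apply, hij, hil, hio, hi, unary_succ]
    · simp [Function.update_apply, hil.symm, hjl, hlo, hl, reverse_unary, hjo]
    · simp [Function.update_apply, hjl.symm]
    · have e1 : unary ((a + 1) * b * c) = unary (a * b * c) ++ unary (b * c) := by
        rw [← unary_add]; congr 1; ring
      funext x
      simp only [Function.update_apply, e1]
      have := hij.symm
      have := hil.symm
      have := hio.symm
      have := hjl.symm
      have := hjo.symm
      have := hlo.symm
      split_ifs <;> simp_all [reverse_unary]
    · simp only [Function.update_apply, hlo, hil.symm, hl, if_true, if_false, List.append_nil,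
        length_unary]
      ring_nf
      omega

end

/-! ### Expectations over independent words -/

/-- The expectation of `V` over lists of `m` independent draws from the weights `q`. -/
def iidExp {W : Type*} [Fintype W] (q : W → ℝ) : ℕ → (List W → ℝ) → ℝ
  | 0, V => V []
  | m + 1, V => ∑ w, q w * iidExp q m fun l => V (w :: l)

/-! ### Programs with measurements -/

/-- From the stacks `S` and head `0` the program takes at most `t` steps, `a` copies and `g` gates
and ends with head `0`; each branch is tagged with an outcome `x` that is related to its stacks by
`Post`, and `E V` is the expectation of `V` at the outcome. -/
def Prob {n k : ℕ} {α : Type} (ρ : QOp (n + 1)) (p : Cmd k) (S : Fin (k + 1) → List Sym)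
    (t a g : ℕ) (Post : α → (Fin (k + 1) → List Sym) → Prop) (E : (α → ℝ) → ℝ) : Prop :=
  ∀ (r : List (Cmd k)) (reg : QOp (n + 1)) (a₀ g₀ : ℕ), ∃ L : List (Config n k × α),
    Reach ρ t ⟨p :: r, S, reg, 0, a₀, g₀⟩ (L.map Prod.fst) ∧
    (∀ c ∈ L, c.1.code = r ∧ c.1.head = 0 ∧ c.1.copies ≤ a₀ + a ∧ c.1.gates ≤ g₀ + g ∧
      Post c.2 c.1.stk) ∧
    ∀ V, (L.map fun c => c.1.weight * V c.2).sum = reg.trace.re * E V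

section

variable {n k : ℕ} {ρ : QOp (n + 1)} {p q : Cmd k} {S S' : Fin (k + 1) → List Sym}
  {t t' a a' g g' : ℕ} {α β : Type} {Post : α → (Fin (k + 1) → List Sym) → Prop}
  {Post' : β → (Fin (k + 1) → List Sym) → Prop} {E : (α → ℝ) → ℝ}

theorem Prob.of_le {Post₁ : α → (Fin (k + 1) → List Sym) → Prop} (h : Prob ρ p S t a g Post E)
    (ht : t ≤ t') (ha : a ≤ a') (hg : g ≤ g') (hP : ∀ x S, Post x S → Post₁ x S) :
    Prob ρ p S t' a' g' Post₁ E := by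
  intro r reg a₀ g₀
  obtain ⟨L, h1, h2, h3⟩ := h r reg a₀ g₀
  refine ⟨L, h1.mono ht, fun c hc => ?_, h3⟩
  obtain ⟨e1, e2, e3, e4, e5⟩ := h2 c hc
  exact ⟨e1, e2, by omega, by omega, hP _ _ e5⟩

theorem Prob.map (h : Prob ρ p S t a g Post E) (f : α → β) (hP : ∀ x S, Post x S → Post' (f x) S) :
    Prob ρ p S t a g Post' (fun V => E fun x => V (f x)) := by
  intro r reg a₀ g₀
  obtain ⟨L, h1, h2, h3⟩ := h r reg a₀ g₀
  refine ⟨L.map fun c => (c.1, f c.2), by simpa [Function.comp_def] using h1, ?_, fun V => ?_⟩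
  · intro c hc
    obtain ⟨d, hd, rfl⟩ := List.mem_map.1 hc
    obtain ⟨e1, e2, e3, e4, e5⟩ := h2 d hd
    exact ⟨e1, e2, e3, e4, hP _ _ e5⟩
  · rw [← h3, List.map_map]
    rfl

theorem Det.prob (h : Det p S S' t) (x : α) :
    Prob ρ p S t 0 0 (fun y X => y = x ∧ X = S') (fun V => V x) := by
  intro r reg a₀ g₀
  exact ⟨[(_, x)], h n ρ r reg 0 a₀ g₀, by simp, by simp [Config.weight]⟩

theorem sum_map_flatMap {α β : Type*} (L : List α) (f : α → List β) (V : β → ℝ) :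
    ((L.flatMap f).map V).sum = (L.map fun x => ((f x).map V).sum).sum := by
  induction L with
  | nil => simp
  | cons x L ih => simp [ih]

/-- This is the law of total expectation on the tree of branches. The rule for `q` holds for every
register content and scales with its trace, so the weight of a branch is the only thing its
continuation inherits. Sequencing and loop unfolding differ only in the first machine step and share
this lemma. -/
theorem Prob.bind_reach {c₀ : Config n k} {r : List (Cmd k)} {L : List (Config n k × α)}
    {a₀ g₀ : ℕ} {w : ℝ} {E' : α → (β → ℝ) → ℝ} (h1 : Reach ρ t c₀ (L.map Prod.fst))
    (h2 : ∀ c ∈ L, c.1.code = q :: r ∧ c.1.head = 0 ∧ c.1.copies ≤ a₀ + a ∧ c.1.gates ≤ g₀ + g ∧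
      Post c.2 c.1.stk)
    (h3 : ∀ V, (L.map fun c => c.1.weight * V c.2).sum = w * E V)
    (hq : ∀ x S', Post x S' → Prob ρ q S' t' a' g' Post' (E' x)) :
    ∃ L' : List (Config n k × β), Reach ρ (t + t') c₀ (L'.map Prod.fst) ∧
      (∀ c ∈ L', c.1.code = r ∧ c.1.head = 0 ∧ c.1.copies ≤ a₀ + (a + a') ∧
        c.1.gates ≤ g₀ + (g + g') ∧ Post' c.2 c.1.stk) ∧
      ∀ V, (L'.map fun c => c.1.weight * V c.2).sum = w * E fun x => E' x V := by
  have key : ∀ c : Config n k × α, ∃ Lc : List (Config n k × β), c ∈ L →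
      Reach ρ t' c.1 (Lc.map Prod.fst) ∧
      (∀ d ∈ Lc, d.1.code = r ∧ d.1.head = 0 ∧ d.1.copies ≤ c.1.copies + a' ∧
        d.1.gates ≤ c.1.gates + g' ∧ Post' d.2 d.1.stk) ∧
      ∀ V, (Lc.map fun d => d.1.weight * V d.2).sum = c.1.weight * E' c.2 V := by
    intro c
    by_cases hc : c ∈ L
    · obtain ⟨e1, e2, -, -, e5⟩ := h2 c hc
      obtain ⟨Lc, f⟩ := hq c.2 c.1.stk e5 r c.1.reg c.1.copies c.1.gates
      refine ⟨Lc, fun _ => ?_⟩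
      rw [← e1, ← e2] at f
      refine ⟨f.1, ?_, f.2.2⟩
      intro d hd
      have := f.2.1 d hd
      rwa [e2] at this
    · exact ⟨[], fun h => absurd h hc⟩
  choose F hF using key
  refine ⟨L.flatMap F, ?_, fun d hd => ?_, fun V => ?_⟩
  · have : (L.flatMap F).map Prod.fst = L.flatMap fun c => (F c).map Prod.fst := List.map_flatMap
    rw [this]
    rw [List.flatMap_def]
    refine h1.trans ?_
    rw [List.forall₂_map_left_iff, List.forall₂_map_right_iff, List.forall₂_same]
    exact fun c hc => (hF c hc).1
  · obtain ⟨c, hc, hd⟩ := List.mem_flatMap.1 hd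
    obtain ⟨e1, e2, e3, e4, e5⟩ := (hF c hc).2.1 d hd
    obtain ⟨-, -, f3, f4, -⟩ := h2 c hc
    exact ⟨e1, e2, by omega, by omega, e5⟩
  · rw [sum_map_flatMap, ← h3]
    exact congrArg List.sum (List.map_congr_left fun c hc => (hF c hc).2.2 V)

theorem Prob.seq {E' : α → (β → ℝ) → ℝ} (hp : Prob ρ p S t a g Post E)
    (hq : ∀ x S', Post x S' → Prob ρ q S' t' a' g' Post' (E' x)) :
    Prob ρ (.seq p q) S (t + t' + 1) (a + a') (g + g') Post' (fun V => E fun x => E' x V) := by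
  intro r reg a₀ g₀
  obtain ⟨L, h1, h2, h3⟩ := hp (q :: r) reg a₀ g₀
  obtain ⟨L', f1, f2⟩ := Prob.bind_reach h1 h2 h3 hq
  exact ⟨L', Reach.det rfl f1, f2⟩

theorem Prob.loop_step {i : Fin (k + 1)} {test : Option Sym → Bool} {E' : α → (β → ℝ) → ℝ}
    (h : test (S i).head? = true) (hp : Prob ρ p S t a g Post E)
    (hq : ∀ x S', Post x S' → Prob ρ (.loop i test p) S' t' a' g' Post' (E' x)) :
    Prob ρ (.loop i test p) S (t + t' + 1) (a + a') (g + g') Post'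
      (fun V => E fun x => E' x V) := by
  intro r reg a₀ g₀
  obtain ⟨L, h1, h2, h3⟩ := hp (.loop i test p :: r) reg a₀ g₀
  obtain ⟨L', f1, f2⟩ := Prob.bind_reach h1 h2 h3 hq
  exact ⟨L', Reach.det (by simp only [step, h, if_true]) f1, f2⟩

/-- A loop whose body draws one word and updates an abstract state. -/
theorem prob_loop {W : Type} [Fintype W] {w : W → ℝ} {upd : α → W → α} {inv : ℕ → α → Prop}
    {st : ℕ → α → Fin (k + 1) → List Sym} {i : Fin (k + 1)}
    (h0 : ∀ x, st 0 x i = []) (h1 : ∀ j x, st (j + 1) x i ≠ [])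
    (hinv : ∀ j x y, inv (j + 1) x → inv j (upd x y))
    (hp : ∀ j x, inv (j + 1) x → Prob ρ p (st (j + 1) x) t a g
      (fun y S' => S' = st j (upd x y)) (fun V => ∑ y, w y * V y)) :
    ∀ (j : ℕ) (x : α), inv j x → Prob ρ (.loop i tSome p) (st j x) (j * (t + 1) + 1) (j * a) (j * g)
      (fun (l : List W) S' => l.length = j ∧ S' = st 0 (l.foldl upd x)) (iidExp w j) := by
  intro j
  induction j with
  | zero =>
    intro x _
    refine (Det.prob (det_loop_done (by simp [h0, tSome])) ([] : List W)).of_le (by simp) (by simp)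
      (by simp) ?_
    rintro l S ⟨rfl, rfl⟩
    exact ⟨rfl, rfl⟩
  | succ j ih =>
    intro x hx
    have hne : tSome (st (j + 1) x i).head? = true := by
      cases hs : st (j + 1) x i with
      | nil => exact absurd hs (h1 _ _)
      | cons b l => rfl
    refine (Prob.loop_step (E' := fun y V => iidExp w j fun l => V (y :: l)) hne (hp j x hx)
      (Post' := fun (l : List W) S' => l.length = j + 1 ∧ S' = st 0 (l.foldl upd x))
      (t' := j * (t + 1) + 1) (a' := j * a) (g' := j * g) ?_).of_le ?_ ?_ ?_ ?_
    · rintro y S' rfl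
      refine (ih _ (hinv _ _ _ hx)).map (fun l => y :: l) ?_
      rintro l S ⟨rfl, rfl⟩
      exact ⟨rfl, rfl⟩
    · rw [Nat.add_one_mul]; omega
    · rw [Nat.add_one_mul]; omega
    · rw [Nat.add_one_mul]; omega
    · exact fun _ _ h => h

end

/-! ### Product operators -/

/-- The tensor product of single-qubit operators. -/
def tensorOp {N : ℕ} (A : Fin N → Matrix Bool Bool ℂ) : QOp N :=
  Matrix.of fun w v => ∏ i, A i (w i) (v i)

theorem tensorOp_mul {N : ℕ} (A B : Fin N → Matrix Bool Bool ℂ) :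
    tensorOp A * tensorOp B = tensorOp fun i => A i * B i := by
  ext w v
  simp only [tensorOp, Matrix.mul_apply, Matrix.of_apply, Finset.prod_univ_sum,
    Fintype.piFinset_univ, Finset.prod_mul_distrib]

theorem tensorOp_one {N : ℕ} : tensorOp (fun _ : Fin N => 1) = (1 : QOp N) := by
  ext w v
  simp only [tensorOp, Matrix.of_apply, Matrix.one_apply, Finset.prod_ite_zero, funext_iff]
  simp

theorem tensorOp_conjTranspose {N : ℕ} (A : Fin N → Matrix Bool Bool ℂ) :
    (tensorOp A)ᴴ = tensorOp fun i => (A i)ᴴ := by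
  ext w v
  simp [tensorOp, Matrix.conjTranspose_apply]

theorem onQubit_eq_tensorOp {N : ℕ} (i : Fin N) (U : Matrix Bool Bool ℂ) :
    onQubit i U = tensorOp (Function.update (fun _ => 1) i U) := by
  ext w v
  simp only [onQubit, tensorOp, Matrix.of_apply]
  rw [← Finset.mul_prod_erase _ _ (Finset.mem_univ i), Function.update_self]
  have : ∏ x ∈ Finset.univ.erase i, Function.update (fun _ => (1 : Matrix Bool Bool ℂ)) i U x (w x)
      (v x) = ∏ x ∈ Finset.univ.erase i, if w x = v x then (1 : ℂ) else 0 :=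
    Finset.prod_congr rfl fun x hx => by
      rw [Function.update_of_ne (Finset.ne_of_mem_erase hx), Matrix.one_apply]
  rw [this, Finset.prod_ite_zero]
  simp

theorem onQubit_mul {N : ℕ} (i : Fin N) (U V : Matrix Bool Bool ℂ) :
    onQubit i U * onQubit i V = onQubit i (U * V) := by
  simp only [onQubit_eq_tensorOp, tensorOp_mul]
  congr 1
  funext j
  by_cases h : j = i
  · subst h; simp
  · simp [h]

theorem onQubit_conjTranspose {N : ℕ} (i : Fin N) (U : Matrix Bool Bool ℂ) :
    (onQubit i U)ᴴ = onQubit i Uᴴ := by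
  simp only [onQubit_eq_tensorOp, tensorOp_conjTranspose]
  congr 1
  funext j
  by_cases h : j = i
  · subst h; simp
  · simp [h]

/-- The operators applied to the qubits after the outcomes `l`, the last one first, when every qubit
is rotated by `U` before it is measured. -/
def measOp (U : Matrix Bool Bool ℂ) (N : ℕ) (l : List Bool) : Fin N → Matrix Bool Bool ℂ :=
  fun i => if h : (i : ℕ) < l.reverse.length then proj (l.reverse[(i : ℕ)]) * U else 1

/-- Qubits are measured in order, so the next one to be measured has index `l.length` and still
carries the identity factor; the new outcome fills exactly this slot. -/
theorem onQubit_mul_measOp (U : Matrix Bool Bool ℂ) {N : ℕ} (l : List Bool) (b : Bool) (i : Fin N)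
    (hi : (i : ℕ) = l.length) :
    onQubit i (proj b * U) * tensorOp (measOp U N l) = tensorOp (measOp U N (b :: l)) := by
  rw [onQubit_eq_tensorOp, tensorOp_mul]
  congr 1
  funext j
  by_cases h : j = i
  · subst h
    simp [measOp, hi]
  · have h' : (j : ℕ) ≠ l.length := fun e => h (Fin.ext (by omega))
    simp only [Function.update_of_ne h, one_mul, measOp]
    simp only [List.reverse_cons, List.length_append, List.length_reverse, List.length_singleton]
    by_cases h2 : (j : ℕ) < l.length
    · rw [dif_pos h2, dif_pos (by omega)]
      congr 2
      rw [List.getElem_append_left]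
    · rw [dif_neg h2, dif_neg (by omega)]

/-- The outcome of a register as a stack content: the last qubit on top. -/
def wordList {N : ℕ} (w : Cube N) : List Bool := (List.ofFn w).reverse

theorem length_wordList {N : ℕ} (w : Cube N) : (wordList w).length = N := by simp [wordList]

/-- Once all qubits are measured, the accumulated product is |w⟩⟨w| U^{⊗N}. The weight of the branch
is therefore a diagonal entry of the rotated state, as in the Born rule for one joint measurement.
-/
theorem trace_measOp (U : Matrix Bool Bool ℂ) {N : ℕ} (ρ : QOp N) (w : Cube N) :
    (tensorOp (measOp U N (wordList w)) * ρ * (tensorOp (measOp U N (wordList w)))ᴴ).trace =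
      (tensorOp (fun _ => U) * ρ * (tensorOp fun _ => U)ᴴ : QOp N) w w := by
  have h : tensorOp (measOp U N (wordList w)) = Matrix.single w w 1 * tensorOp (fun _ => U) := by
    have h1 : (Matrix.single w w 1 : QOp N) = tensorOp fun i => proj (w i) := by
      ext v v'
      simp only [tensorOp, proj, Matrix.of_apply, Matrix.single_apply, Finset.prod_ite_zero]
      congr 1
      · simp only [funext_iff, Finset.mem_univ, true_imp_iff, forall_and]
      · simp
    rw [h1, tensorOp_mul]
    congr 1
    funext i
    simp [measOp, wordList]
  rw [h, Matrix.conjTranspose_mul]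
  have e : Matrix.single w w 1 * tensorOp (fun _ => U) * ρ *
      ((tensorOp fun _ => U)ᴴ * (Matrix.single w w (1 : ℂ))ᴴ) =
      Matrix.single w w 1 * (tensorOp (fun _ => U) * ρ * (tensorOp fun _ => U)ᴴ) *
        Matrix.single w w 1 := by
    simp only [Matrix.mul_assoc, Matrix.conjTranspose_single, star_one]
  rw [e, Matrix.trace_mul_comm, ← Matrix.mul_assoc, Matrix.single_mul_single_same, mul_one,
    Matrix.trace_mul_comm, Matrix.trace_mul_single]
  simp

/-! ### Sampling -/

/-- The gate applied before the measurement: Hadamard, or none. -/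
def rot (fourier : Bool) : Matrix Bool Bool ℂ := if fourier then Gate.H.mat else 1

/-- The probability of the outcome `w` when every qubit of `ρ` is measured, after a Hadamard gate
or not. -/
def outcomeProb {N : ℕ} (fourier : Bool) (ρ : QOp N) (w : Cube N) : ℝ :=
  ((tensorOp (fun _ => rot fourier) * ρ * (tensorOp fun _ => rot fourier)ᴴ : QOp N) w w).re

section

variable {n k : ℕ} {ρ : QOp (n + 1)}

/-- Measure the qubit at the head and push the outcome on `x`. -/
def measureQubit (fourier : Bool) (x : Fin (k + 1)) : Cmd k :=
  .seq (if fourier then .gate .H else .skip) (.seq (.measure x) .advance)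

theorem reach_measureQubit (σ : QOp (n + 1)) (fourier : Bool) (x : Fin (k + 1)) (r : List (Cmd k))
    (S : Fin (k + 1) → List Sym) (l : List Bool) (head : Fin (n + 1)) (a g : ℕ)
    (hl : (head : ℕ) = l.length) :
    Reach ρ 5 ⟨measureQubit fourier x :: r, S, tensorOp (measOp (rot fourier) _ l) * σ *
        (tensorOp (measOp (rot fourier) _ l))ᴴ, head, a, g⟩
      ([false, true].map fun b => ⟨r, Function.update S x (.bit b :: S x),
        tensorOp (measOp (rot fourier) _ (b :: l)) * σ *
        (tensorOp (measOp (rot fourier) _ (b :: l)))ᴴ, head + 1, a, g + fourier.toNat⟩) := by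
  refine Reach.det rfl ?_
  have key : Reach ρ 3 ⟨.seq (.measure x) .advance :: r, S,
      onQubit head (rot fourier) * (tensorOp (measOp (rot fourier) _ l) * σ *
        (tensorOp (measOp (rot fourier) _ l))ᴴ) * (onQubit head (rot fourier))ᴴ, head, a,
        g + fourier.toNat⟩
      ([false, true].map fun b => ⟨r, Function.update S x (.bit b :: S x),
        tensorOp (measOp (rot fourier) _ (b :: l)) * σ *
        (tensorOp (measOp (rot fourier) _ (b :: l)))ᴴ, head + 1, a, g + fourier.toNat⟩) := by
    refine Reach.det rfl ?_
    have hb : ∀ b, onQubit head (proj b) * (onQubit head (rot fourier) *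
        (tensorOp (measOp (rot fourier) _ l) * σ * (tensorOp (measOp (rot fourier) _ l))ᴴ) *
        (onQubit head (rot fourier))ᴴ) * onQubit head (proj b) =
        tensorOp (measOp (rot fourier) _ (b :: l)) * σ *
        (tensorOp (measOp (rot fourier) _ (b :: l)))ᴴ := by
      intro b
      -- The machine multiplies by the same projector on both sides. Reading the right factor as an
      -- adjoint gives the update the form A σ Aᴴ.
      have h1 : (onQubit head (proj b) : QOp (n + 1)) = (onQubit head (proj b))ᴴ := by
        rw [onQubit_conjTranspose, proj, Matrix.conjTranspose_single, star_one]
      rw [← onQubit_mul_measOp _ l b head hl, ← onQubit_mul]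
      nth_rw 2 [h1]
      simp only [Matrix.conjTranspose_mul, Matrix.mul_assoc]
    refine Or.inr ⟨[[_], [_]], .cons (Reach.det rfl (Reach.refl 0 _))
      (.cons (Reach.det rfl (Reach.refl 0 _)) .nil), ?_⟩
    simp only [List.map_cons, List.map_nil, List.flatten_cons, List.flatten_nil, hb]
    rfl
  cases fourier
  · refine Reach.det rfl ?_
    have h1 : (onQubit head (rot false) : QOp (n + 1)) = 1 := by
      rw [onQubit_eq_tensorOp, ← tensorOp_one]
      congr 1
      funext i
      simp [rot, Function.update_apply]
    rw [h1, Matrix.conjTranspose_one, Matrix.one_mul, Matrix.mul_one] at key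
    exact key
  · exact Reach.det rfl key

/-- All extensions of a list by `m` further bits. -/
def extend : ℕ → List Bool → List (List Bool)
  | 0, l => [l]
  | m + 1, l => [false, true].flatMap fun b => extend m (b :: l)

theorem length_of_mem_extend : ∀ {m : ℕ} {l l' : List Bool}, l' ∈ extend m l →
    l'.length = m + l.length
  | 0, l, l', h => by simp only [extend, List.mem_singleton] at h; simp [h]
  | m + 1, l, l', h => by
    obtain ⟨b, _, hb⟩ := List.mem_flatMap.1 h
    have := length_of_mem_extend hb
    simp only [List.length_cons] at this
    omega

theorem extend_eq (m : ℕ) : ∀ (l : List Bool),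
    extend m l = ((extend m []).map fun u => u ++ l) := by
  induction m with
  | zero => intro l; simp [extend]
  | succ m ih =>
    intro l
    simp only [extend, List.flatMap_cons, List.flatMap_nil, List.append_nil]
    rw [ih (false :: l), ih (true :: l), ih [false], ih [true]]
    simp [Function.comp_def]

theorem sum_extend (m : ℕ) : ∀ (l : List Bool) (V : List Bool → ℝ),
    ((extend m l).map V).sum = ∑ w : Cube m, V (wordList w ++ l) := by
  induction m with
  | zero => intro l V; simp [extend, wordList]
  | succ m ih =>
    intro l V
    rw [← (Fin.consEquiv fun _ => Bool).sum_comp, Fintype.sum_prod_type]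
    simp only [extend, sum_map_flatMap, ih, Fintype.sum_bool]
    simp [wordList, List.ofFn_succ, add_comm]

/-- Load an example and measure all its qubits; the stack `i` holds the number of qubits in unary,
and the outcome appears on `x`. -/
def sample (fourier : Bool) (i j x : Fin (k + 1)) : Cmd k :=
  .seq .query (.seq (.loop i tSome (.seq (move i j) (measureQubit fourier x))) (moveAll j i))

/-- Induction on the number `m` of unmeasured qubits, with the head at position `l.length`; each
measurement splits the run in two, which matches the recursion of `extend`. -/
theorem reach_sample_loop (σ : QOp (n + 1)) (fourier : Bool) {i j x : Fin (k + 1)} (hij : i ≠ j) (hix : i ≠ x)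
    (hjx : j ≠ x) (r : List (Cmd k)) (a : ℕ) : ∀ (m : ℕ) (S : Fin (k + 1) → List Sym)
    (l : List Bool) (g : ℕ), l.length + m = n + 1 → S i = unary m →
    Reach ρ (12 * m + 1) ⟨.loop i tSome (.seq (move i j) (measureQubit fourier x)) :: r, S,
        tensorOp (measOp (rot fourier) _ l) * σ * (tensorOp (measOp (rot fourier) _ l))ᴴ,
        Fin.ofNat (n + 1) l.length, a, g⟩
      ((extend m []).map fun u => ⟨r, Function.update (Function.update (Function.update S i []) j
          (unary m ++ S j)) x (encode u ++ S x),
        tensorOp (measOp (rot fourier) _ (u ++ l)) * σ *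
        (tensorOp (measOp (rot fourier) _ (u ++ l)))ᴴ, 0, a, g + m * fourier.toNat⟩) := by
  intro m
  induction m with
  | zero =>
    intro S l g h2 h3
    have h4 : S i = [] := by simp [h3, unary]
    have h5 : Function.update S i [] = S := Function.update_eq_self_iff.2 h4.symm
    -- After the last qubit the cyclic head is back at 0, ready for the next sample.
    have h6 : Fin.ofNat (n + 1) l.length = 0 := by
      rw [show l.length = n + 1 from h2]; exact Fin.ext (by simp [Fin.ofNat])
    rw [h6]
    convert reach_loop_done (p := .seq (move i j) (measureQubit fourier x)) (test := tSome)
      (S := S) (i := i) (by simp [h4, tSome]) r _ _ a g using 1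
    simp [extend, unary, encode, h5]
  | succ m ih =>
    intro S l g h2 h3
    have h1 : (Fin.ofNat (n + 1) l.length : ℕ) = l.length :=
      Nat.mod_eq_of_lt (by omega)
    have hh : ∀ b : Bool, (Fin.ofNat (n + 1) l.length + 1) = Fin.ofNat (n + 1) (b :: l).length := by
      intro b
      exact Fin.ext (by simp [Fin.ofNat, Fin.val_add])
    refine Reach.mono (t := 5 + (5 + (12 * m + 1)) + 1 + 1) ?_ (by omega)
    refine Reach.loop_step (by simp [h3, unary_succ, tSome]) ?_
    refine Reach.det rfl ?_
    refine (det_move hij h3 n ρ _ _ _ _ _).trans_single ?_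
    have := (reach_measureQubit (ρ := ρ) σ fourier x
      (.loop i tSome (.seq (move i j) (measureQubit fourier x)) :: r)
      (Function.update (Function.update S i (List.replicate m (.bit true))) j (.bit true :: S j))
      l _ a g h1).trans
      (List.Forall₂.cons (by
        rw [hh false]
        exact ih _ (false :: l) _ (by simp only [List.length_cons]; omega)
          (by simp [Function.update_apply, hij, hix, unary]))
      (List.Forall₂.cons (by
        rw [hh true]
        exact ih _ (true :: l) _ (by simp only [List.length_cons]; omega)
          (by simp [Function.update_apply, hij, hix, unary])) List.Forall₂.nil))
    convert this using 1
    simp only [extend, List.flatMap_cons, List.flatMap_nil, List.append_nil]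
    rw [extend_eq m [false], extend_eq m [true]]
    have hst : ∀ (b : Bool) (u : List Bool), Function.update (Function.update (Function.update S i [])
        j (unary (m + 1) ++ S j)) x (encode (u ++ [b]) ++ S x) =
        Function.update (Function.update (Function.update (Function.update (Function.update
          (Function.update S i (List.replicate m (.bit true))) j (.bit true :: S j)) x
          (.bit b :: (Function.update (Function.update S i (List.replicate m (.bit true))) j
            (.bit true :: S j)) x)) i []) j (unary m ++ (Function.update (Function.update
          (Function.update S i (List.replicate m (.bit true))) j (.bit true :: S j)) x
          (.bit b :: (Function.update (Function.update S i (List.replicate m (.bit true))) j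
            (.bit true :: S j)) x)) j)) x (encode u ++ (Function.update (Function.update
          (Function.update S i (List.replicate m (.bit true))) j (.bit true :: S j)) x
          (.bit b :: (Function.update (Function.update S i (List.replicate m (.bit true))) j
            (.bit true :: S j)) x)) x) := by
      intro b u
      have e2 : unary (m + 1) = unary m ++ [.bit true] := by rw [unary_add]; rfl
      funext y
      simp only [Function.update_apply]
      have := hij.symm
      have := hix.symm
      have := hjx.symm
      split_ifs <;> simp_all [encode]
    have hg : g + (m + 1) * fourier.toNat = g + fourier.toNat + m * fourier.toNat := by ring
    simp only [List.map_append, List.map_map, List.flatten_cons, List.flatten_nil,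
      List.append_nil, hg, Function.comp_def, hst]
    simp

/-- The inverse of `wordList`. -/
def listWord (N : ℕ) (l : List Bool) : Cube N := fun i => l.reverse.getD i false

theorem listWord_wordList {N : ℕ} (w : Cube N) : listWord N (wordList w) = w := by
  funext i
  simp [listWord, wordList]

theorem wordList_listWord {N : ℕ} {l : List Bool} (h : l.length = N) :
    wordList (listWord N l) = l := by
  subst h
  rw [wordList, List.reverse_eq_iff]
  refine List.ext_getElem (by simp) fun i h1 h2 => ?_
  simp only [List.length_ofFn] at h1
  simp [listWord, h1]

theorem prob_sample (hρ : ρ.IsHermitian) (fourier : Bool) {i j x : Fin (k + 1)} (hij : i ≠ j)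
    (hix : i ≠ x) (hjx : j ≠ x) (S : Fin (k + 1) → List Sym) (hi : S i = unary (n + 1))
    (hj : S j = []) :
    Prob ρ (sample fourier i j x) S (18 * n + 24) 1 (n + 1)
      (fun (w : Cube (n + 1)) S' => S' = Function.update S x (encode (wordList w) ++ S x))
      (fun V => ∑ w, outcomeProb fourier ρ w * V w) := by
  intro r reg a₀ g₀
  have h0 : tensorOp (measOp (rot fourier) (n + 1) []) = 1 := by
    rw [← tensorOp_one]
    congr 1
  have hU : (((tensorOp (fun _ => rot fourier) : QOp (n + 1)) * ρ *
      (tensorOp fun _ => rot fourier)ᴴ)).IsHermitian :=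
    Matrix.isHermitian_mul_mul_conjTranspose _ hρ
  have hH : (reg.trace • ρ) = tensorOp (measOp (rot fourier) (n + 1) []) * (reg.trace • ρ) *
      (tensorOp (measOp (rot fourier) (n + 1) []))ᴴ := by
    rw [h0, Matrix.conjTranspose_one, Matrix.one_mul, Matrix.mul_one]
  refine ⟨(extend (n + 1) []).map fun u => (⟨r, Function.update S x (encode u ++ S x),
      tensorOp (measOp (rot fourier) _ u) * (reg.trace • ρ) *
        (tensorOp (measOp (rot fourier) _ u))ᴴ, 0, a₀ + 1, g₀ + (n + 1) * fourier.toNat⟩,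
        listWord (n + 1) u), ?_, ?_, ?_⟩
  · refine Reach.mono (t := 12 * (n + 1) + 1 + (6 * (n + 1) + 1) + 1 + 1 + 1) ?_ (by omega)
    refine Reach.det rfl (Reach.det rfl (Reach.det rfl ?_))
    have h1 := reach_sample_loop (ρ := ρ) (reg.trace • ρ) fourier hij hix hjx (moveAll j i :: r)
      (a₀ + 1) (n + 1) S [] g₀ (by simp) hi
    have h2 : (⟨.loop i tSome (.seq (move i j) (measureQubit fourier x)) :: moveAll j i :: r, S,
        reg.trace • ρ, 0, a₀ + 1, g₀⟩ : Config n k) = ⟨.loop i tSome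
          (.seq (move i j) (measureQubit fourier x)) :: moveAll j i :: r, S,
        tensorOp (measOp (rot fourier) _ []) * (reg.trace • ρ) *
          (tensorOp (measOp (rot fourier) _ []))ᴴ, Fin.ofNat (n + 1) ([] : List Bool).length, a₀ + 1, g₀⟩ := by
      rw [← hH]
      rfl
    rw [← h2] at h1
    have h3 : ∀ u : List Bool, Reach ρ (6 * (n + 1) + 1)
        ⟨moveAll j i :: r, Function.update (Function.update (Function.update S i []) j
          (unary (n + 1) ++ S j)) x (encode u ++ S x),
        tensorOp (measOp (rot fourier) _ (u ++ [])) * (reg.trace • ρ) *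
        (tensorOp (measOp (rot fourier) _ (u ++ [])))ᴴ, 0, a₀ + 1, g₀ + (n + 1) * fourier.toNat⟩
        [⟨r, Function.update S x (encode u ++ S x),
      tensorOp (measOp (rot fourier) _ u) * (reg.trace • ρ) *
        (tensorOp (measOp (rot fourier) _ u))ᴴ, 0, a₀ + 1, g₀ + (n + 1) * fourier.toNat⟩] := by
      intro u
      rw [List.append_nil]
      refine Det.of_eq (det_moveAll hij.symm) ?_ ?_ n ρ r _ _ _ _
      · funext y
        simp only [Function.update_apply, hj, List.append_nil]
        have := hij.symm
        have := hix.symm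
        have := hjx.symm
        split_ifs <;> simp_all [reverse_unary]
      · simp [hjx, hj, length_unary]
    have h4 := h1.trans (Ms := (extend (n + 1) []).map fun u => [_])
      (List.forall₂_map_left_iff.2 (List.forall₂_map_right_iff.2
        (List.forall₂_same.2 fun u _ => h3 u)))
    convert h4 using 1
    rw [List.map_map, ← List.flatMap_def]
    exact (List.flatMap_pure_eq_map _ _).symm
  · intro c hc
    obtain ⟨u, hu, rfl⟩ := List.mem_map.1 hc
    have hw := wordList_listWord (N := n + 1) (by simpa using length_of_mem_extend hu)
    refine ⟨rfl, rfl, le_rfl, ?_, ?_⟩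
    · cases fourier <;> simp
    · simp only [hw]
  · intro V
    rw [List.map_map]
    have := sum_extend (n + 1) [] fun u => (tensorOp (measOp (rot fourier) (n + 1) u) *
      (reg.trace • ρ) * (tensorOp (measOp (rot fourier) (n + 1) u))ᴴ).trace.re *
        V (listWord (n + 1) u)
    refine (Eq.trans ?_ this).trans ?_
    · rfl
    · rw [Finset.mul_sum]
      refine Finset.sum_congr rfl fun w _ => ?_
      rw [List.append_nil, trace_measOp, listWord_wordList, ← mul_assoc]
      congr 1
      -- A query scales `ρ` by a complex trace. The real part of the product splits into a product
      -- of real parts because the diagonal of a Hermitian operator is real.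
      have him := hU.apply w w
      rw [Matrix.mul_smul, Matrix.smul_mul, Matrix.smul_apply, smul_eq_mul, Complex.mul_re,
        Complex.conj_eq_iff_im.1 him, mul_zero, sub_zero, outcomeProb]

end

/-! ### The outcome distributions of a mixture of superpositions -/

section

variable {n : ℕ} {D : PMF (Cube n × Bool)}

theorem toReal_marginal (hD : D ∈ uniformMarginal n) (z : Cube n) :
    (marginal D z).toReal = 1 / 2 ^ n := by
  have h : marginal D = PMF.uniformOfFintype (Cube n) := hD
  rw [h]
  simp [Fintype.card_pi]

theorem toReal_add (hD : D ∈ uniformMarginal n) (z : Cube n) :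
    (D (z, false)).toReal + (D (z, true)).toReal = 1 / 2 ^ n := by
  rw [← toReal_marginal hD z, ← ENNReal.toReal_add (D.apply_ne_top _) (D.apply_ne_top _)]
  congr 1
  classical
  rw [marginal, PMF.map_apply, tsum_fintype, Fintype.sum_prod_type,
    Finset.sum_eq_single z (by intro b _ hb; simp [hb.symm]) (by simp)]
  simp [add_comm]

theorem labelExp_eq (hD : D ∈ uniformMarginal n) (z : Cube n) :
    labelExp D z = 2 ^ n * (D (z, true)).toReal := by
  rw [labelExp, ENNReal.toReal_div, toReal_marginal hD]
  field_simp

theorem one_sub_labelExp_eq (hD : D ∈ uniformMarginal n) (z : Cube n) :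
    1 - labelExp D z = 2 ^ n * (D (z, false)).toReal := by
  have := toReal_add hD z
  rw [labelExp_eq hD, eq_sub_of_add_eq this]
  field_simp

theorem labelProb_eq (hD : D ∈ uniformMarginal n) (z : Cube n) (b : Bool) :
    (if b then labelExp D z else 1 - labelExp D z) = 2 ^ n * (D (z, b)).toReal := by
  cases b
  · simpa using one_sub_labelExp_eq hD z
  · simpa using labelExp_eq hD z

theorem funProb_nonneg (hD : D ∈ uniformMarginal n) (f : Cube n → Bool) : 0 ≤ funProb D f :=
  Finset.prod_nonneg fun z _ => by rw [labelProb_eq hD]; positivity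

/-- The labels are independent, so the sum over all functions factorises over the inputs and every
factor other than the one at `z` equals 1. -/
theorem sum_funProb_mul (D : PMF (Cube n × Bool)) (z : Cube n) (h : Bool → ℝ) :
    ∑ f : Cube n → Bool, funProb D f * h (f z) =
      labelExp D z * h true + (1 - labelExp D z) * h false := by
  classical
  have e : ∀ f : Cube n → Bool, funProb D f * h (f z) = ∏ y, (fun (y : Cube n) (b : Bool) =>
      (if b then labelExp D y else 1 - labelExp D y) * if y = z then h b else 1) y (f y) := by
    intro f
    simp only [Finset.prod_mul_distrib, funProb]
    congr 1
    rw [Finset.prod_eq_single z (by intro b _ hb; simp [hb]) (by simp)]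
    simp
  simp only [e]
  have := Finset.prod_univ_sum (fun _ : Cube n => (Finset.univ : Finset Bool))
    (fun (y : Cube n) (b : Bool) =>
      (if b then labelExp D y else 1 - labelExp D y) * if y = z then h b else 1)
  rw [Fintype.piFinset_univ] at this
  rw [← this, Finset.prod_eq_single z]
  · simp
  · intro y _ hy
    simp [hy]
  · simp

theorem sum_funProb (D : PMF (Cube n × Bool)) : ∑ f : Cube n → Bool, funProb D f = 1 := by
  have := sum_funProb_mul D (fun _ => false) fun _ => 1
  simpa using this

theorem vecMulVec_conj {N : ℕ} (U : QOp N) (v : Cube N → ℂ) :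
    U * Matrix.vecMulVec v (star v) * Uᴴ = Matrix.vecMulVec (U *ᵥ v) (star (U *ᵥ v)) := by
  rw [Matrix.mul_vecMulVec, Matrix.vecMulVec_mul, Matrix.star_mulVec]

theorem mixtureExample_isHermitian (D : PMF (Cube n × Bool)) : (mixtureExample D).IsHermitian := by
  unfold mixtureExample Matrix.IsHermitian
  rw [Matrix.conjTranspose_sum]
  refine Finset.sum_congr rfl fun f _ => ?_
  rw [Matrix.conjTranspose_smul, Matrix.conjTranspose_vecMulVec, star_star]
  simp

theorem outcomeProb_eq (fourier : Bool) (D : PMF (Cube n × Bool)) (w : Cube (n + 1)) :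
    outcomeProb fourier (mixtureExample D) w = ∑ f, funProb D f *
      Complex.normSq (((tensorOp fun _ => rot fourier) *ᵥ superposition (marginal D) f) w) := by
  rw [outcomeProb, mixtureExample, Matrix.mul_sum, Matrix.sum_mul, Matrix.sum_apply, Complex.re_sum]
  refine Finset.sum_congr rfl fun f _ => ?_
  rw [Matrix.mul_smul, Matrix.smul_mul, vecMulVec_conj, Matrix.smul_apply, Matrix.vecMulVec_apply,
    Pi.star_apply, RCLike.star_def, Complex.mul_conj, smul_eq_mul, ← Complex.ofReal_mul,
    Complex.ofReal_re]

theorem outcomeProb_nonneg (hD : D ∈ uniformMarginal n) (fourier : Bool) (w : Cube (n + 1)) :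
    0 ≤ outcomeProb fourier (mixtureExample D) w := by
  rw [outcomeProb_eq]
  exact Finset.sum_nonneg fun f _ => mul_nonneg (funProb_nonneg hD f) (Complex.normSq_nonneg _)

theorem superposition_eq (hD : D ∈ uniformMarginal n) (f : Cube n → Bool) (w : Cube (n + 1)) :
    superposition (marginal D) f w =
      if w (Fin.last n) = f (Fin.init w) then ((Real.sqrt (1 / 2 ^ n) : ℝ) : ℂ) else 0 := by
  rw [superposition, toReal_marginal hD]

/-- An unrotated copy serves as one ordinary labelled example: the superposition over inputs and the
mixture over labels both collapse. -/
theorem outcomeProb_false (hD : D ∈ uniformMarginal n) (w : Cube (n + 1)) :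
    outcomeProb false (mixtureExample D) w = (D (Fin.init w, w (Fin.last n))).toReal := by
  have h1 : (tensorOp (fun _ => rot false) : QOp (n + 1)) = 1 := by simp [rot, tensorOp_one]
  have h2 : ∀ f : Cube n → Bool, funProb D f *
      Complex.normSq (((tensorOp fun _ => rot false) *ᵥ superposition (marginal D) f) w) =
      funProb D f * (fun b => if w (Fin.last n) = b then (1 / 2 ^ n : ℝ) else 0)
        (f (Fin.init w)) := by
    intro f
    rw [h1, Matrix.one_mulVec, superposition_eq hD]
    split_ifs with h
    · rw [Complex.normSq_ofReal, Real.mul_self_sqrt (by positivity)]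
      simp [h]
    · simp [h]
  rw [outcomeProb_eq, Finset.sum_congr rfl fun f _ => h2 f]
  refine (sum_funProb_mul D (Fin.init w)
    fun b => if w (Fin.last n) = b then (1 / 2 ^ n : ℝ) else 0).trans ?_
  rw [one_sub_labelExp_eq hD, labelExp_eq hD]
  cases w (Fin.last n) <;> simp <;> field_simp

theorem rot_isometry (fourier : Bool) : (rot fourier)ᴴ * rot fourier = 1 := by
  cases fourier
  · simp [rot]
  · have h : ((Real.sqrt 2 : ℝ) : ℂ) * ((Real.sqrt 2 : ℝ) : ℂ) = 2 := by
      rw [← Complex.ofReal_mul, Real.mul_self_sqrt (by norm_num)]; norm_num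
    have h0 : ((Real.sqrt 2 : ℝ) : ℂ) ≠ 0 := fun e => by simp [e] at h
    ext a b
    cases a <;> cases b <;>
      simp [rot, Gate.mat, Matrix.mul_apply, Complex.conj_ofReal] <;> field_simp <;>
        simp [pow_two, h] <;> norm_num

/-- The rotation preserves the trace, so the total does not depend on `fourier` and can be computed
in the computational basis, where it is the mass of `D`. -/
theorem sum_outcomeProb (hD : D ∈ uniformMarginal n) (fourier : Bool) :
    ∑ w, outcomeProb fourier (mixtureExample D) w = 1 := by
  have h1 : ∑ w, outcomeProb fourier (mixtureExample D) w = ∑ w, outcomeProb false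
      (mixtureExample D) w := by
    have key : ∀ (F : Bool) (ρ : QOp (n + 1)), ∑ w, outcomeProb F ρ w = ρ.trace.re := by
      intro F ρ
      simp only [outcomeProb, ← Complex.re_sum]
      congr 1
      change Matrix.trace _ = _
      rw [Matrix.trace_mul_comm, ← Matrix.mul_assoc, tensorOp_conjTranspose, tensorOp_mul]
      simp [rot_isometry, tensorOp_one]
    rw [key, key]
  rw [h1, Finset.sum_congr rfl fun w _ => outcomeProb_false hD w,
    ← (Fin.snocEquiv fun _ => Bool).sum_comp, Fintype.sum_prod_type_right]
  simp only [Fin.snocEquiv, Equiv.coe_fn_mk, Fin.init_snoc, Fin.snoc_last, Fintype.sum_bool]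
  simp only [add_comm (D (_, true)).toReal, toReal_add hD]
  simp [Fintype.card_pi]

/-! ### Fourier coefficients, correlations and the law of a Fourier sample. -/

/-- The sign of a bit. -/
def sgn (b : Bool) : ℝ := if b then -1 else 1

theorem sgn_xor (a b : Bool) : sgn (a ^^ b) = sgn a * sgn b := by
  cases a <;> cases b <;> simp [sgn]

theorem sgn_parity (s x : Cube n) : sgn (parity s x) = ∏ i, sgn (s i && x i) := by
  have h : ∀ t : Finset (Fin n), sgn (decide ((∑ i ∈ t, (s i && x i).toNat) % 2 = 1)) =
      ∏ i ∈ t, sgn (s i && x i) := by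
    intro t
    induction t using Finset.induction_on with
    | empty => simp [sgn]
    | insert a t ha ih =>
      rw [Finset.sum_insert ha, Finset.prod_insert ha, ← ih, ← sgn_xor]
      congr 1
      rcases Nat.mod_two_eq_zero_or_one (∑ i ∈ t, (s i && x i).toNat) with h | h <;>
        cases (s a && x a) <;> simp [Nat.add_mod, h]
  exact h Finset.univ

/-- The Fourier coefficient of the labels `f` at `s`. -/
def fourierCoef (f : Cube n → Bool) (s : Cube n) : ℝ :=
  1 / 2 ^ n * ∑ x, sgn (f x ^^ parity s x)

/-- The correlation of the labels of `D` with the parity `s`. -/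
def corr (D : PMF (Cube n × Bool)) (s : Cube n) : ℝ := 1 - 2 * err D (parity s)

theorem err_eq (D : PMF (Cube n × Bool)) (h : Cube n → Bool) :
    err D h = ∑ x, (D (x, !h x)).toReal := by
  classical
  rw [err, PMF.toOuterMeasure_apply_fintype, ENNReal.toReal_sum, Fintype.sum_prod_type]
  · refine Finset.sum_congr rfl fun x _ => ?_
    rw [Fintype.sum_bool]
    cases hx : h x <;> simp [Set.indicator, hx]
  · intro z _
    simp only [Set.indicator]
    split_ifs
    · exact D.apply_ne_top _
    · simp

/-- A Fourier coefficient is linear in the signs of the labels, and the mean sign of the label at x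
is the difference of the two label probabilities; under the uniform marginal these means assemble to
the correlation of `D`. -/
theorem corr_eq_sum (hD : D ∈ uniformMarginal n) (s : Cube n) :
    corr D s = ∑ f, funProb D f * fourierCoef f s := by
  have h1 : ∀ x, 1 / 2 ^ n * ∑ f : Cube n → Bool, funProb D f * sgn (f x ^^ parity s x) =
      1 / 2 ^ n - 2 * (D (x, !parity s x)).toReal := by
    intro x
    rw [sum_funProb_mul D x fun b => sgn (b ^^ parity s x), one_sub_labelExp_eq hD,
      labelExp_eq hD, ← toReal_add hD x]
    have h2 := toReal_add hD x
    have h3 : (1 : ℝ) / 2 ^ n * 2 ^ n = 1 := by field_simp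
    rw [h2]
    cases parity s x
    · simp only [sgn, Bool.xor_false, if_true, Bool.not_false, Bool.false_eq_true, if_false]
      linear_combination ((D (x, false)).toReal - (D (x, true)).toReal) * h3 + h2
    · simp only [sgn, Bool.xor_true, Bool.not_true, Bool.not_false, if_true, Bool.false_eq_true,
        if_false]
      linear_combination ((D (x, true)).toReal - (D (x, false)).toReal) * h3 + h2
  have h4 : ∑ f, funProb D f * fourierCoef f s =
      ∑ x, 1 / 2 ^ n * ∑ f : Cube n → Bool, funProb D f * sgn (f x ^^ parity s x) := by
    simp only [fourierCoef, Finset.mul_sum]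
    rw [Finset.sum_comm]
    exact Finset.sum_congr rfl fun x _ => Finset.sum_congr rfl fun f _ => by ring
  rw [h4, Finset.sum_congr rfl fun x _ => h1 x, Finset.sum_sub_distrib, corr, err_eq,
    ← Finset.mul_sum]
  simp [Fintype.card_pi]

theorem hadamard_apply (a b : Bool) :
    Gate.H.mat a b = ((sgn (a && b) / Real.sqrt 2 : ℝ) : ℂ) := by
  cases a <;> cases b <;> simp [Gate.mat, sgn]

/-- Outcome 1 on the label qubit turns the label into the phase (-1)^{f(x)}, and the remaining
Hadamard gates form the Walsh transform. The factor 1/√2 comes from the label qubit. -/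
theorem hadamard_mulVec_superposition (hD : D ∈ uniformMarginal n) (f : Cube n → Bool)
    (s : Cube n) :
    ((tensorOp fun _ => rot true) *ᵥ superposition (marginal D) f) (Fin.snoc s true) =
      ((fourierCoef f s / Real.sqrt 2 : ℝ) : ℂ) := by
  have h1 : ∀ (x : Cube n) (b : Bool),
      (tensorOp fun _ => rot true) (Fin.snoc s true) (Fin.snoc x b : Cube (n + 1)) =
        ((sgn (b ^^ parity s x) / Real.sqrt 2 ^ (n + 1) : ℝ) : ℂ) := by
    intro x b
    rw [sgn_xor, sgn_parity, tensorOp, Matrix.of_apply, Fin.prod_univ_castSucc]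
    simp only [rot, if_true, hadamard_apply, Fin.snoc_castSucc, Fin.snoc_last, Bool.true_and]
    rw [← Complex.ofReal_prod, Finset.prod_div_distrib, ← Complex.ofReal_mul]
    simp only [Finset.prod_const, Finset.card_univ, Fintype.card_fin]
    congr 1
    rw [pow_succ]
    ring
  rw [Matrix.mulVec, dotProduct, ← (Fin.snocEquiv fun _ => Bool).sum_comp,
    Fintype.sum_prod_type_right]
  have h2 : ∀ x : Cube n, ∑ b : Bool, (tensorOp fun _ => rot true) (Fin.snoc s true)
      ((Fin.snocEquiv fun _ => Bool) (b, x)) * superposition (marginal D) f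
        ((Fin.snocEquiv fun _ => Bool) (b, x)) =
      ((sgn (f x ^^ parity s x) / Real.sqrt 2 ^ (n + 1) * Real.sqrt (1 / 2 ^ n) : ℝ) : ℂ) := by
    intro x
    simp only [Fin.snocEquiv, Equiv.coe_fn_mk]
    rw [Finset.sum_eq_single (f x)]
    · rw [h1, superposition_eq hD]
      simp
    · intro b _ hb
      rw [superposition_eq hD]
      simp [hb]
    · simp
  rw [Finset.sum_congr rfl fun x _ => h2 x, ← Complex.ofReal_sum, ← Finset.sum_mul,
    ← Finset.sum_div, fourierCoef]
  congr 1
  have h3 : Real.sqrt (1 / 2 ^ n) = 1 / Real.sqrt 2 ^ n := by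
    rw [Real.sqrt_div zero_le_one, Real.sqrt_one]
    congr 1
    rw [Real.sqrt_eq_iff_mul_self_eq (by positivity) (by positivity), ← mul_pow,
      Real.mul_self_sqrt (by norm_num)]
  have h4 : (2 : ℝ) ^ n = Real.sqrt 2 ^ n * Real.sqrt 2 ^ n := by
    rw [← mul_pow, Real.mul_self_sqrt (by norm_num)]
  have h5 : Real.sqrt 2 ≠ 0 := by positivity
  rw [h3, h4, pow_succ]
  field_simp

/-- The outcome probability is half the second moment of `fourierCoef f s` over random f, whose mean
is `corr D s`; a variance is nonnegative. -/
theorem half_corr_sq_le (hD : D ∈ uniformMarginal n) (s : Cube n) :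
    corr D s ^ 2 / 2 ≤ outcomeProb true (mixtureExample D) (Fin.snoc s true) := by
  have h1 : outcomeProb true (mixtureExample D) (Fin.snoc s true) =
      (∑ f, funProb D f * fourierCoef f s ^ 2) / 2 := by
    rw [outcomeProb_eq, Finset.sum_div]
    refine Finset.sum_congr rfl fun f _ => ?_
    rw [hadamard_mulVec_superposition hD, Complex.normSq_ofReal, div_mul_div_comm,
      Real.mul_self_sqrt (by norm_num)]
    ring
  have h2 : corr D s ^ 2 ≤ ∑ f, funProb D f * fourierCoef f s ^ 2 := by
    have h3 : 0 ≤ ∑ f, funProb D f * (fourierCoef f s - corr D s) ^ 2 :=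
      Finset.sum_nonneg fun f _ => mul_nonneg (funProb_nonneg hD f) (sq_nonneg _)
    have h4 : ∑ f, funProb D f * (fourierCoef f s - corr D s) ^ 2 =
        ∑ f, funProb D f * fourierCoef f s ^ 2 - 2 * corr D s * ∑ f, funProb D f * fourierCoef f s +
          corr D s ^ 2 * ∑ f, funProb D f := by
      rw [Finset.mul_sum, Finset.mul_sum, ← Finset.sum_sub_distrib, ← Finset.sum_add_distrib]
      exact Finset.sum_congr rfl fun f _ => by ring
    rw [← corr_eq_sum hD, sum_funProb] at h4
    nlinarith
  rw [h1]
  linarith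

/-- The outcomes with label 1 have total probability at most 1. This Bessel-type bound limits how
many parities can have a large correlation of either sign. -/
theorem sum_corr_sq_le (hD : D ∈ uniformMarginal n) : ∑ s, corr D s ^ 2 ≤ 2 := by
  have h1 : ∑ s : Cube n, outcomeProb true (mixtureExample D) (Fin.snoc s true) ≤ 1 := by
    rw [← sum_outcomeProb hD true, ← (Fin.snocEquiv fun _ => Bool).sum_comp,
      Fintype.sum_prod_type_right]
    refine Finset.sum_le_sum fun s _ => ?_
    rw [Fintype.sum_bool]
    have := outcomeProb_nonneg hD true ((Fin.snocEquiv fun _ => Bool) (false, s))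
    simp only [Fin.snocEquiv, Equiv.coe_fn_mk] at this ⊢
    linarith
  have h2 := (Finset.sum_le_sum fun s (_ : s ∈ Finset.univ) => half_corr_sq_le hD s).trans h1
  rw [← Finset.sum_div] at h2
  linarith

end

/-! ### Candidate lists -/

/-- A candidate parity with a counter. -/
abbrev Entry (n : ℕ) : Type := Cube n × ℕ

section

variable {n : ℕ}

/-- Process the entries from left to right, with a flag and a recorded string as state. -/
def passRun (φ : Bool × Cube n → Entry n → (Bool × Cube n) × Entry n) :
    Bool × Cube n → List (Entry n) → (Bool × Cube n) × List (Entry n)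
  | s, [] => (s, [])
  | s, e :: es => ((passRun φ (φ s e).1 es).1, (φ s e).2 :: (passRun φ (φ s e).1 es).2)

/-- Increment the counter of a matching entry and set the flag. -/
def scoreEntry (M : Cube n → Bool) (s : Bool × Cube n) (e : Entry n) :
    (Bool × Cube n) × Entry n :=
  if M e.1 then ((true, s.2), (e.1, e.2 + 1)) else (s, e)

/-- Replace an entry with counter zero and set the flag, unless the flag is set already. -/
def placeEntry (x : Cube n) (s : Bool × Cube n) (e : Entry n) : (Bool × Cube n) × Entry n :=
  if s.1 = false ∧ e.2 = 0 then ((true, s.2), (x, 1)) else (s, e)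

/-- Unless the flag is set, decrement a positive counter and record the entry. -/
def decEntry (s : Bool × Cube n) (e : Entry n) : (Bool × Cube n) × Entry n :=
  if s.1 = false ∧ e.2 ≠ 0 then ((s.1, e.1), (e.1, e.2 - 1)) else (s, e)

theorem passRun_score (M : Cube n → Bool) (s : Bool × Cube n) (es : List (Entry n)) :
    passRun (scoreEntry M) s es = ((s.1 || es.any fun e => M e.1, s.2),
      es.map fun e => (e.1, e.2 + (M e.1).toNat)) := by
  induction es generalizing s with
  | nil => simp [passRun]
  | cons e es ih =>
    rw [passRun, ih]
    cases h : M e.1 <;> simp [scoreEntry, h]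

theorem passRun_place_true (x R : Cube n) (es : List (Entry n)) :
    passRun (placeEntry x) (true, R) es = ((true, R), es) := by
  induction es with
  | nil => rfl
  | cons e es ih => simp [passRun, placeEntry, ih]

theorem passRun_place_of_ne (x R : Cube n) (es : List (Entry n)) (h : ∀ e ∈ es, e.2 ≠ 0) :
    passRun (placeEntry x) (false, R) es = ((false, R), es) := by
  induction es with
  | nil => rfl
  | cons e es ih =>
    have h1 : e.2 ≠ 0 := h e (by simp)
    simp [passRun, placeEntry, h1, ih fun e he => h e (by simp [he])]

theorem passRun_place_of_eq (x R : Cube n) (es : List (Entry n)) (h : ∃ e ∈ es, e.2 = 0) :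
    ∃ es₁ s es₂, es = es₁ ++ (s, 0) :: es₂ ∧
      passRun (placeEntry x) (false, R) es = ((true, R), es₁ ++ (x, 1) :: es₂) := by
  induction es with
  | nil => simp at h
  | cons e es ih =>
    by_cases he : e.2 = 0
    · refine ⟨[], e.1, es, by rw [← he]; rfl, ?_⟩
      simp [passRun, placeEntry, he, passRun_place_true]
    · obtain ⟨es₁, s, es₂, h1, h2⟩ := ih (by
        obtain ⟨e', h1, h2⟩ := h
        rcases List.mem_cons.1 h1 with rfl | h1
        · exact absurd h2 he
        · exact ⟨e', h1, h2⟩)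
      refine ⟨e :: es₁, s, es₂, by simp [h1], ?_⟩
      simp [passRun, placeEntry, he, h2]

theorem passRun_dec_true (R : Cube n) (es : List (Entry n)) :
    passRun decEntry (true, R) es = ((true, R), es) := by
  induction es with
  | nil => rfl
  | cons e es ih => simp [passRun, decEntry, ih]

theorem passRun_dec_false (R : Cube n) (es : List (Entry n)) :
    (passRun decEntry (false, R) es).1.1 = false ∧
    (passRun decEntry (false, R) es).2 = es.map fun e => (e.1, e.2 - 1) := by
  induction es generalizing R with
  | nil => exact ⟨rfl, rfl⟩
  | cons e es ih =>
    by_cases he : e.2 = 0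
    · have h1 : decEntry (false, R) e = ((false, R), e) := by simp [decEntry, he]
      have h2 : (e.1, e.2 - 1) = e := by rw [he]; exact Prod.ext rfl he.symm
      simp [passRun, h1, h2, ih]
    · have h1 : decEntry (false, R) e = ((false, e.1), (e.1, e.2 - 1)) := by simp [decEntry, he]
      simp [passRun, h1, ih]

/-- A round of decrements leaves the record alone exactly when nothing is positive, so after many
rounds the record dates from the last round that changed a counter. -/
theorem passRun_dec_record (R : Cube n) (es : List (Entry n)) :
    ((∀ e ∈ es, e.2 = 0) ∧ (passRun decEntry (false, R) es).1.2 = R) ∨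
    ∃ e ∈ es, e.2 ≠ 0 ∧ (passRun decEntry (false, R) es).1.2 = e.1 := by
  induction es generalizing R with
  | nil => exact Or.inl ⟨by simp, rfl⟩
  | cons e es ih =>
    by_cases he : e.2 = 0
    · have h1 : decEntry (false, R) e = ((false, R), e) := by simp [decEntry, he]
      simp only [passRun, h1]
      rcases ih R with ⟨h2, h3⟩ | ⟨e', h2, h3⟩
      · exact Or.inl ⟨by simpa [he] using fun a b h => h2 (a, b) h, h3⟩
      · exact Or.inr ⟨e', by simp [h2], h3⟩
    · have h1 : decEntry (false, R) e = ((false, e.1), (e.1, e.2 - 1)) := by simp [decEntry, he]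
      simp only [passRun, h1]
      rcases ih e.1 with ⟨h2, h3⟩ | ⟨e', h2, h3⟩
      · exact Or.inr ⟨e, by simp, he, h3⟩
      · exact Or.inr ⟨e', by simp [h2], h3⟩

/-! ### The steps of the learner -/

/-- The Misra-Gries update with the item `x`. -/
def mgUpdate (a : List (Entry n) × Cube n) (x : Cube n) : List (Entry n) × Cube n :=
  let p := passRun (scoreEntry fun s => decide (s = x)) (false, a.2) a.1
  let q := passRun (placeEntry x) p.1 p.2
  let r := passRun decEntry q.1 q.2
  (r.2, r.1.2)

/-- One round of decrements. -/
def drainStep (a : List (Entry n) × Cube n) : List (Entry n) × Cube n :=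
  let r := passRun decEntry (false, a.2) a.1
  (r.2, r.1.2)

/-- The label of the labelled example `w` agrees with the parity `s`. -/
def agree (w : Cube (n + 1)) (s : Cube n) : Bool :=
  w (Fin.last n) == parity s (Fin.init w)

/-- Count the agreements with the labelled example `w`. -/
def agreeStep (a : List (Entry n) × Cube n) (w : Cube (n + 1)) : List (Entry n) × Cube n :=
  let r := passRun (scoreEntry (agree w)) (false, a.2) a.1
  (r.2, r.1.2)

theorem agreeStep_eq (a : List (Entry n) × Cube n) (w : Cube (n + 1)) :
    agreeStep a w = (a.1.map fun e => (e.1, e.2 + (agree w e.1).toNat), a.2) := by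
  simp [agreeStep, passRun_score]

theorem foldl_agreeStep (a : List (Entry n) × Cube n) (l : List (Cube (n + 1))) :
    l.foldl agreeStep a = (a.1.map fun e => (e.1, e.2 + l.countP fun w => agree w e.1), a.2) := by
  induction l generalizing a with
  | nil => simp
  | cons w l ih =>
    rw [List.foldl_cons, ih, agreeStep_eq]
    simp only [List.map_map, Function.comp_def, List.countP_cons, Prod.mk.injEq, and_true]
    refine List.map_congr_left fun e _ => ?_
    cases agree w e.1 <;> (simp; try omega)

theorem drainStep_fst (a : List (Entry n) × Cube n) :
    (drainStep a).1 = a.1.map fun e => (e.1, e.2 - 1) :=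
  (passRun_dec_false a.2 a.1).2

theorem drain_fst (m : ℕ) (a : List (Entry n) × Cube n) :
    (drainStep^[m] a).1 = a.1.map fun e => (e.1, e.2 - m) := by
  induction m generalizing a with
  | zero => simp
  | succ m ih =>
    rw [Function.iterate_succ_apply, ih, drainStep_fst]
    simp [Function.comp_def, Nat.sub_sub, add_comm]

theorem drain_snd_of_zero (m : ℕ) (a : List (Entry n) × Cube n) (h : ∀ e ∈ a.1, e.2 = 0) :
    (drainStep^[m] a).2 = a.2 := by
  induction m generalizing a with
  | zero => rfl
  | succ m ih =>
    rw [Function.iterate_succ_apply, ih]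
    · rcases passRun_dec_record a.2 a.1 with ⟨_, h1⟩ | ⟨e, h1, h2, _⟩
      · exact h1
      · exact absurd (h e h1) h2
    · intro e he
      rw [drainStep_fst] at he
      obtain ⟨e', h1, rfl⟩ := List.mem_map.1 he
      simp [h e' h1]

/-- Draining records an entry with the largest counter. -/
theorem drain_snd (m : ℕ) (a : List (Entry n) × Cube n) (h : ∃ e ∈ a.1, 0 < e.2)
    (hm : ∀ e ∈ a.1, e.2 ≤ m) :
    ∃ e ∈ a.1, (drainStep^[m] a).2 = e.1 ∧ ∀ e' ∈ a.1, e'.2 ≤ e.2 := by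
  induction m generalizing a with
  | zero =>
    obtain ⟨e, h1, h2⟩ := h
    exact absurd (hm e h1) (by omega)
  | succ m ih =>
    rw [Function.iterate_succ_apply]
    have hs := drainStep_fst a
    by_cases h2 : ∃ e ∈ (drainStep a).1, 0 < e.2
    · obtain ⟨e, h3, h4, h5⟩ := ih (drainStep a) h2 (by
        intro e he
        rw [hs] at he
        obtain ⟨e', h1, rfl⟩ := List.mem_map.1 he
        have := hm e' h1
        simp only
        omega)
      obtain ⟨e₂, h6, h7⟩ := h2
      have h8 := h5 e₂ h6
      rw [hs] at h3
      obtain ⟨e', h1, rfl⟩ := List.mem_map.1 h3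
      refine ⟨e', h1, h4, fun e'' h9 => ?_⟩
      have := h5 (e''.1, e''.2 - 1) (by rw [hs]; exact List.mem_map.2 ⟨e'', h9, rfl⟩)
      simp only at this h8
      omega
    · push Not at h2
      -- This is the last effective round: all counters are at most 1, so any positive entry is
      -- maximal, and the later rounds keep the record.
      have h3 : ∀ e ∈ a.1, e.2 ≤ 1 := by
        intro e he
        have := h2 (e.1, e.2 - 1) (by rw [hs]; exact List.mem_map.2 ⟨e, he, rfl⟩)
        simp only at this
        omega
      rw [drain_snd_of_zero _ _ fun e he => Nat.le_zero.1 (h2 e he)]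
      rcases passRun_dec_record a.2 a.1 with ⟨h4, _⟩ | ⟨e, h4, h5, h6⟩
      · obtain ⟨e, h5, h6⟩ := h
        exact absurd (h4 e h5) (by omega)
      · refine ⟨e, h4, h6, fun e' he' => ?_⟩
        have := h3 e' he'
        omega

/-! ### The Misra-Gries guarantee -/

/-- The sum of the counters of the entries `x`. -/
def cnt (x : Cube n) (es : List (Entry n)) : ℕ := (es.map fun e => if e.1 = x then e.2 else 0).sum

/-- The sum of all counters. -/
def total (es : List (Entry n)) : ℕ := (es.map Prod.snd).sum

/-- The state after the items `l` have been processed. -/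
structure MGInv (k : ℕ) (l : List (Cube n)) (es : List (Entry n)) : Prop where
  length_eq : es.length = k
  nodup : (es.map Prod.fst).Nodup
  bound : ∃ d, total es + (k + 1) * d ≤ l.length ∧ ∀ x, l.count x ≤ d + cnt x es

theorem cnt_of_notMem {x : Cube n} {es : List (Entry n)} (h : x ∉ es.map Prod.fst) :
    cnt x es = 0 := by
  rw [cnt, List.sum_eq_zero_iff]
  intro c hc
  obtain ⟨e, he, rfl⟩ := List.mem_map.1 hc
  rw [if_neg]
  rintro rfl
  exact h (List.mem_map_of_mem he)

theorem total_score (x : Cube n) (es : List (Entry n)) (hn : (es.map Prod.fst).Nodup) :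
    total (es.map fun e => (e.1, e.2 + (decide (e.1 = x)).toNat)) =
      total es + if x ∈ es.map Prod.fst then 1 else 0 := by
  induction es with
  | nil => simp [total]
  | cons e es ih =>
    have ih := ih (List.nodup_cons.1 hn).2
    have h1 := (List.nodup_cons.1 hn).1
    simp only [total, List.map_cons, List.sum_cons] at ih ⊢
    rw [ih]
    by_cases h : e.1 = x
    · subst h
      rw [if_neg h1]
      simp
      omega
    · have h' : ¬ x = e.1 := fun e => h e.symm
      simp only [h, decide_false, Bool.toNat_false, List.mem_cons, h', false_or]
      omega

theorem cnt_le_cnt_score (x y : Cube n) (es : List (Entry n)) :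
    cnt y es ≤ cnt y (es.map fun e => (e.1, e.2 + (decide (e.1 = x)).toNat)) := by
  induction es with
  | nil => simp [cnt]
  | cons e es ih =>
    simp only [cnt, List.map_cons, List.sum_cons] at ih ⊢
    split_ifs <;> omega

theorem cnt_score (x : Cube n) (es : List (Entry n)) (h : x ∈ es.map Prod.fst) :
    cnt x es + 1 ≤ cnt x (es.map fun e => (e.1, e.2 + (decide (e.1 = x)).toNat)) := by
  induction es with
  | nil => simp at h
  | cons e es ih =>
    have h1 := cnt_le_cnt_score x x es
    simp only [cnt, List.map_cons, List.sum_cons] at h1 ih ⊢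
    by_cases he : e.1 = x
    · simp only [he, if_true, decide_true, Bool.toNat_true]
      omega
    · have := ih ((List.mem_cons.1 h).resolve_left fun h => he h.symm)
      simp only [he, if_false]
      omega

theorem cnt_dec (y : Cube n) (es : List (Entry n)) (hn : (es.map Prod.fst).Nodup) :
    cnt y es ≤ cnt y (es.map fun e => (e.1, e.2 - 1)) + 1 := by
  induction es with
  | nil => simp [cnt]
  | cons e es ih =>
    have ih := ih (List.nodup_cons.1 hn).2
    by_cases h : e.1 = y
    · subst h
      have h0 := cnt_of_notMem (List.nodup_cons.1 hn).1
      simp only [cnt, List.map_cons, List.sum_cons, if_true] at h0 ⊢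
      omega
    · simp only [cnt, List.map_cons, List.sum_cons, h, if_false, zero_add] at ih ⊢
      exact ih

theorem total_dec (es : List (Entry n)) (h : ∀ e ∈ es, e.2 ≠ 0) :
    total (es.map fun e => (e.1, e.2 - 1)) + es.length = total es := by
  induction es with
  | nil => simp [total]
  | cons e es ih =>
    have ih := ih fun e he => h e (by simp [he])
    have := h e (by simp)
    simp only [total, List.map_cons, List.sum_cons, List.length_cons] at ih ⊢
    omega

/-- The number `d` counts the items that neither match a key nor find a free slot. Such an item
lowers all k counters and is itself dropped, so it accounts for k + 1 processed items, while each
string loses at most one occurrence. -/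
theorem MGInv.update {k : ℕ} {l : List (Cube n)} {a : List (Entry n) × Cube n}
    (h : MGInv k l a.1) (x : Cube n) : MGInv k (l ++ [x]) (mgUpdate a x).1 := by
  obtain ⟨hk, hn, d, hd, hc⟩ := h
  have hcount : ∀ y, (l ++ [x]).count y = l.count y + if x = y then 1 else 0 := by
    intro y
    simp [List.count_append, List.count_singleton]
  have hany : (a.1.any fun e => decide (e.1 = x)) = decide (x ∈ a.1.map Prod.fst) := by
    rw [Bool.eq_iff_iff]
    simp
  by_cases hx : x ∈ a.1.map Prod.fst
  · have hmap : (mgUpdate a x).1 = a.1.map fun e => (e.1, e.2 + (decide (e.1 = x)).toNat) := by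
      simp only [mgUpdate, passRun_score, hany, hx, decide_true, Bool.or_true,
        passRun_place_true, passRun_dec_true]
    rw [hmap]
    refine ⟨by simpa using hk, by simpa [Function.comp_def] using hn, d, ?_, fun y => ?_⟩
    · rw [total_score x _ hn, if_pos hx]
      simp
      omega
    · rw [hcount]
      have h1 := cnt_le_cnt_score x y a.1
      have h2 := hc y
      split_ifs with h
      · subst h
        have := cnt_score x a.1 hx
        omega
      · omega
  · have hmap : (a.1.map fun e => (e.1, e.2 + (decide (e.1 = x)).toNat)) = a.1 := by
      conv_rhs => rw [← List.map_id a.1]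
      refine List.map_congr_left fun e he => ?_
      have : e.1 ≠ x := fun h => hx (h ▸ List.mem_map_of_mem he)
      simp [this]
    have hc0 : cnt x a.1 = 0 := cnt_of_notMem hx
    by_cases hz : ∃ e ∈ a.1, e.2 = 0
    · obtain ⟨es₁, s, es₂, h1, h2⟩ := passRun_place_of_eq x a.2 a.1 hz
      have hmg : (mgUpdate a x).1 = es₁ ++ (x, 1) :: es₂ := by
        simp only [mgUpdate, passRun_score, hany, hx, decide_false, Bool.or_false, hmap, h2,
          passRun_dec_true]
      rw [hmg]
      rw [h1] at hk hn hx hc hd hc0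
      refine ⟨by simpa using hk, ?_, d, ?_, fun y => ?_⟩
      · simp only [List.map_append, List.map_cons, List.nodup_append, List.nodup_cons,
          List.mem_append, List.mem_cons, not_or] at hn hx ⊢
        refine ⟨hn.1, ⟨hx.2.2, hn.2.1.2⟩, fun u hu v hv => ?_⟩
        rcases hv with rfl | hv
        · rintro rfl
          exact hx.1 hu
        · exact hn.2.2 u hu v (Or.inr hv)
      · simp only [total, List.map_append, List.map_cons, List.sum_append, List.sum_cons,
          List.length_append, List.length_singleton] at hd ⊢
        omega
      · have h3 := hc y
        rw [hcount]
        simp only [cnt, List.map_append, List.map_cons, List.sum_append, List.sum_cons,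
          ite_self] at h3 ⊢
        split_ifs <;> omega
    · push Not at hz
      have hp := passRun_place_of_ne x a.2 a.1 hz
      have hmg : (mgUpdate a x).1 = a.1.map fun e => (e.1, e.2 - 1) := by
        simp only [mgUpdate, passRun_score, hany, hx, decide_false, Bool.or_false, hmap, hp,
          (passRun_dec_false a.2 a.1).2]
      rw [hmg]
      refine ⟨by simpa using hk, by simpa [Function.comp_def] using hn, d + 1, ?_, fun y => ?_⟩
      · have := total_dec a.1 hz
        simp only [List.length_append, List.length_singleton]
        rw [hk] at this
        rw [Nat.mul_add, mul_one]
        omega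
      · rw [hcount]
        have h1 := cnt_dec y a.1 hn
        have h2 := hc y
        split_ifs with h
        · subst h
          omega
        · omega

theorem MGInv.foldl {k : ℕ} {l : List (Cube n)} (l' : List (Cube n))
    {a : List (Entry n) × Cube n} (h : MGInv k l a.1) :
    MGInv k (l ++ l') (l'.foldl mgUpdate a).1 := by
  induction l' generalizing l a with
  | nil => simpa using h
  | cons x l' ih => simpa using ih (h.update x)

/-- A string without an entry has all its occurrences absorbed by `d`, and (k + 1) d is at most the
number of items. -/
theorem MGInv.mem {k : ℕ} {l : List (Cube n)} {es : List (Entry n)} (h : MGInv k l es)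
    {x : Cube n} (hx : l.length < (k + 1) * l.count x) : x ∈ es.map Prod.fst := by
  obtain ⟨-, -, d, hd, hc⟩ := h
  by_contra hmem
  have h1 := hc x
  rw [cnt_of_notMem hmem] at h1
  have h2 := Nat.mul_le_mul_left (k + 1) h1
  simp only [add_zero] at h2
  omega

theorem le_total {es : List (Entry n)} {e : Entry n} (h : e ∈ es) : e.2 ≤ total es :=
  List.le_sum_of_mem (List.mem_map_of_mem h)

theorem MGInv.le {k : ℕ} {l : List (Cube n)} {es : List (Entry n)} (h : MGInv k l es)
    {e : Entry n} (he : e ∈ es) : e.2 ≤ l.length := by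
  obtain ⟨-, -, d, hd, -⟩ := h
  have := le_total he
  omega

end

/-! ### Tail bounds -/

section

variable {W : Type*} [Fintype W] {q : W → ℝ}

theorem iidExp_mono (hq : ∀ w, 0 ≤ q w) (m : ℕ) : ∀ {V V' : List W → ℝ},
    (∀ l, l.length = m → V l ≤ V' l) → iidExp q m V ≤ iidExp q m V' := by
  induction m with
  | zero => intro V V' h; exact h [] rfl
  | succ m ih =>
    intro V V' h
    exact Finset.sum_le_sum fun w _ => mul_le_mul_of_nonneg_left
      (ih fun l hl => h (w :: l) (by simp [hl])) (hq w)

theorem iidExp_prod (m : ℕ) (g : W → ℝ) (c : ℝ) :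
    iidExp q m (fun l => c * (l.map g).prod) = c * (∑ w, q w * g w) ^ m := by
  induction m generalizing c with
  | zero => simp [iidExp]
  | succ m ih =>
    simp only [iidExp, List.map_cons, List.prod_cons, ← mul_assoc, ih]
    rw [← Finset.sum_mul, pow_succ', ← mul_assoc, Finset.mul_sum]
    congr 1
    exact Finset.sum_congr rfl fun w _ => by ring

theorem iidExp_const (hq : ∑ w, q w = 1) (m : ℕ) (c : ℝ) : iidExp q m (fun _ => c) = c := by
  have := iidExp_prod (q := q) m (fun _ => 1) c
  simpa [hq] using this

theorem iidExp_sub (m : ℕ) : ∀ (V V' : List W → ℝ),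
    iidExp q m (fun l => V l - V' l) = iidExp q m V - iidExp q m V' := by
  induction m with
  | zero => intro V V'; rfl
  | succ m ih =>
    intro V V'
    simp only [iidExp, ih, mul_sub, Finset.sum_sub_distrib]

theorem iidExp_const_mul (m : ℕ) (c : ℝ) : ∀ V : List W → ℝ,
    iidExp q m (fun l => c * V l) = c * iidExp q m V := by
  induction m with
  | zero => intro V; rfl
  | succ m ih =>
    intro V
    simp only [iidExp, ih, Finset.mul_sum, mul_left_comm c]

theorem iidExp_add (m : ℕ) : ∀ (V V' : List W → ℝ),
    iidExp q m (fun l => V l + V' l) = iidExp q m V + iidExp q m V' := by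
  induction m with
  | zero => intro V V'; rfl
  | succ m ih =>
    intro V V'
    simp only [iidExp, ih, mul_add, Finset.sum_add_distrib]

theorem iidExp_list_sum {ι : Type*} (m : ℕ) (L : List ι) (V : ι → List W → ℝ) :
    iidExp q m (fun l => (L.map fun i => V i l).sum) = (L.map fun i => iidExp q m (V i)).sum := by
  induction L with
  | nil =>
    have := iidExp_prod (q := q) m (fun _ => 1) 0
    simpa using this
  | cons i L ih => simp only [List.map_cons, List.sum_cons, iidExp_add, ih]

open Classical in
/-- An event of probability at least `p` occurs rarely at most `θ` times. -/
theorem iidExp_count_le (hq : ∀ w, 0 ≤ q w) (hq1 : ∑ w, q w = 1) (A : W → Bool) {p θ : ℝ} (m : ℕ)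
    (hp : p ≤ ∑ w, q w * (A w).toNat) :
    iidExp q m (fun l => if (l.countP A : ℝ) ≤ θ then 1 else 0) ≤
      Real.exp (θ - 3 / 5 * p * m) := by
  have h1 : ∀ l : List W, Real.exp (θ - l.countP A) =
      Real.exp θ * (l.map fun w => Real.exp (-((A w).toNat : ℝ))).prod := by
    intro l
    induction l with
    | nil => simp
    | cons w l ih =>
      rw [List.map_cons, List.prod_cons, ← mul_assoc, mul_comm (Real.exp θ), mul_assoc, ← ih,
        ← Real.exp_add, List.countP_cons]
      congr 1
      cases A w <;> simp
      ring
  have h2 : iidExp q m (fun l => if (l.countP A : ℝ) ≤ θ then 1 else 0) ≤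
      iidExp q m (fun l => Real.exp θ * (l.map fun w => Real.exp (-((A w).toNat : ℝ))).prod) := by
    refine iidExp_mono hq m fun l _ => ?_
    rw [← h1]
    split_ifs with h
    · rw [Real.one_le_exp_iff]; linarith
    · positivity
  have h3 : ∑ w, q w * Real.exp (-((A w).toNat : ℝ)) ≤ 1 - 3 / 5 * p := by
    have h4 : ∀ w, q w * Real.exp (-((A w).toNat : ℝ)) ≤ q w - 3 / 5 * (q w * (A w).toNat) := by
      intro w
      -- The constant 3/5 is a lower bound for 1 - 1/e, which arises from the exponential moment
      -- with parameter -1.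
      have he : Real.exp (-1) ≤ 2 / 5 := by
        rw [Real.exp_neg, inv_le_comm₀ (Real.exp_pos _) (by norm_num)]
        linarith [Real.exp_one_gt_d9]
      cases A w
      · simp
      · simp only [Bool.toNat_true, Nat.cast_one, mul_one]
        nlinarith [hq w]
    refine (Finset.sum_le_sum fun w _ => h4 w).trans ?_
    rw [Finset.sum_sub_distrib, hq1, ← Finset.mul_sum]
    linarith
  have h5 : (∑ w, q w * Real.exp (-((A w).toNat : ℝ))) ^ m ≤ Real.exp (-(3 / 5 * p * m)) := by
    rw [show -(3 / 5 * p * m) = m * (-(3 / 5 * p)) by ring, Real.exp_nat_mul]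
    refine pow_le_pow_left₀ (Finset.sum_nonneg fun w _ => mul_nonneg (hq w) (Real.exp_pos _).le)
      (h3.trans ?_) m
    linarith [Real.add_one_le_exp (-(3 / 5 * p))]
  rw [iidExp_prod] at h2
  refine h2.trans ?_
  rw [sub_eq_add_neg, Real.exp_add]
  exact mul_le_mul_of_nonneg_left h5 (Real.exp_pos _).le

open Classical in
/-- A one-sided deviation bound for a centred bounded function. -/
theorem iidExp_sum_ge (hq : ∀ w, 0 ≤ q w) (hq1 : ∑ w, q w = 1) (g : W → ℝ) (hg : ∀ w, |g w| ≤ 1)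
    (hg0 : ∑ w, q w * g w = 0) {η : ℝ} (h0 : 0 ≤ η) (h2 : η ≤ 2) (m : ℕ) :
    iidExp q m (fun l => if η * m ≤ (l.map g).sum then 1 else 0) ≤
      Real.exp (-(η ^ 2 / 4 * m)) := by
  -- The parameter η/2 minimises λ² - λη, the exponent that results from bounding the moment of one
  -- draw by 1 + λ².
  have h1 : ∀ l : List W, Real.exp (η / 2 * ((l.map g).sum - η * m)) =
      Real.exp (-(η ^ 2 / 2 * m)) * (l.map fun w => Real.exp (η / 2 * g w)).prod := by
    intro l
    have : (l.map fun w => Real.exp (η / 2 * g w)).prod = Real.exp (η / 2 * (l.map g).sum) := by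
      induction l with
      | nil => simp
      | cons w l ih => simp [ih, mul_add, Real.exp_add]
    rw [this, ← Real.exp_add]
    congr 1
    ring
  have h3 : iidExp q m (fun l => if η * m ≤ (l.map g).sum then 1 else 0) ≤
      iidExp q m (fun l => Real.exp (-(η ^ 2 / 2 * m)) *
        (l.map fun w => Real.exp (η / 2 * g w)).prod) := by
    refine iidExp_mono hq m fun l _ => ?_
    rw [← h1]
    split_ifs with h
    · rw [Real.one_le_exp_iff]
      exact mul_nonneg (by linarith) (by linarith)
    · positivity
  have h4 : ∑ w, q w * Real.exp (η / 2 * g w) ≤ 1 + η ^ 2 / 4 := by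
    have h5 : ∀ w, q w * Real.exp (η / 2 * g w) ≤
        q w * (1 + η ^ 2 / 4) + η / 2 * (q w * g w) := by
      intro w
      have h6 : |η / 2 * g w| ≤ 1 := by
        rw [abs_mul, abs_of_nonneg (by linarith : 0 ≤ η / 2)]
        nlinarith [hg w, abs_nonneg (g w)]
      -- The bound exp x ≤ 1 + x + x² needs |x| ≤ 1, which is why η ≤ 2 is assumed.
      have h7 := (abs_le.1 (Real.abs_exp_sub_one_sub_id_le h6)).2
      have h8 : g w ^ 2 ≤ 1 := by
        rw [← sq_abs]
        exact pow_le_one₀ (abs_nonneg _) (hg w)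
      have h9 : Real.exp (η / 2 * g w) ≤ 1 + η ^ 2 / 4 + η / 2 * g w := by nlinarith [sq_nonneg η]
      have := mul_le_mul_of_nonneg_left h9 (hq w)
      linarith
    refine (Finset.sum_le_sum fun w _ => h5 w).trans ?_
    rw [Finset.sum_add_distrib, ← Finset.sum_mul, hq1, ← Finset.mul_sum, hg0]
    linarith
  rw [iidExp_prod] at h3
  refine h3.trans ?_
  have h10 : (∑ w, q w * Real.exp (η / 2 * g w)) ^ m ≤ Real.exp (η ^ 2 / 4 * m) := by
    rw [mul_comm, Real.exp_nat_mul]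
    refine pow_le_pow_left₀ (Finset.sum_nonneg fun w _ => mul_nonneg (hq w) (Real.exp_pos _).le)
      (h4.trans ?_) m
    linarith [Real.add_one_le_exp (η ^ 2 / 4)]
  refine (mul_le_mul_of_nonneg_left h10 (Real.exp_pos _).le).trans ?_
  rw [← Real.exp_add]
  exact Real.exp_le_exp.2 (by linarith)

open Classical in
/-- A two-sided deviation bound for the frequency of an event. -/
theorem iidExp_count_dev (hq : ∀ w, 0 ≤ q w) (hq1 : ∑ w, q w = 1) (A : W → Bool) {p : ℝ}
    (hp : ∑ w, q w * (A w).toNat = p) {η : ℝ} (h0 : 0 ≤ η) (h2 : η ≤ 2) (m : ℕ) :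
    iidExp q m (fun l => if η * m ≤ |(l.countP A : ℝ) - p * m| then 1 else 0) ≤
      2 * Real.exp (-(η ^ 2 / 4 * m)) := by
  have hp0 : 0 ≤ p := hp ▸ Finset.sum_nonneg fun w _ => mul_nonneg (hq w) (Nat.cast_nonneg _)
  have hp1 : p ≤ 1 := by
    rw [← hp, ← hq1]
    refine Finset.sum_le_sum fun w _ => ?_
    have := hq w
    cases A w <;> simp [this]
  have hsum : ∀ l : List W, (l.map fun w => ((A w).toNat : ℝ) - p).sum =
      (l.countP A : ℝ) - p * l.length := by
    intro l
    induction l with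
    | nil => simp
    | cons w l ih =>
      rw [List.map_cons, List.sum_cons, ih, List.countP_cons, List.length_cons]
      cases A w <;> simp <;> ring
  have hsum' : ∀ l : List W, (l.map fun w => p - ((A w).toNat : ℝ)).sum =
      -((l.countP A : ℝ) - p * l.length) := by
    intro l
    rw [← hsum]
    induction l with
    | nil => simp
    | cons w l ih => rw [List.map_cons, List.sum_cons, ih, List.map_cons, List.sum_cons]; ring
  have hb : ∀ w, |((A w).toNat : ℝ) - p| ≤ 1 := by
    intro w
    rw [abs_le]
    cases A w <;> simp <;> constructor <;> linarith
  have e1 := iidExp_sum_ge hq hq1 (fun w => ((A w).toNat : ℝ) - p) hb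
    (by simp only [mul_sub, Finset.sum_sub_distrib, ← Finset.sum_mul, hq1, hp]; ring) h0 h2 m
  have e2 := iidExp_sum_ge hq hq1 (fun w => p - ((A w).toNat : ℝ))
    (fun w => by rw [abs_sub_comm]; exact hb w)
    (by simp only [mul_sub, Finset.sum_sub_distrib, ← Finset.sum_mul, hq1, hp]; ring) h0 h2 m
  have e3 := add_le_add e1 e2
  rw [← iidExp_add] at e3
  refine (iidExp_mono hq m fun l hl => ?_).trans (e3.trans_eq (by ring))
  rw [hsum, hsum', hl]
  split_ifs with f1 f2 f3 f4 <;> norm_num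
  rcases abs_cases ((l.countP A : ℝ) - p * m) with ⟨h, _⟩ | ⟨h, _⟩
  · exact absurd (h ▸ f1) f2
  · exact absurd (h ▸ f1) (by assumption)

end

/-! ### The success probability of the learner -/

section

variable {n : ℕ} {D : PMF (Cube n × Bool)}

/-- The output of the learner on `m` Fourier samples and `m` labelled examples. -/
def learn (m : ℕ) (a : List (Entry n) × Cube n) (l₁ l₂ : List (Cube (n + 1))) : Cube n :=
  (drainStep^[m] (l₂.foldl agreeStep (drainStep^[m]
    (l₁.foldl (fun a w => mgUpdate a (Fin.init w)) a)))).2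

theorem err_eq_corr (D : PMF (Cube n × Bool)) (s : Cube n) :
    err D (parity s) = (1 - corr D s) / 2 := by rw [corr]; ring

theorem sum_agree (hD : D ∈ uniformMarginal n) (s : Cube n) :
    ∑ w, outcomeProb false (mixtureExample D) w * (agree w s).toNat = 1 - err D (parity s) := by
  have h1 := sum_outcomeProb hD false
  simp only [outcomeProb_false hD] at h1 ⊢
  rw [← (Fin.snocEquiv fun _ => Bool).sum_comp, Fintype.sum_prod_type_right] at h1 ⊢
  rw [← h1, err_eq, ← Finset.sum_sub_distrib]
  refine Finset.sum_congr rfl fun x _ => ?_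
  simp only [Fin.snocEquiv, Equiv.coe_fn_mk, Fin.init_snoc, Fin.snoc_last, Fintype.sum_bool, agree]
  cases parity s x <;> simp

/-- A strongly correlated `t` is itself a candidate. Otherwise err(t) > (1 - ε)/2, and a candidate
with c(u) ≥ -3ε/4 has error at most (1 + 3ε/4)/2; the difference is 7ε/8. The bound 3/4 on the error
guarantees later that this candidate agrees with some example. -/
theorem exists_good_entry (hD : D ∈ uniformMarginal n) {ε : ℝ} (h0 : 0 < ε) (h1 : ε < 1 / 2)
    {K : List (Cube n)} (hK : K.Nodup) (hk : 4 ≤ K.length * ε ^ 2) (t : Cube n)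
    (ht : ε ≤ corr D t → t ∈ K) :
    ∃ u ∈ K, err D (parity u) ≤ err D (parity t) + 7 / 8 * ε ∧ err D (parity u) ≤ 3 / 4 := by
  simp only [err_eq_corr]
  by_cases hc : ε ≤ corr D t
  · exact ⟨t, ht hc, by linarith, by linarith⟩
  · push Not at hc
    have hsum : ∑ s ∈ K.toFinset, corr D s ^ 2 ≤ 2 :=
      (Finset.sum_le_sum_of_subset_of_nonneg (Finset.subset_univ _)
        fun _ _ _ => sq_nonneg _).trans (sum_corr_sq_le hD)
    have hcard : K.toFinset.card = K.length := List.toFinset_card_of_nodup hK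
    -- Averaging: the squared correlations sum to at most 2 over at least 4/ε² distinct strings.
    obtain ⟨u, hu, hu'⟩ : ∃ u ∈ K.toFinset, corr D u ^ 2 ≤ ε ^ 2 / 2 := by
      by_contra! hcon
      have h2 : ∑ s ∈ K.toFinset, ε ^ 2 / 2 < ∑ s ∈ K.toFinset, corr D s ^ 2 := by
        refine Finset.sum_lt_sum_of_nonempty ?_ hcon
        rw [← Finset.card_pos, hcard]
        by_contra h
        have : K.length = 0 := by omega
        rw [this] at hk
        norm_num at hk
      rw [Finset.sum_const, hcard, nsmul_eq_mul] at h2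
      linarith
    have h3 : -(3 / 4 * ε) ≤ corr D u := by
      by_contra! h
      nlinarith
    exact ⟨u, List.mem_toFinset.1 hu, by linarith, by linarith⟩

/-- The winner has at least as many agreements as `u`. Two estimates, each off by less than ε/16,
cost at most ε/8, and 7ε/8 + ε/8 = ε. Since the counters start at zero, they end up equal to the
numbers of agreements. -/
theorem err_learn_le {ε : ℝ} (h1 : ε < 1 / 2) {m : ℕ} (hm : 0 < m)
    {l₂ : List (Cube (n + 1))} (hl₂ : l₂.length = m) {es : List (Entry n)} {R : Cube n}
    (hz : ∀ e ∈ es, e.2 = 0) {u t : Cube n} (hu : u ∈ es.map Prod.fst)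
    (hut : err D (parity u) ≤ err D (parity t) + 7 / 8 * ε) (hu2 : err D (parity u) ≤ 3 / 4)
    (hgood : ∀ s ∈ es.map Prod.fst,
      |(l₂.countP (fun w => agree w s) : ℝ) - (1 - err D (parity s)) * m| < ε / 16 * m) :
    err D (parity (drainStep^[m] (l₂.foldl agreeStep (es, R))).2) ≤ err D (parity t) + ε := by
  have hm' : (0 : ℝ) < m := Nat.cast_pos.2 hm
  have hu3 := (abs_lt.1 (hgood u hu)).1
  obtain ⟨eu, heu, rfl⟩ := List.mem_map.1 hu
  rw [foldl_agreeStep]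
  obtain ⟨e, he, heR, hmax⟩ := drain_snd m
    (es.map fun e => (e.1, e.2 + l₂.countP fun w => agree w e.1), R)
    ⟨_, List.mem_map.2 ⟨eu, heu, rfl⟩, by
      -- Draining records a key only if some counter is positive. Here the count exceeds (1 - 3/4 -
      -- ε/16) m > 0.
      have : (0 : ℝ) < l₂.countP fun w => agree w eu.1 := by nlinarith
      have := Nat.cast_pos.1 this
      simp only
      omega⟩
    (by
      intro e he
      obtain ⟨e', he', rfl⟩ := List.mem_map.1 he
      have h2 : l₂.countP (fun w => agree w e'.1) ≤ l₂.length := List.countP_le_length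
      simp only [hz e' he', zero_add]
      omega)
  obtain ⟨e', he', rfl⟩ := List.mem_map.1 he
  have h4 := hmax _ (List.mem_map.2 ⟨eu, heu, rfl⟩)
  simp only [hz e' he', hz eu heu, zero_add] at h4
  have h5 : (l₂.countP (fun w => agree w eu.1) : ℝ) ≤ l₂.countP (fun w => agree w e'.1) := by
    exact_mod_cast h4
  have h6 := (abs_lt.1 (hgood e'.1 (List.mem_map_of_mem he'))).2
  rw [heR]
  simp only
  have h7 : err D (parity e'.1) * m < (err D (parity eu.1) + ε / 8) * m := by linarith
  have h8 := lt_of_mul_lt_mul_right h7 hm'.le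
  linarith

/-- Two things can fail: a strongly correlated optimum may be too rare among the Fourier samples
(probability at most X), or one of the k agreement frequencies may deviate by ε/16 (at most 2X
each). The candidates depend on the first samples only, so the second bound is applied conditionally
on them. -/
theorem learn_prob (hD : D ∈ uniformMarginal n) {ε δ : ℝ} (h0 : 0 < ε) (h1 : ε < 1 / 2)
    (hδ : δ < 1) {k m : ℕ} {es₀ : List (Entry n)} (R₀ : Cube n) (hlen : es₀.length = k)
    (hnd : (es₀.map Prod.fst).Nodup) (hz : ∀ e ∈ es₀, e.2 = 0) (hk : 4 ≤ k * ε ^ 2)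
    (hm : 2 * k * Real.exp (-(ε ^ 2 / 1024 * m)) ≤ δ / 2) (S : Set (Cube n))
    [DecidablePred (· ∈ S)]
    (hS : ∀ s, err D (parity s) ≤ (⨅ t : Cube n, err D (parity t)) + ε → s ∈ S) :
    1 - δ ≤ iidExp (outcomeProb true (mixtureExample D)) m fun l₁ =>
      iidExp (outcomeProb false (mixtureExample D)) m fun l₂ =>
        if learn m (es₀, R₀) l₁ l₂ ∈ S then 1 else 0 := by
  classical
  obtain ⟨t, ht⟩ := Finite.exists_min fun t : Cube n => err D (parity t)
  have hS' : ∀ s, err D (parity s) ≤ err D (parity t) + ε → s ∈ S := fun s hs =>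
    hS s (hs.trans (by have := le_ciInf ht; linarith))
  have hq1 := outcomeProb_nonneg hD true
  have hq2 := outcomeProb_nonneg hD false
  have hs1 := sum_outcomeProb hD true
  have hs2 := sum_outcomeProb hD false
  have hk1 : (1 : ℝ) ≤ k := by
    rw [Nat.one_le_cast]
    by_contra h
    have : k = 0 := by omega
    subst this
    norm_num at hk
  have hm0 : 0 < m := by
    by_contra h
    have : m = 0 := by omega
    subst this
    norm_num at hm
    linarith
  set X := Real.exp (-(ε ^ 2 / 1024 * m)) with hX
  have hXpos : 0 < X := Real.exp_pos _
  set A : Cube (n + 1) → Bool := fun w => decide (Fin.init w = t) with hA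
  set θ : ℝ := m / (k + 1) with hθ
  set bad : List (Cube (n + 1)) → ℝ := fun l => if (l.countP A : ℝ) ≤ θ then 1 else 0 with hbad
  -- The factor `c` removes the first failure event when the optimum is weakly correlated, since
  -- then it need not survive.
  set c : ℝ := if ε ≤ corr D t then 1 else 0 with hc
  set mg := fun l₁ : List (Cube (n + 1)) =>
    l₁.foldl (fun a w => mgUpdate a (Fin.init w)) (es₀, R₀) with hmg
  have hinv : ∀ l₁, MGInv k (l₁.map fun w => (Fin.init w : Cube n)) (mg l₁).1 := by
    intro l₁
    have h2 : MGInv k ([] : List (Cube n)) es₀ := by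
      refine ⟨hlen, hnd, 0, ?_, by simp⟩
      have : total es₀ = 0 := by
        rw [total, List.sum_eq_zero_iff]
        intro x hx
        obtain ⟨e, he, rfl⟩ := List.mem_map.1 hx
        exact hz e he
      simp [this]
    have h3 := h2.foldl (l₁.map fun w => (Fin.init w : Cube n)) (a := (es₀, R₀))
    rw [List.foldl_map] at h3
    simpa using h3
  have hbad_le : c * iidExp (outcomeProb true (mixtureExample D)) m bad ≤ X := by
    by_cases hct : ε ≤ corr D t
    · rw [hc, if_pos hct, one_mul]
      have hp : ε ^ 2 / 2 ≤ ∑ w, outcomeProb true (mixtureExample D) w * (A w).toNat := by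
        have h2 := half_corr_sq_le hD t
        -- The learner ignores the label of a Fourier outcome. Both labels count towards `t`, and
        -- the one with label 1 already has enough mass.
        have h3 := Finset.single_le_sum (f := fun w => outcomeProb true (mixtureExample D) w *
          (A w).toNat) (fun w _ => mul_nonneg (hq1 w) (Nat.cast_nonneg _))
          (Finset.mem_univ (Fin.snoc t true : Cube (n + 1)))
        simp only [hA, Fin.init_snoc, decide_true, Bool.toNat_true, Nat.cast_one, mul_one] at h3
        nlinarith
      refine (iidExp_count_le hq1 hs1 A m hp).trans (Real.exp_le_exp.2 ?_)
      -- The Misra-Gries threshold m/(k+1) is below ε²m/4, while the Chernoff exponent contributes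
      -- 3/5 · ε²/2 · m; the gap ε²m/20 more than covers ε²m/1024.
      have h4 : θ ≤ ε ^ 2 / 4 * m := by
        rw [hθ, div_le_iff₀ (by linarith)]
        have : (0 : ℝ) ≤ m := Nat.cast_nonneg m
        nlinarith [mul_nonneg this (sq_nonneg ε), mul_le_mul_of_nonneg_right hk this]
      have : 0 ≤ ε ^ 2 * m := by positivity
      linarith
    · rw [hc, if_neg hct, zero_mul]
      exact hXpos.le
  have hinner : ∀ l₁ : List (Cube (n + 1)), l₁.length = m → 1 - c * bad l₁ - 2 * k * X ≤
      iidExp (outcomeProb false (mixtureExample D)) m fun l₂ =>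
        if learn m (es₀, R₀) l₁ l₂ ∈ S then 1 else 0 := by
    intro l₁ hl₁
    set es := (mg l₁).1 with hes
    set K := es.map Prod.fst with hK
    have hKlen : K.length = k := by rw [hK, List.length_map]; exact (hinv l₁).length_eq
    set dev : Cube n → List (Cube (n + 1)) → ℝ := fun s l₂ =>
      if ε / 16 * m ≤ |(l₂.countP (fun w => agree w s) : ℝ) - (1 - err D (parity s)) * m|
      then 1 else 0 with hdev
    have hdev0 : ∀ s l, 0 ≤ dev s l := by
      intro s l
      simp only [hdev]
      split_ifs <;> norm_num
    have hpt : ∀ l₂ : List (Cube (n + 1)), l₂.length = m →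
        (1 - c * bad l₁) - (K.map fun s => dev s l₂).sum ≤
          if learn m (es₀, R₀) l₁ l₂ ∈ S then 1 else 0 := by
      intro l₂ hl₂
      have hsum0 : 0 ≤ (K.map fun s => dev s l₂).sum :=
        List.sum_nonneg fun x hx => by
          obtain ⟨s, _, rfl⟩ := List.mem_map.1 hx
          exact hdev0 s l₂
      have hcb : 0 ≤ c * bad l₁ := by
        simp only [hc, hbad]
        split_ifs <;> norm_num
      by_cases hd : ∃ s ∈ K, dev s l₂ = 1
      · obtain ⟨s, hs, hs1⟩ := hd
        have h2 : dev s l₂ ≤ (K.map fun s => dev s l₂).sum :=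
          List.single_le_sum (fun x hx => by
            obtain ⟨s, _, rfl⟩ := List.mem_map.1 hx
            exact hdev0 s l₂) _ (List.mem_map_of_mem hs)
        have h3 : (1 - c * bad l₁) - (K.map fun s => dev s l₂).sum ≤ 0 := by linarith
        exact h3.trans (by split_ifs <;> norm_num)
      by_cases hb : c * bad l₁ = 1
      · have h3 : (1 - c * bad l₁) - (K.map fun s => dev s l₂).sum ≤ 0 := by linarith
        exact h3.trans (by split_ifs <;> norm_num)
      rw [if_pos]
      · linarith
      apply hS'
      have hmem : ε ≤ corr D t → t ∈ K := by
        intro hct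
        refine (hinv l₁).mem ?_
        have h4 : ¬ (l₁.countP A : ℝ) ≤ θ := by
          intro h
          exact hb (by simp [hc, hbad, hct, h])
        have h5 : (l₁.map fun w => (Fin.init w : Cube n)).count t = l₁.countP A := by
          rw [List.count, List.countP_map]
          congr 1
        rw [h5, List.length_map, hl₁]
        rw [hθ, not_le, div_lt_iff₀ (by linarith)] at h4
        have : (m : ℝ) < ((k + 1) * l₁.countP A : ℕ) := by push_cast; linarith
        exact_mod_cast this
      obtain ⟨u, hu, hu1, hu2⟩ := exists_good_entry hD h0 h1 (hinv l₁).nodup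
        (by rw [← hes, ← hK, hKlen]; exact hk) t hmem
      have hdr : ((drainStep^[m] (mg l₁)).1).map Prod.fst = K := by
        rw [drain_fst, List.map_map, hK]
        rfl
      have hfin := err_learn_le (D := D) (R := (drainStep^[m] (mg l₁)).2) h1 hm0 hl₂
        (es := (drainStep^[m] (mg l₁)).1) ?_ (by rw [hdr]; exact hu) hu1 hu2 ?_
      · exact hfin
      · intro e he
        rw [drain_fst] at he
        obtain ⟨e', he', rfl⟩ := List.mem_map.1 he
        have := (hinv l₁).le he'
        simp only [List.length_map, hl₁] at this ⊢
        omega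
      · rw [hdr]
        intro s hs
        by_contra hcon
        exact hd ⟨s, hs, if_pos (not_lt.1 hcon)⟩
    refine le_trans ?_ (iidExp_mono hq2 m hpt)
    rw [iidExp_sub, iidExp_const hs2, iidExp_list_sum]
    have h6 : (K.map fun s => iidExp (outcomeProb false (mixtureExample D)) m (dev s)).sum ≤
        2 * k * X := by
      have h7 : ∀ s, iidExp (outcomeProb false (mixtureExample D)) m (dev s) ≤ 2 * X := by
        intro s
        have := iidExp_count_dev hq2 hs2 (fun w => agree w s) (sum_agree hD s) (η := ε / 16)
          (by linarith) (by linarith) m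
        rwa [show (ε / 16) ^ 2 / 4 = ε ^ 2 / 1024 by ring] at this
      have h8 := List.sum_le_card_nsmul (K.map fun s =>
        iidExp (outcomeProb false (mixtureExample D)) m (dev s)) (2 * X) (by
          intro x hx
          obtain ⟨s, _, rfl⟩ := List.mem_map.1 hx
          exact h7 s)
      rw [List.length_map, hKlen, nsmul_eq_mul] at h8
      linarith
    linarith
  refine le_trans ?_ (iidExp_mono hq1 m hinner)
  rw [iidExp_sub, iidExp_sub, iidExp_const hs1, iidExp_const hs1]
  rw [iidExp_const_mul]
  -- The total failure X + 2kX is at most 4kX, which is at most δ by `hm`.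
  have : X ≤ 2 * k * X := by nlinarith
  linarith

end

/-! ### The stacks of the learner -/

/-- The contents of the stacks. -/
structure St where
  /-- input and output -/
  I : List Sym
  /-- the number of qubits in unary -/
  N : List Sym
  N2 : List Sym
  /-- the current sample -/
  X : List Sym
  X2 : List Sym
  /-- the keys of the entries -/
  A : List Sym
  A2 : List Sym
  /-- the counters of the entries -/
  Q : List Sym
  Q2 : List Sym
  /-- the flag of a pass -/
  F : List Sym
  /-- the result of a comparison -/
  G : List Sym
  /-- the recorded entry -/
  R : List Sym
  /-- the number of samples in unary -/
  M : List Sym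
  M2 : List Sym
  /-- the length of the binary input, in unary -/
  L : List Sym
  /-- copies of the inverse accuracy in unary -/
  U : List Sym
  U2 : List Sym
  /-- the number of entries in unary -/
  K : List Sym
  /-- scratch -/
  T : List Sym
  /-- a power of two in unary -/
  P : List Sym
  /-- a string that runs through the initial keys -/
  Y : List Sym

/-- The stacks as a function of the index. -/
def St.fn (s : St) : Fin (20 + 1) → List Sym :=
  ![s.I, s.N, s.N2, s.X, s.X2, s.A, s.A2, s.Q, s.Q2, s.F, s.G, s.R,
    s.M, s.M2, s.L, s.U, s.U2, s.K, s.T, s.P, s.Y]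

/-- The index of `I`. -/
def sI : Fin (20 + 1) := 0

/-- The index of `N`. -/
def sN : Fin (20 + 1) := 1

/-- The index of `N2`. -/
def sN2 : Fin (20 + 1) := 2

/-- The index of `X`. -/
def sX : Fin (20 + 1) := 3

/-- The index of `X2`. -/
def sX2 : Fin (20 + 1) := 4

/-- The index of `A`. -/
def sA : Fin (20 + 1) := 5

/-- The index of `A2`. -/
def sA2 : Fin (20 + 1) := 6

/-- The index of `Q`. -/
def sQ : Fin (20 + 1) := 7

/-- The index of `Q2`. -/
def sQ2 : Fin (20 + 1) := 8

/-- The index of `F`. -/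
def sF : Fin (20 + 1) := 9

/-- The index of `G`. -/
def sG : Fin (20 + 1) := 10

/-- The index of `R`. -/
def sR : Fin (20 + 1) := 11

/-- The index of `M`. -/
def sM : Fin (20 + 1) := 12

/-- The index of `M2`. -/
def sM2 : Fin (20 + 1) := 13

/-- The index of `L`. -/
def sL : Fin (20 + 1) := 14

/-- The index of `U`. -/
def sU : Fin (20 + 1) := 15

/-- The index of `U2`. -/
def sU2 : Fin (20 + 1) := 16

/-- The index of `K`. -/
def sK : Fin (20 + 1) := 17

/-- The index of `T`. -/
def sT : Fin (20 + 1) := 18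

/-- The index of `P`. -/
def sP : Fin (20 + 1) := 19

/-- The index of `Y`. -/
def sY : Fin (20 + 1) := 20

section

variable (s : St) (l : List Sym)

@[simp] theorem fn_sI : s.fn sI = s.I := rfl

@[simp] theorem fn_sN : s.fn sN = s.N := rfl

@[simp] theorem fn_sX : s.fn sX = s.X := rfl

@[simp] theorem fn_sX2 : s.fn sX2 = s.X2 := rfl

@[simp] theorem fn_sA : s.fn sA = s.A := rfl

@[simp] theorem fn_sA2 : s.fn sA2 = s.A2 := rfl

@[simp] theorem fn_sQ : s.fn sQ = s.Q := rfl

@[simp] theorem fn_sQ2 : s.fn sQ2 = s.Q2 := rfl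

@[simp] theorem fn_sF : s.fn sF = s.F := rfl

@[simp] theorem fn_sG : s.fn sG = s.G := rfl

@[simp] theorem fn_sR : s.fn sR = s.R := rfl

@[simp] theorem fn_sM : s.fn sM = s.M := rfl

@[simp] theorem fn_sM2 : s.fn sM2 = s.M2 := rfl

@[simp] theorem fn_sL : s.fn sL = s.L := rfl

@[simp] theorem fn_sU : s.fn sU = s.U := rfl

@[simp] theorem fn_sU2 : s.fn sU2 = s.U2 := rfl

@[simp] theorem fn_sK : s.fn sK = s.K := rfl

@[simp] theorem fn_sT : s.fn sT = s.T := rfl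

@[simp] theorem fn_sP : s.fn sP = s.P := rfl

@[simp] theorem fn_sY : s.fn sY = s.Y := rfl

@[simp] theorem update_sI :
    Function.update s.fn sI l = St.fn { s with I := l } := by
  funext i; fin_cases i <;> rfl

@[simp] theorem update_sN :
    Function.update s.fn sN l = St.fn { s with N := l } := by
  funext i; fin_cases i <;> rfl

@[simp] theorem update_sX :
    Function.update s.fn sX l = St.fn { s with X := l } := by
  funext i; fin_cases i <;> rfl

@[simp] theorem update_sX2 :
    Function.update s.fn sX2 l = St.fn { s with X2 := l } := by
  funext i; fin_cases i <;> rfl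

@[simp] theorem update_sA :
    Function.update s.fn sA l = St.fn { s with A := l } := by
  funext i; fin_cases i <;> rfl

@[simp] theorem update_sA2 :
    Function.update s.fn sA2 l = St.fn { s with A2 := l } := by
  funext i; fin_cases i <;> rfl

@[simp] theorem update_sQ :
    Function.update s.fn sQ l = St.fn { s with Q := l } := by
  funext i; fin_cases i <;> rfl

@[simp] theorem update_sQ2 :
    Function.update s.fn sQ2 l = St.fn { s with Q2 := l } := by
  funext i; fin_cases i <;> rfl

@[simp] theorem update_sF :
    Function.update s.fn sF l = St.fn { s with F := l } := by
  funext i; fin_cases i <;> rfl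

@[simp] theorem update_sG :
    Function.update s.fn sG l = St.fn { s with G := l } := by
  funext i; fin_cases i <;> rfl

@[simp] theorem update_sR :
    Function.update s.fn sR l = St.fn { s with R := l } := by
  funext i; fin_cases i <;> rfl

@[simp] theorem update_sM :
    Function.update s.fn sM l = St.fn { s with M := l } := by
  funext i; fin_cases i <;> rfl

@[simp] theorem update_sM2 :
    Function.update s.fn sM2 l = St.fn { s with M2 := l } := by
  funext i; fin_cases i <;> rfl

@[simp] theorem update_sL :
    Function.update s.fn sL l = St.fn { s with L := l } := by
  funext i; fin_cases i <;> rfl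

@[simp] theorem update_sU :
    Function.update s.fn sU l = St.fn { s with U := l } := by
  funext i; fin_cases i <;> rfl

@[simp] theorem update_sU2 :
    Function.update s.fn sU2 l = St.fn { s with U2 := l } := by
  funext i; fin_cases i <;> rfl

@[simp] theorem update_sK :
    Function.update s.fn sK l = St.fn { s with K := l } := by
  funext i; fin_cases i <;> rfl

@[simp] theorem update_sT :
    Function.update s.fn sT l = St.fn { s with T := l } := by
  funext i; fin_cases i <;> rfl

@[simp] theorem update_sP :
    Function.update s.fn sP l = St.fn { s with P := l } := by
  funext i; fin_cases i <;> rfl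

@[simp] theorem update_sY :
    Function.update s.fn sY l = St.fn { s with Y := l } := by
  funext i; fin_cases i <;> rfl

end

/-! ### Binary counters -/

/-- Increment a number in binary, least significant bit first. -/
def incBits : List Bool → List Bool
  | [] => [true]
  | false :: l => true :: l
  | true :: l => false :: incBits l

theorem bits_succ (c : ℕ) : Nat.bits (c + 1) = incBits (Nat.bits c) := by
  induction c using Nat.strong_induction_on with
  | _ c ih =>
    rcases Nat.even_or_odd' c with ⟨d, rfl | rfl⟩
    · rcases Nat.eq_zero_or_pos d with rfl | hd
      · simp [incBits]
      · rw [Nat.bit1_bits, Nat.bit0_bits d hd.ne', incBits]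
    · rw [show 2 * d + 1 + 1 = 2 * (d + 1) by ring, Nat.bit0_bits (d + 1) (by omega),
        Nat.bit1_bits, incBits, ih d (by omega)]

theorem incBits_cases (l : List Bool) : ∃ a,
    (l = List.replicate a true ∧ incBits l = List.replicate a false ++ [true]) ∨
    ∃ l', l = List.replicate a true ++ false :: l' ∧
      incBits l = List.replicate a false ++ true :: l' := by
  induction l with
  | nil => exact ⟨0, Or.inl ⟨rfl, rfl⟩⟩
  | cons b l ih =>
    cases b
    · exact ⟨0, Or.inr ⟨l, rfl, rfl⟩⟩
    · obtain ⟨a, ⟨h1, h2⟩ | ⟨l', h1, h2⟩⟩ := ih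
      · exact ⟨a + 1, Or.inl ⟨by rw [h1, List.replicate_succ], by
          rw [incBits, h2, List.replicate_succ, List.cons_append]⟩⟩
      · exact ⟨a + 1, Or.inr ⟨l', by rw [h1, List.replicate_succ, List.cons_append], by
          rw [incBits, h2, List.replicate_succ, List.cons_append]⟩⟩

/-- The borrow flips the low zeros and clears the lowest 1. If that was the top bit, it must vanish,
because `Nat.bits` has no leading zeros; this normal form lets the machine recognise a zero counter
by an empty block. -/
theorem bits_pred_cases (c : ℕ) (hc : c ≠ 0) : ∃ a b,
    Nat.bits c = List.replicate a false ++ true :: Nat.bits b ∧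
    Nat.bits (c - 1) = List.replicate a true ++ if b = 0 then [] else false :: Nat.bits b := by
  induction c using Nat.strong_induction_on with
  | _ c ih =>
    rcases Nat.even_or_odd' c with ⟨d, rfl | rfl⟩
    · have hd : d ≠ 0 := by omega
      obtain ⟨a, b, h1, h2⟩ := ih d (by omega) hd
      refine ⟨a + 1, b, ?_, ?_⟩
      · rw [Nat.bit0_bits d hd, h1, List.replicate_succ, List.cons_append]
      · rw [show 2 * d - 1 = 2 * (d - 1) + 1 by omega, Nat.bit1_bits, h2, List.replicate_succ,
          List.cons_append]
    · refine ⟨0, d, by simp, ?_⟩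
      split_ifs with h
      · simp [h]
      · simp [Nat.bit0_bits d h]

theorem bits_eq_append_true (b : ℕ) (hb : b ≠ 0) : ∃ l, Nat.bits b = l ++ [true] := by
  induction b using Nat.strong_induction_on with
  | _ b ih =>
    rcases Nat.even_or_odd' b with ⟨d, rfl | rfl⟩
    · have hd : d ≠ 0 := by omega
      obtain ⟨l, h⟩ := ih d (by omega) hd
      exact ⟨false :: l, by rw [Nat.bit0_bits d hd, h, List.cons_append]⟩
    · rcases Nat.eq_zero_or_pos d with rfl | hd
      · exact ⟨[], by simp⟩
      · obtain ⟨l, h⟩ := ih d (by omega) hd.ne'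
        exact ⟨true :: l, by rw [Nat.bit1_bits, h, List.cons_append]⟩

theorem encode_append (l l' : List Bool) : encode (l ++ l') = encode l ++ encode l' :=
  List.map_append

theorem encode_cons (b : Bool) (l : List Bool) : encode (b :: l) = .bit b :: encode l := rfl

theorem encode_reverse (l : List Bool) : encode l.reverse = (encode l).reverse := List.map_reverse

theorem length_encode (l : List Bool) : (encode l).length = l.length := List.length_map _

section

variable {k : ℕ} {S : Fin (k + 1) → List Sym} {i j : Fin (k + 1)}

theorem det_moveBits (hij : i ≠ j) {l : List Bool} {r : List Sym} (hr : tBit r.head? = false)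
    (h : S i = encode l ++ r) : Det (moveWhile tBit i j) S
      (Function.update (Function.update S i r) j ((encode l).reverse ++ S j))
      (6 * l.length + 1) :=
  (det_moveWhile hij tBit_of_mem_encode hr h).mono (by rw [length_encode])

/-- Move symbols `b` from `i` to `j`, flipping them. -/
def flipWhile (b : Bool) (i j : Fin (k + 1)) : Cmd k :=
  .loop i (tIs b) (.seq (.pop i) (.push j (.bit !b)))

theorem det_flipWhile (hij : i ≠ j) (b : Bool) {a : ℕ} {r : List Sym} (hr : tIs b r.head? = false)
    (h : S i = encode (List.replicate a b) ++ r) : Det (flipWhile b i j) S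
      (Function.update (Function.update S i r) j (encode (List.replicate a !b) ++ S j))
      (4 * a + 1) := by
  induction a generalizing S with
  | zero =>
    have h' : S i = r := by simpa [encode] using h
    refine (det_loop_done (by rw [h', hr])).of_eq ?_ (by omega)
    simp [encode, ← h']
  | succ a ih =>
    refine (Det.loop_step (by simp [h, List.replicate_succ, encode, tIs])
      ((det_pop i).seq (det_push j _))
      (ih (by simp [Function.update_apply, hij, h, List.replicate_succ, encode]))).of_eq ?_
      (by omega)
    have e : encode (List.replicate (a + 1) !b) = encode (List.replicate a !b) ++ [.bit !b] := by
      simp [encode, List.replicate_succ']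
    rw [e]
    funext x
    have := hij.symm
    simp only [Function.update_apply, List.append_assoc, List.singleton_append]
    split_ifs <;> simp_all

/-- Move a binary number from `i` to `j` and increment it. -/
def incMove (i j : Fin (k + 1)) : Cmd k :=
  .seq (flipWhile true i j) (.seq (.ite i (tIs false) (.seq (.pop i) (.push j (.bit true)))
    (.push j (.bit true))) (moveWhile tBit i j))

theorem det_incMove (hij : i ≠ j) {l : List Bool} {r : List Sym} (hr : tBit r.head? = false)
    (h : S i = encode l ++ r) : Det (incMove i j) S
      (Function.update (Function.update S i r) j ((encode (incBits l)).reverse ++ S j))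
      (6 * l.length + 10) := by
  have hr' : ∀ b, tIs b r.head? = false := by
    intro b
    cases r with
    | nil => rfl
    | cons a r => cases a <;> simp_all [tBit, tIs]
  have hji := hij.symm
  obtain ⟨a, ⟨h1, h2⟩ | ⟨l', h1, h2⟩⟩ := incBits_cases l
  · refine ((det_flipWhile hij true (hr' true) (by rw [h, h1])).seq
      ((Det.ite_false (by simp [hij, hr']) (det_push j _)).seq
        (det_moveBits (l := []) hij hr (by simp [hij, encode])))).of_eq ?_ ?_
    · funext x
      rw [h2]
      simp only [Function.update_apply]
      split_ifs <;> simp_all [encode]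
    · rw [h1]; simp; omega
  · have h3 : S i = encode (List.replicate a true) ++ (.bit false :: (encode l' ++ r)) := by
      rw [h, h1, encode_append, encode_cons]; simp
    refine ((det_flipWhile hij true rfl h3).seq
      ((Det.ite_true (by simp [hij, tIs])
        ((det_pop i).seq (det_push j _))).seq
        (det_moveBits (l := l') hij hr (by simp [Function.update_apply, hij])))).of_eq ?_ ?_
    · funext x
      rw [h2]
      simp only [Function.update_apply]
      split_ifs <;> simp_all [encode]
    · rw [h1]; simp; omega

/-- Move a positive binary number from `i` to `j` and decrement it. -/
def decMove (i j : Fin (k + 1)) : Cmd k :=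
  .seq (flipWhile false i j) (.seq (.pop i) (.seq (.push j (.bit false))
    (.seq (moveWhile tBit i j) (.ite j (tIs false) (.pop j) .skip))))

/-- After the move the most significant bit is on top of `j`. It is 0 only when the cleared bit was
the leading one, and then it is popped to restore the normal form. -/
theorem det_decMove (hij : i ≠ j) {c : ℕ} (hc : c ≠ 0) {r : List Sym} (hr : tBit r.head? = false)
    (h : S i = encode (Nat.bits c) ++ r) : Det (decMove i j) S
      (Function.update (Function.update S i r) j ((encode (Nat.bits (c - 1))).reverse ++ S j))
      (6 * (Nat.bits c).length + 20) := by
  have hji := hij.symm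
  obtain ⟨a, b, h1, h2⟩ := bits_pred_cases c hc
  have h3 : S i = encode (List.replicate a false) ++ (.bit true :: (encode (Nat.bits b) ++ r)) := by
    rw [h, h1, encode_append, encode_cons]; simp
  have h5 : ∀ {S' t}, Det (.ite j (tIs false) (.pop j) .skip)
      (Function.update (Function.update S i r) j
        ((encode (Nat.bits b)).reverse ++ (.bit false :: (encode (List.replicate a true) ++ S j))))
      S' t → Det (decMove i j) S S' (4 * a + (6 * (Nat.bits b).length) + 10 + t) := by
    intro S' t h5
    refine ((det_flipWhile hij false rfl h3).seq ((det_pop i).seq ((det_push j (.bit false)).seq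
      ((det_moveBits (l := Nat.bits b) hij hr (by simp [Function.update_apply, hij])).seq
        (S'' := S') (t' := t) ?_)))).mono (by omega)
    convert h5 using 1
    funext x
    simp only [Function.update_apply]
    split_ifs <;> simp_all
  have hlen : (Nat.bits c).length = a + 1 + (Nat.bits b).length := by
    rw [h1]; simp; omega
  by_cases hb : b = 0
  · subst hb
    refine (h5 (Det.ite_true (by simp [encode, tIs]) (det_pop j))).of_eq ?_ (by omega)
    funext x
    rw [h2]
    simp only [Function.update_apply]
    split_ifs <;> simp_all [encode]
  · obtain ⟨l, hl⟩ := bits_eq_append_true b hb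
    refine (h5 (Det.ite_false (by simp [hl, encode, tIs]) det_skip)).of_eq ?_ (by omega)
    funext x
    rw [h2]
    simp only [Function.update_apply]
    split_ifs <;> simp_all [encode]

end

/-! ### Passes over the entries -/

section

variable {n : ℕ}

/-- The key of an entry: the qubits of an outcome with label `1`, the label first. -/
def key (s : Cube n) : List Bool := wordList (Fin.snoc s true : Cube (n + 1))

theorem wordList_snoc (s : Cube n) (b : Bool) :
    wordList (Fin.snoc s b : Cube (n + 1)) = b :: wordList s := by
  simp only [wordList, List.ofFn_succ', Fin.snoc_castSucc, Fin.snoc_last]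
  simp

theorem length_key (s : Cube n) : (key s).length = n + 1 := length_wordList _

theorem key_injective : Function.Injective (key (n := n)) := by
  intro s t h
  have h1 := congrArg (listWord (n + 1)) h
  rw [key, key, listWord_wordList, listWord_wordList] at h1
  have := congrArg (fun w : Cube (n + 1) => (Fin.init w : Cube n)) h1
  simpa using this

/-- The keys on their stack. -/
def encA : List (Entry n) → List Sym
  | [] => []
  | e :: es => encode (key e.1) ++ .sep :: encA es

/-- The counters on their stack. -/
def encQ : List (Entry n) → List Sym
  | [] => []
  | e :: es => encode (Nat.bits e.2) ++ .sep :: encQ es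

theorem length_encA (es : List (Entry n)) : (encA es).length = es.length * (n + 2) := by
  induction es with
  | nil => simp [encA]
  | cons e es ih =>
    simp only [encA, List.length_append, length_encode, length_key, List.length_cons, ih]
    ring

theorem length_encQ {B : ℕ} (es : List (Entry n)) (h : ∀ e ∈ es, (Nat.bits e.2).length ≤ B) :
    (encQ es).length ≤ es.length * (B + 1) := by
  induction es with
  | nil => simp [encQ]
  | cons e es ih =>
    have h1 := h e (by simp)
    have h2 := ih fun e he => h e (by simp [he])
    simp only [encQ, List.length_append, length_encode, List.length_cons, Nat.add_one_mul]
    omega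

/-- The program `p` processes one entry according to `φ`, when the current sample is `x`. -/
def EntrySpec (p : Cmd 20) (φ : Bool × Cube n → Entry n → (Bool × Cube n) × Entry n)
    (x : List Sym) (B t : ℕ) : Prop :=
  ∀ (s : St) (f : Bool) (R : Cube n) (e : Entry n) (A₀ Q₀ : List Sym),
    (Nat.bits e.2).length ≤ B → s.A = encode (key e.1) ++ .sep :: A₀ →
    s.Q = encode (Nat.bits e.2) ++ .sep :: Q₀ → s.F = [.bit f] → s.G = [.bit false] →
    s.R = (encode (key R)).reverse → s.X = x → s.X2 = [] →
    Det p s.fn (St.fn { s with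
      A := A₀
      A2 := .sep :: ((encode (key (φ (f, R) e).2.1)).reverse ++ s.A2)
      Q := Q₀
      Q2 := .sep :: ((encode (Nat.bits (φ (f, R) e).2.2)).reverse ++ s.Q2)
      F := [.bit (φ (f, R) e).1.1]
      R := (encode (key (φ (f, R) e).1.2)).reverse }) t

/-- Process all entries with `p`. -/
def pass (p : Cmd 20) : Cmd 20 :=
  .seq (.loop sA tSome p) (.seq (moveAll sA2 sA) (moveAll sQ2 sQ))

theorem det_pass_loop {p : Cmd 20} {φ : Bool × Cube n → Entry n → (Bool × Cube n) × Entry n}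
    {x : List Sym} {B t : ℕ} (h : EntrySpec p φ x B t) (es : List (Entry n)) :
    ∀ (s : St) (f : Bool) (R : Cube n), (∀ e ∈ es, (Nat.bits e.2).length ≤ B) →
    s.A = encA es → s.Q = encQ es → s.F = [.bit f] → s.G = [.bit false] →
    s.R = (encode (key R)).reverse → s.X = x → s.X2 = [] →
    Det (.loop sA tSome p) s.fn (St.fn { s with
      A := []
      A2 := (encA (passRun φ (f, R) es).2).reverse ++ s.A2
      Q := []
      Q2 := (encQ (passRun φ (f, R) es).2).reverse ++ s.Q2
      F := [.bit (passRun φ (f, R) es).1.1]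
      R := (encode (key (passRun φ (f, R) es).1.2)).reverse }) (es.length * (t + 1) + 1) := by
  induction es with
  | nil =>
    intro s f R _ hA hQ hF hG hR hX hX2
    refine (det_loop_done (by simp [hA, encA, tSome])).of_eq ?_ (by simp)
    cases s
    simp_all [passRun, encA, encQ]
  | cons e es ih =>
    intro s f R hB hA hQ hF hG hR hX hX2
    have hne : tSome (s.fn sA).head? = true := by
      simp only [fn_sA, hA, encA]
      cases encode (key e.1) <;> rfl
    refine (Det.loop_step hne (h s f R e (encA es) (encQ es) (hB e (by simp)) hA hQ hF hG hR hX
      hX2) (ih _ (φ (f, R) e).1.1 (φ (f, R) e).1.2 (fun e he => hB e (by simp [he])) rfl rfl rfl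
        hG rfl hX hX2)).of_eq ?_ ?_
    · simp [passRun, encA, encQ]
    · rw [List.length_cons, Nat.add_one_mul]; omega

theorem det_pass {p : Cmd 20} {φ : Bool × Cube n → Entry n → (Bool × Cube n) × Entry n}
    {x : List Sym} {B t k : ℕ} (h : EntrySpec p φ x B t) {es : List (Entry n)}
    (s : St) (f : Bool) (R : Cube n) (hB : ∀ e ∈ es, (Nat.bits e.2).length ≤ B)
    (hB' : ∀ e ∈ (passRun φ (f, R) es).2, (Nat.bits e.2).length ≤ B)
    (hk : es.length = k) (hk' : (passRun φ (f, R) es).2.length = k)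
    (hA : s.A = encA es) (hQ : s.Q = encQ es) (hF : s.F = [.bit f]) (hG : s.G = [.bit false])
    (hR : s.R = (encode (key R)).reverse) (hX : s.X = x) (hX2 : s.X2 = []) (hA2 : s.A2 = [])
    (hQ2 : s.Q2 = []) :
    Det (pass p) s.fn (St.fn { s with
      A := encA (passRun φ (f, R) es).2
      Q := encQ (passRun φ (f, R) es).2
      F := [.bit (passRun φ (f, R) es).1.1]
      R := (encode (key (passRun φ (f, R) es).1.2)).reverse })
      (k * (t + 6 * n + 6 * B + 19) + 5) := by
  refine ((det_pass_loop h es s f R hB hA hQ hF hG hR hX hX2).seq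
    ((det_moveAll (by decide)).seq (det_moveAll (by decide)))).of_eq ?_ ?_
  · simp [hA2, hQ2]
  · have h1 := length_encA (passRun φ (f, R) es).2
    have h2 := length_encQ _ hB'
    rw [hk'] at h1 h2
    simp only [update_sA2, update_sA, fn_sA2, fn_sQ2, List.length_append, List.length_reverse, hA2,
      hQ2, List.length_nil, h1, hk]
    nlinarith

theorem length_passRun (φ : Bool × Cube n → Entry n → (Bool × Cube n) × Entry n)
    (a : Bool × Cube n) (es : List (Entry n)) : (passRun φ a es).2.length = es.length := by
  induction es generalizing a with
  | nil => rfl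
  | cons e es ih => simp [passRun, ih]

/-! ### Comparing an entry with the sample -/

/-- Update the comparison bit with the tops of `A` and `X`. -/
def compareBit (u : Bool → Bool → Bool → Bool) : Cmd 20 :=
  let upd (a x : Bool) : Cmd 20 :=
    .ite sG (tIs true) (setBit sG (u true a x)) (setBit sG (u false a x))
  .ite sA (tIs true) (.ite sX (tIs true) (upd true true) (upd true false))
    (.ite sX (tIs true) (upd false true) (upd false false))

theorem det_compareBit (u : Bool → Bool → Bool → Bool) (s : St) {a x g : Bool} {A₀ X₀ : List Sym}
    (hA : s.A = .bit a :: A₀) (hX : s.X = .bit x :: X₀) (hG : s.G = [.bit g]) :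
    Det (compareBit u) s.fn (St.fn { s with G := [.bit (u g a x)] }) 6 := by
  have h : ∀ a x, Det (.ite sG (tIs true) (setBit sG (u true a x)) (setBit sG (u false a x)))
      s.fn (St.fn { s with G := [.bit (u g a x)] }) 4 := by
    intro a x
    cases g
    · exact (Det.ite_false (by simp [hG, tIs]) det_setBit).of_eq (by simp [hG]) le_rfl
    · exact (Det.ite_true (by simp [hG, tIs]) det_setBit).of_eq (by simp [hG]) le_rfl
  cases a <;> cases x
  · exact Det.ite_false (by simp [hA, tIs]) (Det.ite_false (by simp [hX, tIs]) (h _ _))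
  · exact Det.ite_false (by simp [hA, tIs]) (Det.ite_true (by simp [hX, tIs]) (h _ _))
  · exact Det.ite_true (by simp [hA, tIs]) (Det.ite_false (by simp [hX, tIs]) (h _ _))
  · exact Det.ite_true (by simp [hA, tIs]) (Det.ite_true (by simp [hX, tIs]) (h _ _))

/-- The result of a bitwise comparison. -/
def compareList (u : Bool → Bool → Bool → Bool) (g : Bool) : List Bool → List Bool → Bool
  | a :: v, x :: y => compareList u (u g a x) v y
  | _, _ => g

/-- Compare the top key of `A` with the sample, moving both. -/
def compareLoop (u : Bool → Bool → Bool → Bool) : Cmd 20 :=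
  .loop sX tSome (.seq (compareBit u) (.seq (move sA sA2) (move sX sX2)))

theorem det_compareLoop (u : Bool → Bool → Bool → Bool) (A₀ : List Sym) : ∀ (v y : List Bool)
    (s : St) (g : Bool), v.length = y.length → s.A = encode v ++ A₀ → s.X = encode y →
    s.G = [.bit g] →
    Det (compareLoop u) s.fn (St.fn { s with
      A := A₀
      A2 := (encode v).reverse ++ s.A2
      X := []
      X2 := (encode y).reverse ++ s.X2
      G := [.bit (compareList u g v y)] }) (19 * y.length + 1)
  | [], [], s, g, _, hA, hX, hG => by
    refine (det_loop_done (by simp [hX, encode, tSome])).of_eq ?_ (by simp)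
    cases s
    simp_all [encode, compareList]
  | a :: v, x :: y, s, g, hl, hA, hX, hG => by
    have h1 := det_compareBit u s (A₀ := encode v ++ A₀) (X₀ := encode y) hA hX hG
    have h2 := det_move (i := sA) (j := sA2) (by decide)
      (S := St.fn { s with G := [.bit (u g a x)] }) (a := .bit a) (l := encode v ++ A₀) hA
    simp only [fn_sA2, update_sA, update_sA2] at h2
    have h3 := det_move (i := sX) (j := sX2) (by decide)
      (S := St.fn { s with
        A := encode v ++ A₀
        A2 := .bit a :: s.A2
        G := [.bit (u g a x)] }) (a := .bit x) (l := encode y) hX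
    simp only [fn_sX2, update_sX, update_sX2] at h3
    refine (Det.loop_step (by simp [hX, encode, tSome]) (h1.seq (h2.seq h3))
      (det_compareLoop u A₀ v y { s with
        A := encode v ++ A₀
        A2 := .bit a :: s.A2
        X := encode y
        X2 := .bit x :: s.X2
        G := [.bit (u g a x)] } (u g a x) (by simpa using hl) rfl rfl rfl)).of_eq ?_ ?_
    · simp [compareList, encode]
    · rw [List.length_cons]; omega

/-- Increment the counters of the entries that match the sample. -/
def scoreProg (u : Bool → Bool → Bool → Bool) : Cmd 20 :=
  .seq (setBit sG true) (.seq (compareLoop u) (.seq (moveAll sX2 sX) (.seq (move sA sA2)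
    (.seq (.ite sG (tIs true) (.seq (setBit sF true) (incMove sQ sQ2)) (moveWhile tBit sQ sQ2))
      (.seq (move sQ sQ2) (setBit sG false))))))

/-- One program serves both phases: equality of strings and agreement with a labelled example are
both computed by a one-bit accumulator `u` run along key and sample. -/
theorem scoreProg_spec (u : Bool → Bool → Bool → Bool) (M : Cube n → Bool) (y : List Bool)
    (hy : y.length = n + 1) (hM : ∀ s, compareList u true (key s) y = M s) (B : ℕ) :
    EntrySpec (scoreProg u) (scoreEntry M) (encode y) B (25 * n + 6 * B + 70) := by
  intro s f R e A₀ Q₀ hB hA hQ hF hG hR hX hX2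
  have h1 : Det (setBit sG true) s.fn (St.fn { s with G := [.bit true] }) 3 :=
    det_setBit.of_eq (by simp [hG]) le_rfl
  have h2 := (det_compareLoop u (.sep :: A₀) (key e.1) y { s with G := [.bit true] } true
    (by rw [length_key, hy]) hA hX rfl).of_eq (S'' := St.fn { s with
      A := .sep :: A₀
      A2 := (encode (key e.1)).reverse ++ s.A2
      X := []
      X2 := (encode y).reverse
      G := [.bit (M e.1)] }) (by simp [hX2, hM]) (by rw [hy])
  have h3 := det_moveAll (S := St.fn { s with
      A := .sep :: A₀
      A2 := (encode (key e.1)).reverse ++ s.A2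
      X := []
      X2 := (encode y).reverse
      G := [.bit (M e.1)] }) (i := sX2) (j := sX) (by decide)
  simp only [fn_sX2, fn_sX, update_sX, update_sX2, List.append_nil, List.reverse_reverse,
    List.length_reverse, length_encode, hy] at h3
  have h4 := det_move (i := sA) (j := sA2) (by decide) (S := St.fn { s with
      A := .sep :: A₀
      A2 := (encode (key e.1)).reverse ++ s.A2
      X := encode y
      X2 := []
      G := [.bit (M e.1)] }) (a := .sep) (l := A₀) rfl
  simp only [fn_sA2, update_sA, update_sA2] at h4
  have h5 : Det (.ite sG (tIs true) (.seq (setBit sF true) (incMove sQ sQ2))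
      (moveWhile tBit sQ sQ2)) (St.fn { s with
      A := A₀
      A2 := .sep :: ((encode (key e.1)).reverse ++ s.A2)
      X := encode y
      X2 := []
      G := [.bit (M e.1)] }) (St.fn { s with
      A := A₀
      A2 := .sep :: ((encode (key e.1)).reverse ++ s.A2)
      X := encode y
      X2 := []
      F := [.bit (M e.1 || f)]
      Q := .sep :: Q₀
      Q2 := (encode (Nat.bits (e.2 + (M e.1).toNat))).reverse ++ s.Q2
      G := [.bit (M e.1)] }) (6 * B + 15) := by
    cases M e.1
    · exact (Det.ite_false rfl (det_moveBits (by decide) rfl hQ)).of_eq (by simp [hF]) (by omega)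
    · refine (Det.ite_true rfl ((det_setBit (i := sF) (b := true)).seq
        (det_incMove (i := sQ) (j := sQ2) (by decide) (l := Nat.bits e.2) (r := .sep :: Q₀) rfl
          (by simpa using hQ)))).of_eq ?_ (by omega)
      simp [hF, bits_succ]
  have h6 := det_move (i := sQ) (j := sQ2) (by decide) (S := St.fn { s with
      A := A₀
      A2 := .sep :: ((encode (key e.1)).reverse ++ s.A2)
      X := encode y
      X2 := []
      F := [.bit (M e.1 || f)]
      Q := .sep :: Q₀
      Q2 := (encode (Nat.bits (e.2 + (M e.1).toNat))).reverse ++ s.Q2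
      G := [.bit (M e.1)] }) (a := .sep) (l := Q₀) rfl
  simp only [fn_sQ2, update_sQ, update_sQ2] at h6
  refine (h1.seq (h2.seq (h3.seq (h4.seq (h5.seq (h6.seq det_setBit)))))).of_eq ?_ ?_
  rotate_left
  · omega
  cases h : M e.1 <;> simp [scoreEntry, h, hX, hX2, hG, hR]

/-- Replace the key on `A` by the sample and the counter, which is zero, by one. -/
def placeHere : Cmd 20 :=
  .seq (clearWhile tBit sA) (.seq (moveDup tSome sX sX2 sA2) (.seq (moveAll sX2 sX)
    (.seq (.push sQ2 (.bit true)) (setBit sF true))))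

/-- Move the key and the counter at the top. -/
def moveEntry : Cmd 20 := .seq (moveWhile tBit sA sA2) (moveWhile tBit sQ sQ2)

/-- Move the separators at the top. -/
def moveSep : Cmd 20 := .seq (move sA sA2) (move sQ sQ2)

/-- Replace an entry with counter zero by the sample, unless the flag is set already. -/
def placeProg : Cmd 20 :=
  .seq (.ite sF (tIs true) moveEntry (.ite sQ tBit moveEntry placeHere)) moveSep

/-- Record the key on `A` and decrement the positive counter. -/
def decHere : Cmd 20 :=
  .seq (clearWhile tSome sR) (.seq (moveDup tBit sA sA2 sR) (decMove sQ sQ2))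

/-- Unless the flag is set, decrement a positive counter and record the key. -/
def decProg : Cmd 20 :=
  .seq (.ite sF (tIs true) moveEntry (.ite sQ tBit decHere moveEntry)) moveSep

theorem det_moveSep (s : St) {A₀ Q₀ : List Sym} (hA : s.A = .sep :: A₀) (hQ : s.Q = .sep :: Q₀) :
    Det moveSep s.fn (St.fn { s with
      A := A₀
      A2 := .sep :: s.A2
      Q := Q₀
      Q2 := .sep :: s.Q2 }) 11 := by
  refine ((det_move (by decide) (a := .sep) (l := A₀) (by simpa using hA)).seq
    (det_move (by decide) (a := .sep) (l := Q₀) (by simpa using hQ))).of_eq ?_ (by omega)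
  simp

theorem det_moveEntry (s : St) {u v : List Bool} {A₀ Q₀ : List Sym}
    (hA : s.A = encode u ++ .sep :: A₀) (hQ : s.Q = encode v ++ .sep :: Q₀) :
    Det moveEntry s.fn (St.fn { s with
      A := .sep :: A₀
      A2 := (encode u).reverse ++ s.A2
      Q := .sep :: Q₀
      Q2 := (encode v).reverse ++ s.Q2 }) (6 * u.length + 6 * v.length + 3) := by
  refine ((det_moveBits (by decide) (r := .sep :: A₀) rfl (by simpa using hA)).seq
    (det_moveBits (by decide) (l := v) (r := .sep :: Q₀) rfl (by simpa using hQ))).of_eq ?_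
      (by omega)
  simp

theorem bits_eq_cons {c : ℕ} (hc : c ≠ 0) : ∃ b l, Nat.bits c = b :: l := by
  obtain ⟨l, h⟩ := bits_eq_append_true c hc
  cases l with
  | nil => exact ⟨true, [], h⟩
  | cons b l => exact ⟨b, l ++ [true], h⟩

theorem EntrySpec.of_ite {φ : Bool × Cube n → Entry n → (Bool × Cube n) × Entry n}
    {x : List Sym} {B t : ℕ} {p : Cmd 20}
    (h : ∀ (s : St) (f : Bool) (R : Cube n) (e : Entry n) (A₀ Q₀ : List Sym),
    (Nat.bits e.2).length ≤ B → s.A = encode (key e.1) ++ .sep :: A₀ →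
    s.Q = encode (Nat.bits e.2) ++ .sep :: Q₀ → s.F = [.bit f] →
    s.R = (encode (key R)).reverse → s.X = x → s.X2 = [] →
    Det p s.fn (St.fn { s with
      A := .sep :: A₀
      A2 := (encode (key (φ (f, R) e).2.1)).reverse ++ s.A2
      Q := .sep :: Q₀
      Q2 := (encode (Nat.bits (φ (f, R) e).2.2)).reverse ++ s.Q2
      F := [.bit (φ (f, R) e).1.1]
      R := (encode (key (φ (f, R) e).1.2)).reverse }) t) :
    EntrySpec (.seq p moveSep) φ x B (t + 12) := by
  intro s f R e A₀ Q₀ hB hA hQ hF hG hR hX hX2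
  exact ((h s f R e A₀ Q₀ hB hA hQ hF hR hX hX2).seq (det_moveSep _ rfl rfl)).mono (by omega)

theorem placeProg_spec (x : Cube n) (B : ℕ) :
    EntrySpec placeProg (placeEntry x) (encode (key x)) B (20 * n + 6 * B + 60) := by
  refine (EntrySpec.of_ite (t := 20 * n + 6 * B + 48) ?_)
  intro s f R e A₀ Q₀ hB hA hQ hF hR hX hX2
  have h1 := (det_moveEntry s hA hQ).mono (t' := 6 * n + 6 * B + 9) (by rw [length_key]; omega)
  cases f
  swap
  · refine (Det.ite_true (by simp [hF, tIs]) h1).of_eq ?_ (by omega)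
    simp [placeEntry, hF, hR]
  refine (Det.ite_false (t := 20 * n + 6 * B + 46) (by simp [hF, tIs]) ?_).mono (by omega)
  by_cases hc : e.2 = 0
  swap
  · obtain ⟨b, l, hb⟩ := bits_eq_cons hc
    refine (Det.ite_true (by simp [hQ, hb, encode_cons, tBit]) h1).of_eq ?_ (by omega)
    simp [placeEntry, hF, hR, hc]
  have hQ' : s.Q = .sep :: Q₀ := by simpa [hc, encode] using hQ
  have h2 : Det (clearWhile tBit sA) s.fn (St.fn { s with A := .sep :: A₀ }) (2 * n + 3) :=
    (det_clearWhile tBit_of_mem_encode (r := .sep :: A₀) rfl (by simpa using hA)).of_eq (by simp)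
      (by rw [length_encode, length_key]; omega)
  have h3 : Det (moveDup tSome sX sX2 sA2) (St.fn { s with A := .sep :: A₀ }) (St.fn { s with
      A := .sep :: A₀
      A2 := (encode (key x)).reverse ++ s.A2
      X := []
      X2 := (encode (key x)).reverse }) (10 * n + 11) :=
    (det_moveDup (by decide) (by decide) (by decide) (l := encode (key x)) (r := [])
      (fun a _ => tSome_some a) rfl (by simpa using hX)).of_eq (by simp [hX2])
      (by rw [length_encode, length_key]; omega)
  have h4 : Det (moveAll sX2 sX) (St.fn { s with
      A := .sep :: A₀
      A2 := (encode (key x)).reverse ++ s.A2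
      X := []
      X2 := (encode (key x)).reverse }) (St.fn { s with
      A := .sep :: A₀
      A2 := (encode (key x)).reverse ++ s.A2
      X := encode (key x)
      X2 := [] }) (6 * n + 7) :=
    (det_moveAll (by decide)).of_eq (by simp)
      (by simp only [fn_sX2, List.length_reverse, length_encode, length_key]; omega)
  refine (Det.ite_false (by simp [hQ', tBit])
    (h2.seq (h3.seq (h4.seq ((det_push sQ2 _).seq det_setBit))))).of_eq ?_ ?_
  · simp [placeEntry, hc, hF, hX, hX2, hR, hQ', encode]
  · omega

theorem decProg_spec (x : List Sym) (B : ℕ) :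
    EntrySpec decProg (decEntry (n := n)) x B (12 * n + 6 * B + 60) := by
  refine (EntrySpec.of_ite (t := 12 * n + 6 * B + 48) ?_)
  intro s f R e A₀ Q₀ hB hA hQ hF hR hX hX2
  have h1 := (det_moveEntry s hA hQ).mono (t' := 6 * n + 6 * B + 9) (by rw [length_key]; omega)
  cases f
  swap
  · refine (Det.ite_true (by simp [hF, tIs]) h1).of_eq ?_ (by omega)
    simp [decEntry, hF, hR]
  refine (Det.ite_false (t := 12 * n + 6 * B + 46) (by simp [hF, tIs]) ?_).mono (by omega)
  by_cases hc : e.2 = 0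
  · refine (Det.ite_false (by simp [hQ, hc, encode, tBit]) h1).of_eq ?_ (by omega)
    simp [decEntry, hF, hR, hc]
  obtain ⟨b, l, hb⟩ := bits_eq_cons hc
  have h2 : Det (clearWhile tSome sR) s.fn (St.fn { s with R := [] }) (2 * n + 3) :=
    det_clear.of_eq (by simp) (by
      simp only [fn_sR, hR, List.length_reverse, length_encode, length_key]; omega)
  have h3 : Det (moveDup tBit sA sA2 sR) (St.fn { s with R := [] }) (St.fn { s with
      A := .sep :: A₀
      A2 := (encode (key e.1)).reverse ++ s.A2
      R := (encode (key e.1)).reverse }) (10 * n + 11) :=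
    (det_moveDup (by decide) (by decide) (by decide) (l := encode (key e.1)) (r := .sep :: A₀)
      tBit_of_mem_encode rfl (by simpa using hA)).of_eq (by simp)
      (by rw [length_encode, length_key]; omega)
  refine (Det.ite_true (by simp [hQ, hb, encode_cons, tBit])
    (h2.seq (h3.seq (det_decMove (by decide) hc (r := .sep :: Q₀) rfl
      (by simpa using hQ))))).of_eq ?_ ?_
  · simp [decEntry, hc, hF]
  · omega

/-! ### The two comparisons -/

theorem compareList_eq (g : Bool) : ∀ v y : List Bool, v.length = y.length →
    compareList (fun g a x => g && (a == x)) g v y = (g && decide (v = y))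
  | [], [], _ => by simp [compareList]
  | a :: v, x :: y, h => by
    rw [compareList, compareList_eq _ v y (by simpa using h)]
    cases g <;> cases a <;> cases x <;> simp

theorem compareList_key (s x : Cube n) :
    compareList (fun g a x => g && (a == x)) true (key s) (key x) = decide (s = x) := by
  rw [compareList_eq _ _ _ (by rw [length_key, length_key]), Bool.true_and]
  exact decide_eq_decide.2 key_injective.eq_iff

theorem compareList_ofFn (g : Bool) : ∀ {n : ℕ} (v y : Cube n),
    compareList (fun g a x => g ^^ (a && x)) g (List.ofFn v) (List.ofFn y) =
      (g ^^ decide ((∑ i, (v i && y i).toNat) % 2 = 1))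
  | 0, v, y => by simp [compareList]
  | n + 1, v, y => by
    rw [List.ofFn_succ, List.ofFn_succ, compareList, compareList_ofFn, Fin.sum_univ_succ,
      Nat.add_mod]
    rcases Nat.mod_two_eq_zero_or_one (∑ i : Fin n, (v i.succ && y i.succ).toNat) with h | h <;>
      rw [h] <;> cases g <;> cases v 0 && y 0 <;> rfl

theorem wordList_eq_ofFn {N : ℕ} (w : Cube N) : wordList w = List.ofFn fun i => w i.rev := by
  refine List.ext_getElem (by simp [wordList]) fun i h1 h2 => ?_
  simp only [wordList, List.getElem_reverse, List.getElem_ofFn, List.length_ofFn]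
  congr 1
  ext
  simp only [Fin.val_rev]
  omega

theorem wordList_eq_cons (w : Cube (n + 1)) :
    wordList w = w (Fin.last n) :: wordList (Fin.init w) := by
  rw [← wordList_snoc, Fin.snoc_init_self]

/-- The leading 1 of the key makes the running inner product include the label. With starting value
`true` the result is the negation of label + s·x, that is, agreement. Both strings are stored in
reverse, which does not change the inner product. -/
theorem compareList_agree (w : Cube (n + 1)) (s : Cube n) :
    compareList (fun g a x => g ^^ (a && x)) true (key s) (wordList w) = agree w s := by
  rw [key, wordList_snoc, wordList_eq_cons, compareList, wordList_eq_ofFn, wordList_eq_ofFn,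
    compareList_ofFn, agree, parity]
  have h := (Fin.revPerm (n := n)).sum_comp Finset.univ
    (fun i => (s i && (Fin.init w : Cube n) i).toNat) (by simp)
  simp only [Fin.revPerm_apply] at h
  rw [h]
  cases w (Fin.last n) <;> simp

end

/-! ### The main loops -/

section

variable {n k : ℕ} {ρ : QOp (n + 1)} {p q : Cmd k} {S S' : Fin (k + 1) → List Sym}
  {t t' a g : ℕ} {α : Type} {Post : α → (Fin (k + 1) → List Sym) → Prop}
  {E : (α → ℝ) → ℝ}

theorem Prob.det_seq (hp : Det p S S' t) (hq : Prob ρ q S' t' a g Post E) :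
    Prob ρ (.seq p q) S (t + t' + 1) a g Post E :=
  ((hp.prob ()).seq (E' := fun _ => E) fun _ _ h => h.2 ▸ hq).of_le le_rfl (by simp) (by simp)
    fun _ _ h => h

theorem Prob.seq_det (hp : Prob ρ p S t a g Post E) {F : α → Fin (k + 1) → List Sym}
    (hq : ∀ x S', Post x S' → Det q S' (F x) t') :
    Prob ρ (.seq p q) S (t + t' + 1) a g (fun x S' => S' = F x) E :=
  (hp.seq (Post' := fun x S' => S' = F x) (E' := fun x V => V x)
    fun x S' h => ((hq x S' h).prob x).of_le le_rfl le_rfl le_rfl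
      fun _ _ h => by rw [h.2, h.1]).of_le le_rfl le_rfl le_rfl fun _ _ h => h

end

section

variable {n : ℕ}

theorem forall_passRun {φ : Bool × Cube n → Entry n → (Bool × Cube n) × Entry n}
    {P P' : ℕ → Prop} (h : ∀ s e, P e.2 → P' (φ s e).2.2) (s : Bool × Cube n)
    {es : List (Entry n)} (hes : ∀ e ∈ es, P e.2) : ∀ e ∈ (passRun φ s es).2, P' e.2 := by
  induction es generalizing s with
  | nil => simp [passRun]
  | cons e es ih =>
    simp only [passRun, List.mem_cons, forall_eq_or_imp] at hes ⊢
    exact ⟨h s e hes.1, ih _ hes.2⟩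

theorem scoreEntry_le (M : Cube n → Bool) {b : ℕ} (s : Bool × Cube n) (e : Entry n)
    (h : e.2 + 1 ≤ b) : (scoreEntry M s e).2.2 ≤ b := by
  rw [scoreEntry]
  split_ifs <;> simp only <;> omega

theorem placeEntry_le (x : Cube n) {b : ℕ} (hb : 1 ≤ b) (s : Bool × Cube n) (e : Entry n)
    (h : e.2 ≤ b) : (placeEntry x s e).2.2 ≤ b := by
  rw [placeEntry]
  split_ifs <;> simp only <;> omega

theorem decEntry_le {b : ℕ} (s : Bool × Cube n) (e : Entry n)
    (h : e.2 ≤ b) : (decEntry s e).2.2 ≤ b := by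
  rw [decEntry]
  split_ifs <;> simp only <;> omega

theorem length_bits_le {c b : ℕ} (h : c ≤ b) : (Nat.bits c).length ≤ b.size := by
  rw [Nat.size_eq_bits_len]
  exact Nat.size_le_size h

/-- The stacks between two passes. -/
def cfg (s : St) (c c' : ℕ) (f : Bool) (x : List Sym) (a : List (Entry n) × Cube n) : St :=
  { s with
    N := unary (n + 1)
    N2 := []
    X := x
    X2 := []
    A := encA a.1
    A2 := []
    Q := encQ a.1
    Q2 := []
    F := [.bit f]
    G := [.bit false]
    R := (encode (key a.2)).reverse
    M := unary c
    M2 := unary c' }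

/-- The time of a pass over `k` entries with counters of at most `B` bits. -/
def passTime (n k B : ℕ) : ℕ := k * (31 * n + 12 * B + 89) + 5

theorem det_pass_cfg {p : Cmd 20} {φ : Bool × Cube n → Entry n → (Bool × Cube n) × Entry n}
    {x : List Sym} {m t k : ℕ} (h : EntrySpec p φ x m.size t) (ht : t ≤ 25 * n + 6 * m.size + 70)
    (s : St) (c c' : ℕ) (f : Bool) (a : List (Entry n) × Cube n) (hk : a.1.length = k)
    (hm : ∀ e ∈ a.1, e.2 ≤ m) (hm' : ∀ e ∈ (passRun φ (f, a.2) a.1).2, e.2 ≤ m) :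
    Det (pass p) (cfg s c c' f x a).fn (cfg s c c' (passRun φ (f, a.2) a.1).1.1 x
      ((passRun φ (f, a.2) a.1).2, (passRun φ (f, a.2) a.1).1.2)).fn (passTime n k m.size) :=
  (det_pass h (cfg s c c' f x a) f a.2 (fun e he => length_bits_le (hm e he))
    (fun e he => length_bits_le (hm' e he)) hk (by rw [length_passRun, hk]) rfl rfl rfl rfl rfl rfl
    rfl rfl rfl).mono (by
      rw [passTime]
      exact Nat.add_le_add_right (Nat.mul_le_mul_left k (by omega)) 5)

/-- Reset the flag and drop the sample. -/
def resetProg : Cmd 20 := .seq (setBit sF false) (clearWhile tSome sX)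

theorem det_reset (s : St) (c c' : ℕ) (f : Bool) {x : List Sym} (hx : x.length ≤ n + 1)
    (a : List (Entry n) × Cube n) : Det resetProg (cfg s c c' f x a).fn
      (cfg s c c' false [] a).fn (2 * n + 7) := by
  refine (det_setBit.seq det_clear).of_eq (by simp [cfg]) ?_
  simp only [cfg, update_sF, fn_sX]
  omega

/-- The Misra-Gries update with the sample. -/
def mgProg : Cmd 20 :=
  .seq (pass (scoreProg fun g a x => g && (a == x))) (.seq (pass placeProg)
    (.seq (pass decProg) resetProg))

theorem det_mgProg (s : St) (c c' : ℕ) (a : List (Entry n) × Cube n) (x : Cube n) {m k : ℕ}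
    (hk : a.1.length = k) (hm : 1 ≤ m) (ha : ∀ e ∈ a.1, e.2 + 1 ≤ m) :
    Det mgProg (cfg s c c' false (encode (key x)) a).fn (cfg s c c' false [] (mgUpdate a x)).fn
      (3 * passTime n k m.size + 2 * n + 10) ∧
    (mgUpdate a x).1.length = k ∧ ∀ e ∈ (mgUpdate a x).1, e.2 ≤ m := by
  have h1 := forall_passRun (P := fun c => c + 1 ≤ m) (P' := fun c => c ≤ m)
    (scoreEntry_le fun s => decide (s = x)) (false, a.2) ha
  set p := passRun (scoreEntry fun s => decide (s = x)) (false, a.2) a.1 with hp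
  have hpk : p.2.length = k := by rw [hp, length_passRun, hk]
  have h2 := forall_passRun (P := fun c => c ≤ m) (P' := fun c => c ≤ m)
    (placeEntry_le x hm) p.1 h1
  set q := passRun (placeEntry x) p.1 p.2 with hq
  have hqk : q.2.length = k := by rw [hq, length_passRun, hpk]
  have h3 := forall_passRun (P := fun c => c ≤ m) (P' := fun c => c ≤ m) decEntry_le q.1 h2
  have e : mgUpdate a x = ((passRun decEntry q.1 q.2).2, (passRun decEntry q.1 q.2).1.2) := rfl
  refine ⟨?_, by rw [e, length_passRun, hqk], h3⟩
  rw [e]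
  exact ((det_pass_cfg (scoreProg_spec _ _ _ (length_key x) (fun s => compareList_key s x) _)
    le_rfl s c c' false a hk (fun e he => by have := ha e he; omega) h1).seq
    ((det_pass_cfg (placeProg_spec x _) (by omega) s c c' p.1.1 (p.2, p.1.2) hpk h1 h2).seq
    ((det_pass_cfg (decProg_spec _ _) (by omega) s c c' q.1.1 (q.2, q.1.2) hqk h2 h3).seq
    (det_reset s c c' _ (by rw [length_encode, length_key]) _)))).mono (by omega)

/-- Count the agreements with the sample. -/
def agreeProg : Cmd 20 := .seq (pass (scoreProg fun g a x => g ^^ (a && x))) resetProg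

theorem det_agreeProg (s : St) (c c' : ℕ) (a : List (Entry n) × Cube n) (w : Cube (n + 1))
    {m k : ℕ} (hk : a.1.length = k) (ha : ∀ e ∈ a.1, e.2 + 1 ≤ m) :
    Det agreeProg (cfg s c c' false (encode (wordList w)) a).fn
      (cfg s c c' false [] (agreeStep a w)).fn (passTime n k m.size + 2 * n + 8) ∧
    (agreeStep a w).1.length = k ∧ ∀ e ∈ (agreeStep a w).1, e.2 ≤ m := by
  have h1 := forall_passRun (P := fun c => c + 1 ≤ m) (P' := fun c => c ≤ m)
    (scoreEntry_le (agree w)) (false, a.2) ha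
  refine ⟨?_, by rw [agreeStep, length_passRun, hk], h1⟩
  exact ((det_pass_cfg (scoreProg_spec _ _ _ (length_wordList w) (compareList_agree w) _)
    le_rfl s c c' false a hk (fun e he => by have := ha e he; omega) h1).seq
    (det_reset s c c' _ (by rw [length_encode, length_wordList]) _)).mono (by omega)

/-- As many rounds of decrements as there are symbols on `M2`, which are moved to `M`. -/
def drainLoop : Cmd 20 :=
  .loop sM2 tSome (.seq (move sM2 sM) (.seq (pass decProg) (setBit sF false)))

theorem det_drainLoop (s : St) {m k : ℕ} (c' : ℕ) : ∀ (c : ℕ) (a : List (Entry n) × Cube n),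
    a.1.length = k → (∀ e ∈ a.1, e.2 ≤ m) →
    Det drainLoop (cfg s c c' false [] a).fn (cfg s (c + c') 0 false [] (drainStep^[c'] a)).fn
      (c' * (passTime n k m.size + 11) + 1) := by
  induction c' with
  | zero =>
    intro c a _ _
    exact (det_loop_done rfl).mono (by omega)
  | succ c' ih =>
    intro c a hk ha
    have h1 := forall_passRun (P := fun c => c ≤ m) (P' := fun c => c ≤ m) decEntry_le
      (false, a.2) ha
    have h2 : Det (move sM2 sM) (cfg s c (c' + 1) false [] a).fn
        (cfg s (c + 1) c' false [] a).fn 5 :=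
      (det_move (by decide) (a := .bit true) (l := unary c') rfl).of_eq (by simp [cfg, unary_succ])
        le_rfl
    have h3 := det_pass_cfg (decProg_spec [] m.size) (by omega) s (c + 1) c' false a hk ha h1
    have h4 : ∀ f, Det (setBit sF false) (cfg s (c + 1) c' f [] (drainStep a)).fn
        (cfg s (c + 1) c' false [] (drainStep a)).fn 3 := fun f =>
      det_setBit.of_eq (by simp [cfg]) le_rfl
    refine (Det.loop_step rfl (h2.seq (h3.seq (h4 _)))
      (ih (c + 1) (drainStep a) (by rw [drainStep, length_passRun, hk]) h1)).of_eq ?_ ?_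
    · rw [add_right_comm, add_assoc c c' 1, Function.iterate_succ_apply]
    · rw [Nat.add_one_mul]; omega

/-- Draw a sample. -/
def drawProg (fourier : Bool) : Cmd 20 := .seq (move sM sM2) (sample fourier sN sN2 sX)

theorem prob_drawProg {ρ : QOp (n + 1)} (hρ : ρ.IsHermitian) (fourier : Bool) (s : St) (c c' : ℕ)
    (a : List (Entry n) × Cube n) :
    Prob ρ (drawProg fourier) (cfg s (c + 1) c' false [] a).fn (18 * n + 30) 1 (n + 1)
      (fun w S' => S' = (cfg s c (c' + 1) false (encode (wordList w)) a).fn)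
      (fun V => ∑ w, outcomeProb fourier ρ w * V w) := by
  have h1 : Det (move sM sM2) (cfg s (c + 1) c' false [] a).fn
      (cfg s c (c' + 1) false [] a).fn 5 :=
    (det_move (by decide) (a := .bit true) (l := unary c) rfl).of_eq (by simp [cfg, unary_succ])
      le_rfl
  refine (Prob.det_seq h1 (prob_sample hρ fourier (i := sN) (j := sN2) (x := sX) (by decide)
    (by decide) (by decide) _ rfl rfl)).of_le (by omega) le_rfl le_rfl ?_
  rintro w S' rfl
  simp [cfg]

/-- Process as many samples as there are symbols on `M`, which are moved to `M2`. -/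
def sampleLoop (fourier : Bool) (p : Cmd 20) : Cmd 20 := .loop sM tSome (.seq (drawProg fourier) p)

theorem prob_sampleLoop {ρ : QOp (n + 1)} (hρ : ρ.IsHermitian) (fourier : Bool) (s : St)
    {p : Cmd 20} {m k t : ℕ}
    {upd : List (Entry n) × Cube n → Cube (n + 1) → List (Entry n) × Cube n}
    (hp : ∀ c c' b a w, 1 ≤ b → b ≤ m → a.1.length = k → (∀ e ∈ a.1, e.2 + 1 ≤ b) →
      Det p (cfg s c c' false (encode (wordList w)) a).fn (cfg s c c' false [] (upd a w)).fn t ∧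
      (upd a w).1.length = k ∧ ∀ e ∈ (upd a w).1, e.2 ≤ b)
    {a : List (Entry n) × Cube n} (hk : a.1.length = k) (ha : ∀ e ∈ a.1, e.2 = 0) :
    Prob ρ (sampleLoop fourier p) (cfg s m 0 false [] a).fn (m * (18 * n + t + 32) + 1) m
      (m * (n + 1)) (fun l S' => l.length = m ∧ S' = (cfg s 0 m false [] (l.foldl upd a)).fn)
      (iidExp (outcomeProb fourier ρ) m) := by
  have h := prob_loop (ρ := ρ) (p := .seq (drawProg fourier) p) (w := outcomeProb fourier ρ)
    (upd := upd) (t := 18 * n + t + 31) (a := 1) (g := n + 1) (i := sM)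
    -- With `j` samples left a counter is at most m - j, so the bit length of `m` bounds all
    -- counters and one time bound serves every round.
    (inv := fun j a => j ≤ m ∧ a.1.length = k ∧ ∀ e ∈ a.1, e.2 + j ≤ m)
    (st := fun j a => (cfg s j (m - j) false [] a).fn) (fun _ => rfl)
    (fun j x => List.cons_ne_nil _ _) ?_ ?_ m a ⟨le_rfl, hk, fun e he => by simp [ha e he]⟩
  · simp only [Nat.sub_self, Nat.sub_zero, mul_one] at h
    exact h.of_le (by rw [Nat.add_assoc]) le_rfl le_rfl fun _ _ h => h
  · rintro j a w ⟨h1, h2, h3⟩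
    obtain ⟨-, h4, h5⟩ := hp 0 0 (m - j) a w (by omega) (by omega) h2
      fun e he => by have := h3 e he; omega
    exact ⟨by omega, h4, fun e he => by have := h5 e he; omega⟩
  · rintro j a ⟨h1, h2, h3⟩
    refine (Prob.seq_det (prob_drawProg hρ fourier s j (m - (j + 1)) a) (t' := t) ?_).of_le
      (by omega) le_rfl le_rfl fun _ _ h => h
    rintro w S' rfl
    rw [show m - (j + 1) + 1 = m - j by omega]
    exact (hp _ _ (m - j) a w (by omega) (by omega) h2
      fun e he => by have := h3 e he; omega).1

/-- A counter never exceeds the number of samples processed. Hence m rounds of decrements empty the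
table, which resets it between the phases. -/
theorem foldl_le {m k : ℕ}
    {upd : List (Entry n) × Cube n → Cube (n + 1) → List (Entry n) × Cube n}
    (hu : ∀ b a w, 1 ≤ b → b ≤ m → a.1.length = k → (∀ e ∈ a.1, e.2 + 1 ≤ b) →
      (upd a w).1.length = k ∧ ∀ e ∈ (upd a w).1, e.2 ≤ b) :
    ∀ (l : List (Cube (n + 1))) (j : ℕ) (a : List (Entry n) × Cube n), j + l.length ≤ m →
      a.1.length = k → (∀ e ∈ a.1, e.2 ≤ j) →
      (l.foldl upd a).1.length = k ∧ ∀ e ∈ (l.foldl upd a).1, e.2 ≤ j + l.length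
  | [], j, a, _, hk, ha => ⟨hk, ha⟩
  | w :: l, j, a, hl, hk, ha => by
    rw [List.length_cons] at hl ⊢
    obtain ⟨h1, h2⟩ := hu (j + 1) a w (by omega) (by omega) hk fun e he => by
      have := ha e he
      omega
    obtain ⟨h3, h4⟩ := foldl_le hu l (j + 1) (upd a w) (by omega) h1 h2
    exact ⟨h3, fun e he => by have := h4 e he; omega⟩

/-- The output phase. -/
def outputProg : Cmd 20 := .seq (moveAll sR sT) (.seq (.pop sT) (moveAll sT sI))

/-- The record holds its key upside down. The first move brings the label bit to the top, where it
is popped, and the second move lands the string on the output stack in the required order. -/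
theorem det_outputProg (s : St) (hI : s.I = []) (hT : s.T = []) (c c' : ℕ)
    (a : List (Entry n) × Cube n) : ∃ S', S' 0 = encode (List.ofFn a.2) ∧
    Det outputProg (cfg s c c' false [] a).fn S' (12 * n + 20) := by
  refine ⟨_, ?_, ((det_moveAll (by decide)).seq ((det_pop sT).seq
    (det_moveAll (by decide)))).mono ?_⟩
  · rw [show (0 : Fin (20 + 1)) = sI from rfl]
    have h : key a.2 = true :: (List.ofFn a.2).reverse := wordList_snoc _ _
    simp [cfg, hI, hT, h, encode_cons, encode_reverse]
  · simp [cfg, hT, length_encode, length_key]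
    omega

/-- The learner, once the numbers of entries and samples are on the stacks. -/
def learnProg : Cmd 20 :=
  .seq (sampleLoop true (.seq (setBit sX true) mgProg)) (.seq drainLoop
    (.seq (sampleLoop false agreeProg) (.seq drainLoop outputProg)))

/-- The time of `learnProg`. -/
def learnTime (n k m : ℕ) : ℕ := m * (6 * passTime n k m.size + 40 * n + 120) + 12 * n + 40

theorem prob_learnProg {ρ : QOp (n + 1)} (hρ : ρ.IsHermitian) (s : St) (hI : s.I = [])
    (hT : s.T = []) {m k : ℕ} {a : List (Entry n) × Cube n} (hk : a.1.length = k)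
    (ha : ∀ e ∈ a.1, e.2 = 0) :
    Prob ρ learnProg (cfg s m 0 false [] a).fn (learnTime n k m) (2 * m) (2 * (m * (n + 1)))
      (fun l S' => S' 0 = encode (List.ofFn (learn m a l.1 l.2)))
      (fun V => iidExp (outcomeProb true ρ) m fun l₁ =>
        iidExp (outcomeProb false ρ) m fun l₂ => V (l₁, l₂)) := by
  have hp1 : ∀ c c' b (a : List (Entry n) × Cube n) w, 1 ≤ b → b ≤ m → a.1.length = k →
      (∀ e ∈ a.1, e.2 + 1 ≤ b) → Det (.seq (setBit sX true) mgProg)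
        (cfg s c c' false (encode (wordList w)) a).fn
        (cfg s c c' false [] (mgUpdate a (Fin.init w))).fn
        (3 * passTime n k m.size + 2 * n + 14) ∧
      (mgUpdate a (Fin.init w)).1.length = k ∧ ∀ e ∈ (mgUpdate a (Fin.init w)).1, e.2 ≤ b := by
    intro c c' b a w hb hbm hk ha
    -- Overwriting the measured label by 1 turns the outcome into a key, so that it can be compared
    -- and stored without further conversion.
    have h1 : Det (setBit sX true) (cfg s c c' false (encode (wordList w)) a).fn
        (cfg s c c' false (encode (key (Fin.init w : Cube n))) a).fn 3 :=
      det_setBit.of_eq (by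
        simp [cfg, key, wordList_snoc, wordList_eq_cons w, encode_cons]) le_rfl
    obtain ⟨h2, h3, h4⟩ := det_mgProg s c c' a (Fin.init w) hk hb ha
    obtain ⟨h5, -⟩ := det_mgProg s c c' a (Fin.init w) (m := m) hk (by omega)
      fun e he => (ha e he).trans hbm
    exact ⟨(h1.seq h5).mono (by omega), h3, h4⟩
  have hp2 : ∀ c c' b (a : List (Entry n) × Cube n) w, 1 ≤ b → b ≤ m → a.1.length = k →
      (∀ e ∈ a.1, e.2 + 1 ≤ b) → Det agreeProg
        (cfg s c c' false (encode (wordList w)) a).fn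
        (cfg s c c' false [] (agreeStep a w)).fn (passTime n k m.size + 2 * n + 8) ∧
      (agreeStep a w).1.length = k ∧ ∀ e ∈ (agreeStep a w).1, e.2 ≤ b := by
    intro c c' b a w hb hbm hk ha
    obtain ⟨h2, h3, h4⟩ := det_agreeProg s c c' a w hk ha
    obtain ⟨h5, -⟩ := det_agreeProg s c c' a w (m := m) hk fun e he => (ha e he).trans hbm
    exact ⟨h5, h3, h4⟩
  have hdrain : ∀ a : List (Entry n) × Cube n, a.1.length = k →
      (drainStep^[m] a).1.length = k := fun a hk => by
    rw [drain_fst, List.length_map, hk]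
  have hout : ∀ a' : List (Entry n) × Cube n, ∃ S', S' 0 = encode (List.ofFn a'.2) ∧
      Det outputProg (cfg s m 0 false [] a').fn S' (12 * n + 20) :=
    det_outputProg s hI hT m 0
  choose F hF1 hF2 using hout
  have hmain : ∀ l₁ : List (Cube (n + 1)), l₁.length = m →
      Prob ρ (.seq drainLoop (.seq (sampleLoop false agreeProg) (.seq drainLoop outputProg)))
        (cfg s 0 m false [] (l₁.foldl (fun a w => mgUpdate a (Fin.init w)) a)).fn
        (m * (3 * passTime n k m.size + 20 * n + 62) + 12 * n + 26)
        m (m * (n + 1))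
        (fun l₂ S' => S' 0 = encode (List.ofFn (learn m a l₁ l₂)))
        (iidExp (outcomeProb false ρ) m) := by
    intro l₁ hl₁
    obtain ⟨h1, h2⟩ := foldl_le (fun b a w hb hbm hk ha => (hp1 0 0 b a w hb hbm hk ha).2) l₁ 0 a
      (by omega) hk fun e he => (ha e he).le
    set a₁ := l₁.foldl (fun a w => mgUpdate a (Fin.init w)) a
    have h3 := hdrain a₁ h1
    have h4 : ∀ e ∈ (drainStep^[m] a₁).1, e.2 = 0 := by
      rw [drain_fst]
      intro e he
      obtain ⟨e', he', rfl⟩ := List.mem_map.1 he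
      have := h2 e' he'
      simp only
      omega
    have h5 := det_drainLoop s m 0 a₁ h1 (m := m) fun e he => by have := h2 e he; omega
    rw [Nat.zero_add] at h5
    refine (Prob.det_seq h5 (Prob.seq_det (prob_sampleLoop hρ false s hp2 h3 h4)
      (t' := m * (passTime n k m.size + 11) + 12 * n + 22)
      (F := fun l₂ => F (drainStep^[m] (l₂.foldl agreeStep (drainStep^[m] a₁)))) ?_)).of_le
      (le_of_eq (by ring)) le_rfl le_rfl ?_
    · rintro l₂ S' ⟨hl₂, rfl⟩
      obtain ⟨h6, h7⟩ := foldl_le (fun b a w hb hbm hk ha => (hp2 0 0 b a w hb hbm hk ha).2) l₂ 0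
        (drainStep^[m] a₁) (by omega) h3 fun e he => (h4 e he).le
      have h8 := det_drainLoop s m 0 (l₂.foldl agreeStep (drainStep^[m] a₁)) h6 (m := m)
        fun e he => by have := h7 e he; omega
      rw [Nat.zero_add] at h8
      exact (h8.seq (hF2 _)).mono (by omega)
    · rintro l₂ S' rfl
      exact hF1 _
  refine (Prob.seq (prob_sampleLoop hρ true s hp1 hk ha)
    (β := List (Cube (n + 1)) × List (Cube (n + 1)))
    (Post' := fun l S' => S' 0 = encode (List.ofFn (learn m a l.1 l.2)))
    (E' := fun l₁ V => iidExp (outcomeProb false ρ) m fun l₂ => V (l₁, l₂))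
    (t' := m * (3 * passTime n k m.size + 20 * n + 62) + 12 * n + 26) (a' := m)
    (g' := m * (n + 1)) ?_).of_le ?_ (by omega) (by omega) fun _ _ h => h
  · rintro l₁ S' ⟨hl₁, rfl⟩
    exact (hmain l₁ hl₁).map (fun l₂ => (l₁, l₂)) fun _ _ h => h
  · rw [learnTime]
    generalize passTime n k m.size = T
    nlinarith [Nat.zero_le (m * T), Nat.zero_le (m * n), Nat.zero_le m]

end

/-! ### Setting up the stacks -/

section

/-- The value of a number in binary, least significant bit first. -/
def bitVal : List Bool → ℕ
  | [] => 0
  | b :: l => b.toNat + 2 * bitVal l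

theorem bitVal_incBits : ∀ l, bitVal (incBits l) = bitVal l + 1
  | [] => rfl
  | false :: l => by simp [incBits, bitVal]; omega
  | true :: l => by simp [incBits, bitVal, bitVal_incBits l]; omega

theorem length_incBits : ∀ l, bitVal l + 1 < 2 ^ l.length → (incBits l).length = l.length
  | [], h => by simp [bitVal] at h
  | false :: l, _ => rfl
  | true :: l, h => by
    simp only [bitVal, List.length_cons, pow_succ, Bool.toNat_true] at h
    simp only [incBits, List.length_cons, length_incBits l (by omega)]

theorem bitVal_bits (c : ℕ) : bitVal (Nat.bits c) = c := by
  induction c using Nat.strong_induction_on with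
  | _ c ih =>
    rcases Nat.even_or_odd' c with ⟨d, rfl | rfl⟩
    · rcases Nat.eq_zero_or_pos d with rfl | hd
      · simp [bitVal]
      · rw [Nat.bit0_bits d hd.ne', bitVal, ih d (by omega)]
        simp
    · rw [Nat.bit1_bits, bitVal, ih d (by omega), Bool.toNat_true]
      omega

theorem bitVal_replicate (n : ℕ) : bitVal (List.replicate n false) = 0 := by
  induction n with
  | zero => rfl
  | succ n ih => simp [List.replicate_succ, bitVal, ih]

/-- Read the unary part of the input. -/
def readUnary : Cmd 20 :=
  .loop sI (tIs true) (.seq (.pop sI) (.seq (.push sN (.bit true)) (.seq (.push sY (.bit false))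
    (.push sR (.bit false)))))

theorem det_readUnary {r : List Sym} (hr : tIs true r.head? = false) (n : ℕ) : ∀ s : St,
    s.I = unary n ++ r → Det readUnary s.fn (St.fn { s with
      I := r
      N := unary n ++ s.N
      Y := encode (List.replicate n false) ++ s.Y
      R := encode (List.replicate n false) ++ s.R }) (8 * n + 1) := by
  induction n with
  | zero =>
    intro s hI
    have hI' : s.I = r := hI
    refine (det_loop_done (by simp [hI', hr])).of_eq ?_ (by omega)
    cases s
    simp_all [unary, encode]
  | succ n ih =>
    intro s hI
    refine (Det.loop_step (S' := St.fn { s with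
      I := unary n ++ r
      N := .bit true :: s.N
      Y := .bit false :: s.Y
      R := .bit false :: s.R }) (t := 7) (by simp [hI, unary_succ, tIs])
      (((det_pop sI).seq ((det_push sN _).seq ((det_push sY _).seq (det_push sR _)))).of_eq
        (by simp [hI, unary_succ]) (by omega)) (ih _ rfl)).of_eq ?_ (by omega)
    have e1 : unary (n + 1) = unary n ++ [.bit true] := by rw [unary_add]; rfl
    have e2 : encode (List.replicate (n + 1) false) =
        encode (List.replicate n false) ++ [.bit false] := by
      rw [List.replicate_succ', encode_append]; rfl
    simp [e1, e2]

/-- Double the unary number that is moved from `T` to `P`. -/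
def doubleProg : Cmd 20 :=
  .loop sT tSome (.seq (.pop sT) (.seq (.push sP (.bit true)) (.push sP (.bit true))))

theorem det_doubleProg (c : ℕ) : ∀ s : St, s.T = unary c → Det doubleProg s.fn (St.fn { s with
      T := []
      P := unary (c * 2) ++ s.P }) (6 * c + 1) := by
  induction c with
  | zero =>
    intro s hT
    have hT' : s.T = [] := hT
    refine (det_loop_done (by simp [hT', tSome])).of_eq ?_ (by omega)
    cases s
    simp_all [unary]
  | succ c ih =>
    intro s hT
    refine (Det.loop_step (S' := St.fn { s with
      T := unary c
      P := unary 2 ++ s.P }) (t := 5) (by simp [hT, unary_succ, tSome])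
      (((det_pop sT).seq ((det_push sP _).seq (det_push sP _))).of_eq
        (by simp [hT, unary]) (by omega)) (ih _ rfl)).of_eq ?_ (by omega)
    have e1 : unary ((c + 1) * 2) = unary (c * 2) ++ unary 2 := by rw [← unary_add]; congr 1; ring
    simp [e1]

/-- Convert a binary number to unary, and count its bits. -/
def readBinary : Cmd 20 :=
  .loop sI tBit (.seq (.push sL (.bit true)) (.seq (.ite sI (tIs true) (moveDup tSome sP sT sU)
    (moveAll sP sT)) (.seq doubleProg (.pop sI))))

/-- The stack `P` holds the current power of two in unary and is copied to `U` at each bit 1. The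
bound `p₁` dominates all these powers, so the cost is of order (number of bits) · `p₁`. -/
theorem det_readBinary {r : List Sym} (hr : tBit r.head? = false) (p₁ : ℕ) (l : List Bool) :
    ∀ (s : St) (p : ℕ), p * 2 ^ l.length ≤ p₁ → s.I = encode l ++ r → s.P = unary p → s.T = [] →
    Det readBinary s.fn (St.fn { s with
      I := r
      L := unary l.length ++ s.L
      U := unary (p * bitVal l) ++ s.U
      P := unary (p * 2 ^ l.length) }) (l.length * (16 * p₁ + 10) + 1) := by
  induction l with
  | nil =>
    intro s p hp hI hP hT
    have hI' : s.I = r := hI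
    refine (det_loop_done (by simp [hI', hr])).of_eq ?_ (by omega)
    cases s
    simp_all [unary, bitVal]
  | cons b l ih =>
    intro s p hp hI hP hT
    have hp' : p * 2 * 2 ^ l.length ≤ p₁ := by
      rw [List.length_cons, pow_succ] at hp
      linarith
    have hpp : p ≤ p₁ := by
      have := Nat.one_le_two_pow (n := l.length)
      nlinarith
    have h1 : Det (.ite sI (tIs true) (moveDup tSome sP sT sU) (moveAll sP sT))
        (St.fn { s with L := .bit true :: s.L }) (St.fn { s with
          L := .bit true :: s.L
          T := unary p
          P := []
          U := unary (p * b.toNat) ++ s.U }) (10 * p + 2) := by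
      cases b
      · refine (Det.ite_false (by simp [hI, encode_cons, tIs]) (det_moveAll (by decide))).of_eq ?_ ?_
        · simp [hP, hT, unary]
        · simp only [fn_sP, hP, length_unary]
          omega
      · refine (Det.ite_true (by simp [hI, encode_cons, tIs]) (det_moveDup (by decide) (by decide)
          (by decide) (l := unary p) (r := []) (fun a _ => tSome_some a) rfl
          (by simp [hP]))).of_eq ?_ ?_
        · simp [hT, reverse_unary]
        · rw [length_unary]
    have h2 := det_doubleProg p { s with
          L := .bit true :: s.L
          T := unary p
          P := []
          U := unary (p * b.toNat) ++ s.U } rfl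
    refine (Det.loop_step (S' := St.fn { s with
      I := encode l ++ r
      L := .bit true :: s.L
      T := []
      P := unary (p * 2)
      U := unary (p * b.toNat) ++ s.U }) (by simp [hI, encode_cons, tBit])
      ((((det_push sL _).of_eq (S'' := St.fn { s with L := .bit true :: s.L }) (by simp)
        le_rfl).seq (h1.seq (h2.seq (det_pop sI)))).of_eq (by simp [hI, encode_cons]) le_rfl) (ih _ (p * 2) hp' rfl rfl rfl)).of_eq ?_ ?_
    · have e1 : unary (l.length + 1) = unary l.length ++ [.bit true] := by rw [unary_add]; rfl
      have e2 : unary (p * (b.toNat + 2 * bitVal l)) =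
          unary (p * 2 * bitVal l) ++ unary (p * b.toNat) := by
        rw [← unary_add]; congr 1; ring
      have e3 : p * 2 ^ (l.length + 1) = p * 2 * 2 ^ l.length := by ring
      simp [bitVal, e1, e2, e3, hT]
    · have := Nat.add_one_mul l.length (16 * p₁ + 10)
      rw [List.length_cons]
      omega

/-- Count the bits of the rest of the input. -/
def countBits : Cmd 20 := .loop sI tSome (.seq (.pop sI) (.push sL (.bit true)))

/-- Writing 1/δ in unary would exceed the time bound; the learner only needs its bit length, which
stands in for log(1/δ). -/
theorem det_countBits (l : List Sym) : ∀ s : St, s.I = l → Det countBits s.fn (St.fn { s with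
      I := []
      L := unary l.length ++ s.L }) (4 * l.length + 1) := by
  induction l with
  | nil =>
    intro s hI
    refine (det_loop_done (by simp [hI, tSome])).of_eq ?_ (by omega)
    cases s
    simp_all [unary]
  | cons a l ih =>
    intro s hI
    refine (Det.loop_step (S' := St.fn { s with
      I := l
      L := .bit true :: s.L }) (t := 3) (by simp [hI, tSome])
      (((det_pop sI).seq (det_push sL _)).of_eq
        (by simp [hI]) (by omega)) (ih _ rfl)).of_eq ?_ (by rw [List.length_cons]; omega)
    have e1 : unary (l.length + 1) = unary l.length ++ [.bit true] := by rw [unary_add]; rfl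
    simp [e1]

/-- Create an entry for each symbol of `K`. -/
def entryLoop : Cmd 20 :=
  .loop sK tSome (.seq (.pop sK) (.seq (.push sA .sep) (.seq (moveDup tSome sY sT sA)
    (.seq (.seq (.push sA (.bit true)) (.push sQ .sep)) (incMove sT sY)))))

/-- The keys are successive n-bit binary numbers. All stored keys have value below that of `l`, so
the next one is new, and the bound by 2^n prevents the counter from growing beyond n bits. -/
theorem det_entryLoop {n : ℕ} (c : ℕ) : ∀ (s : St) (l : List Bool) (es : List (Entry n)),
    l.length = n → bitVal l + c < 2 ^ n → s.K = unary c → s.Y = (encode l).reverse →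
    s.T = [] → s.A = encA es → s.Q = encQ es → (es.map Prod.fst).Nodup →
    (∀ e ∈ es, e.2 = 0 ∧ bitVal (wordList e.1) < bitVal l) →
    ∃ (es' : List (Entry n)) (Y : List Sym), es'.length = es.length + c ∧
      (es'.map Prod.fst).Nodup ∧ (∀ e ∈ es', e.2 = 0) ∧
      Det entryLoop s.fn (St.fn { s with
        K := []
        Y := Y
        A := encA es'
        Q := encQ es' }) (c * (16 * n + 24) + 1) := by
  induction c with
  | zero =>
    intro s l es _ _ hK hY hT hA hQ hn he
    have hK' : s.K = [] := hK
    refine ⟨es, s.Y, rfl, hn, fun e h => (he e h).1,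
      (det_loop_done (by simp [hK', tSome])).of_eq ?_ (by omega)⟩
    cases s
    simp_all
  | succ c ih =>
    intro s l es hl hlc hK hY hT hA hQ hn he
    have hw : wordList (listWord n l) = l := wordList_listWord hl
    have hkey : key (listWord n l) = true :: l := by rw [key, wordList_snoc, hw]
    have h1 : Det (moveDup tSome sY sT sA) (St.fn { s with
        K := unary c
        A := .sep :: s.A }) (St.fn { s with
        K := unary c
        Y := []
        T := encode l
        A := encode l ++ .sep :: s.A }) (10 * n + 1) :=
      (det_moveDup (by decide) (by decide) (by decide) (l := (encode l).reverse) (r := [])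
        (fun a _ => tSome_some a) rfl (by simp [hY])).of_eq (by simp [hT])
        (by simp [length_encode, hl])
    have h2 : Det (incMove sT sY) (St.fn { s with
        K := unary c
        Y := []
        T := encode l
        A := .bit true :: (encode l ++ .sep :: s.A)
        Q := .sep :: s.Q }) (St.fn { s with
        K := unary c
        Y := (encode (incBits l)).reverse
        T := []
        A := .bit true :: (encode l ++ .sep :: s.A)
        Q := .sep :: s.Q }) (6 * n + 10) :=
      (det_incMove (by decide) (l := l) (r := []) rfl (by simp)).of_eq (by simp) (by rw [hl])
    have hl' := length_incBits l (by rw [hl]; omega)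
    have hv := bitVal_incBits l
    obtain ⟨es', Y, e1, e2, e3, e4⟩ := ih { s with
        K := unary c
        Y := (encode (incBits l)).reverse
        T := []
        A := .bit true :: (encode l ++ .sep :: s.A)
        Q := .sep :: s.Q } (incBits l) ((listWord n l, 0) :: es) (by rw [hl', hl])
      (by omega) rfl rfl rfl (by simp [encA, hkey, encode_cons, hA])
      (by simp [encQ, encode, hQ]) (by
        rw [List.map_cons, List.nodup_cons]
        refine ⟨fun h => ?_, hn⟩
        obtain ⟨e, h3, h4⟩ := List.mem_map.1 h
        have := (he e h3).2
        rw [h4, hw] at this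
        exact lt_irrefl _ this) (by
        intro e h
        rcases List.mem_cons.1 h with rfl | h
        · exact ⟨rfl, by rw [hw]; omega⟩
        · exact ⟨(he e h).1, by have := (he e h).2; omega⟩)
    refine ⟨es', Y, by rw [e1, List.length_cons]; omega, e2, e3,
      (Det.loop_step (by simp [hK, unary_succ, tSome])
        (((det_pop sK).of_eq (S'' := St.fn { s with K := unary c }) (by simp [hK, unary_succ])
          le_rfl).seq (((det_push sA _).of_eq (S'' := St.fn { s with
            K := unary c
            A := .sep :: s.A }) (by simp) le_rfl).seq (h1.seq
            (((det_push sA _).seq (det_push sQ _)).of_eq (S'' := St.fn { s with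
              K := unary c
              Y := []
              T := encode l
              A := .bit true :: (encode l ++ .sep :: s.A)
              Q := .sep :: s.Q }) (by simp) le_rfl |>.seq h2)))) e4).of_eq ?_ ?_⟩
    · simp [hT]
    · have := Nat.add_one_mul c (16 * n + 24)
      omega

end

/-! ### The whole program -/

/-- Empty stacks. -/
def St.empty : St where
  I := []
  N := []
  N2 := []
  X := []
  X2 := []
  A := []
  A2 := []
  Q := []
  Q2 := []
  F := []
  G := []
  R := []
  M := []
  M2 := []
  L := []
  U := []
  U2 := []
  K := []
  T := []
  P := []
  Y := []

/-- The number of entries for the inverse accuracy `E`. -/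
def numEntries (E : ℕ) : ℕ := E * (E - 2) * 12

/-- The number of samples of each kind for the inverse accuracy `E` and the inverse confidence
`D`. -/
def numSamples (E D : ℕ) : ℕ := (E.size + D.size) * numEntries E * 1024

/-- Read the input. -/
def readProg : Cmd 20 :=
  .seq (.push sR (.bit true)) (.seq readUnary (.seq (.seq (.push sN (.bit true))
    (.seq (.pop sI) (.push sP (.bit true)))) (.seq readBinary (.seq (.pop sI) countBits))))

/-- Compute the numbers of entries and samples. -/
def arithProg : Cmd 20 :=
  .seq (clearWhile tSome sP) (.seq (moveDup tSome sU sP sU2) (.seq (.seq (.pop sU2) (.pop sU2))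
    (.seq (mulStacks sP sU2 sT sK 12) (mulStacks sL sK sT sM 1024))))

/-- Create the initial entries. -/
def entryProg : Cmd 20 :=
  .seq entryLoop (.seq (.push sF (.bit false)) (.push sG (.bit false)))

theorem two_pow_size_le {E : ℕ} (hE : 0 < E) : 2 ^ E.size ≤ 2 * E := by
  have h1 : 0 < E.size := Nat.size_pos.2 hE
  have h2 : 2 ^ (E.size - 1) ≤ E := Nat.lt_size.1 (by omega)
  calc 2 ^ E.size = 2 ^ (E.size - 1 + 1) := by congr 1; omega
    _ ≤ 2 * E := by rw [pow_succ]; omega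

section

variable (n E D : ℕ)

/-- The input. -/
def inputSt : St := { St.empty with
  I := encode (List.replicate n true) ++ .sep ::
    (encode (Nat.bits E) ++ .sep :: encode (Nat.bits D)) }

/-- The stacks after the input has been read. -/
def readSt : St := { St.empty with
  N := unary (n + 1)
  Y := encode (List.replicate n false)
  R := encode (List.replicate n false) ++ [.bit true]
  L := unary (E.size + D.size)
  U := unary E
  P := unary (2 ^ E.size) }

/-- The stacks after the computation of the numbers of entries and samples. -/
def arithSt : St := { St.empty with
  N := unary (n + 1)
  Y := encode (List.replicate n false)
  R := encode (List.replicate n false) ++ [.bit true]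
  U2 := unary (E - 2)
  K := unary (numEntries E)
  M := unary (numSamples E D) }

theorem det_readProg (hE : 0 < E) : Det readProg (inputSt n E D).fn (readSt n E D).fn
    (8 * n + E.size * (32 * E + 10) + 4 * D.size + 20) := by
  have hrep : encode (List.replicate n true) = unary n := by simp [encode, unary]
  have h1 : Det readUnary (St.fn { inputSt n E D with R := [.bit true] }) (St.fn { St.empty with
      I := .sep :: (encode (Nat.bits E) ++ .sep :: encode (Nat.bits D))
      N := unary n
      Y := encode (List.replicate n false)
      R := encode (List.replicate n false) ++ [.bit true] }) (8 * n + 1) :=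
    (det_readUnary (r := .sep :: (encode (Nat.bits E) ++ .sep :: encode (Nat.bits D)))
      rfl n _ (by simp [inputSt, hrep])).of_eq (by simp [inputSt, St.empty]) le_rfl
  have h2 : Det (.seq (.push sN (.bit true)) (.seq (.pop sI) (.push sP (.bit true))))
      (St.fn { St.empty with
        I := .sep :: (encode (Nat.bits E) ++ .sep :: encode (Nat.bits D))
        N := unary n
        Y := encode (List.replicate n false)
        R := encode (List.replicate n false) ++ [.bit true] }) (St.fn { St.empty with
        I := encode (Nat.bits E) ++ .sep :: encode (Nat.bits D)
        N := unary (n + 1)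
        Y := encode (List.replicate n false)
        R := encode (List.replicate n false) ++ [.bit true]
        P := [.bit true] }) 5 :=
    ((det_push sN _).seq ((det_pop sI).seq (det_push sP _))).of_eq
      (by simp [St.empty, unary_succ]) le_rfl
  have h3 : Det readBinary (St.fn { St.empty with
        I := encode (Nat.bits E) ++ .sep :: encode (Nat.bits D)
        N := unary (n + 1)
        Y := encode (List.replicate n false)
        R := encode (List.replicate n false) ++ [.bit true]
        P := [.bit true] }) (St.fn { readSt n E D with
        I := .sep :: encode (Nat.bits D)
        L := unary E.size }) (E.size * (16 * (2 * E) + 10) + 1) :=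
    (det_readBinary rfl (2 * E) (Nat.bits E) _ 1 (by
        rw [Nat.size_eq_bits_len, one_mul]; exact two_pow_size_le hE) rfl rfl rfl).of_eq
      (by simp [St.empty, readSt, Nat.size_eq_bits_len, bitVal_bits])
      (by rw [Nat.size_eq_bits_len])
  have h4 : Det countBits (St.fn { readSt n E D with
        I := encode (Nat.bits D)
        L := unary E.size }) (readSt n E D).fn (4 * D.size + 1) :=
    (det_countBits (encode (Nat.bits D)) _ rfl).of_eq (by
      simp [St.empty, readSt, length_encode, Nat.size_eq_bits_len, ← unary_add, add_comm])
      (by rw [length_encode, Nat.size_eq_bits_len])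
  have h5 : Det (.pop sI) (St.fn { readSt n E D with
        I := .sep :: encode (Nat.bits D)
        L := unary E.size }) (St.fn { readSt n E D with
        I := encode (Nat.bits D)
        L := unary E.size }) 1 := (det_pop sI).of_eq (by simp) le_rfl
  exact (((det_push sR _).of_eq (by simp [inputSt, St.empty]) le_rfl).seq (h1.seq (h2.seq
    (h3.seq (h5.seq h4))))).mono (by ring_nf; omega)

theorem det_arithProg (hE : 0 < E) : Det arithProg (readSt n E D).fn (arithSt n E D).fn
    (14 * E + E * ((E - 2) * 38 + 6) + (E.size + D.size) * (numEntries E * 2062 + 6) + 20) := by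
  have h0 := two_pow_size_le hE
  have h1 : Det (clearWhile tSome sP) (readSt n E D).fn (St.fn { readSt n E D with P := [] })
      (4 * E + 1) :=
    det_clear.of_eq (by simp) (by simp [readSt, length_unary]; omega)
  have h2 : Det (moveDup tSome sU sP sU2) (St.fn { readSt n E D with P := [] })
      (St.fn { readSt n E D with
        U := []
        U2 := unary E
        P := unary E }) (10 * E + 1) :=
    (det_moveDup (by decide) (by decide) (by decide) (l := unary E) (r := [])
      (fun a _ => tSome_some a) rfl (by simp [readSt])).of_eq
      (by simp [readSt, St.empty, reverse_unary]) (by rw [length_unary])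
  have h3 : Det (.seq (.pop sU2) (.pop sU2)) (St.fn { readSt n E D with
        U := []
        U2 := unary E
        P := unary E }) (St.fn { readSt n E D with
        U := []
        U2 := unary (E - 2)
        P := unary E }) 3 :=
    ((det_pop sU2).seq (det_pop sU2)).of_eq (by simp [unary, Nat.sub_sub]) le_rfl
  have h4 : Det (mulStacks sP sU2 sT sK 12) (St.fn { readSt n E D with
        U := []
        U2 := unary (E - 2)
        P := unary E }) (St.fn { readSt n E D with
        U := []
        U2 := unary (E - 2)
        K := unary (numEntries E)
        P := [] }) (E * ((E - 2) * 38 + 6) + 1) :=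
    (det_mulStacks (by decide) (by decide) (by decide) (by decide) (by decide) (by decide) 12
      rfl rfl rfl).of_eq (by simp [numEntries, readSt, St.empty]) le_rfl
  have h5 : Det (mulStacks sL sK sT sM 1024) (St.fn { readSt n E D with
        U := []
        U2 := unary (E - 2)
        K := unary (numEntries E)
        P := [] }) (arithSt n E D).fn
      ((E.size + D.size) * (numEntries E * 2062 + 6) + 1) :=
    (det_mulStacks (by decide) (by decide) (by decide) (by decide) (by decide) (by decide) 1024
      rfl rfl rfl).of_eq (by simp [numSamples, arithSt, readSt, St.empty]) le_rfl
  exact (h1.seq (h2.seq (h3.seq (h4.seq h5)))).mono (by omega)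

/-- The string of the record before the first round. -/
def zeroCube : Cube n := fun _ => false

theorem det_entryProg (hk : numEntries E < 2 ^ n) : ∃ (s : St) (es : List (Entry n)),
    s.I = [] ∧ s.T = [] ∧ es.length = numEntries E ∧ (es.map Prod.fst).Nodup ∧
    (∀ e ∈ es, e.2 = 0) ∧ Det entryProg (arithSt n E D).fn
      (cfg s (numSamples E D) 0 false [] (es, zeroCube n)).fn
      (numEntries E * (16 * n + 24) + 10) := by
  obtain ⟨es, Y, h1, h2, h3, h4⟩ := det_entryLoop (n := n) (numEntries E) (arithSt n E D)
    (List.replicate n false) [] (by simp) (by rwa [bitVal_replicate, zero_add]) rfl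
    (by simp [arithSt, encode]) rfl rfl rfl (by simp) (by simp)
  refine ⟨{ St.empty with
    U2 := unary (E - 2)
    Y := Y }, es, rfl, rfl, by simpa using h1, h2, h3,
    (h4.seq ((det_push sF _).seq (det_push sG _))).of_eq ?_ (by omega)⟩
  have h5 : (encode (key (zeroCube n))).reverse =
      encode (List.replicate n false) ++ [.bit true] := by
    have h6 : List.ofFn (zeroCube n) = List.replicate n false := List.ofFn_const n false
    rw [key, wordList_snoc, wordList, ← encode_reverse, List.reverse_cons, List.reverse_reverse,
      h6, encode_append]
    rfl
  simp [cfg, h5, arithSt, St.empty, unary]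

end

/-- The learner. -/
def learner : Cmd 20 := .seq readProg (.seq arithProg (.seq entryProg learnProg))

/-- The running time of the learner. -/
def totalTime (n E D : ℕ) : ℕ :=
  8 * n + E.size * (32 * E + 10) + 4 * D.size + 14 * E + E * ((E - 2) * 38 + 6) +
    (E.size + D.size) * (numEntries E * 2062 + 6) + numEntries E * (16 * n + 24) + 60 +
    learnTime n (numEntries E) (numSamples E D)

section

variable {n E D : ℕ}

theorem prob_learner (hE : 0 < E) (hk : numEntries E < 2 ^ n) : ∃ es : List (Entry n),
    es.length = numEntries E ∧ (es.map Prod.fst).Nodup ∧ (∀ e ∈ es, e.2 = 0) ∧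
    ∀ {ρ : QOp (n + 1)}, ρ.IsHermitian →
    Prob ρ learner (inputSt n E D).fn (totalTime n E D) (2 * numSamples E D)
      (2 * (numSamples E D * (n + 1)))
      (fun l S' => S' 0 = encode (List.ofFn (learn (numSamples E D) (es, zeroCube n) l.1 l.2)))
      (fun V => iidExp (outcomeProb true ρ) (numSamples E D) fun l₁ =>
        iidExp (outcomeProb false ρ) (numSamples E D) fun l₂ => V (l₁, l₂)) := by
  obtain ⟨s, es, hI, hT, hlen, hnd, hz, h3⟩ := det_entryProg n E D hk
  refine ⟨es, hlen, hnd, hz, fun hρ => ?_⟩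
  exact (Prob.det_seq (det_readProg n E D hE) (Prob.det_seq (det_arithProg n E D hE)
    (Prob.det_seq h3 (prob_learnProg hρ s hI hT (a := (es, zeroCube n)) hlen hz)))).of_le
    (by rw [totalTime]; omega) le_rfl le_rfl fun _ _ h => h

/-- The dominant term is n · k · m times the counter width. The unary arithmetic costs O(E²) plus
O((E.size + D.size) k), which E² ≤ k + 4 and the definition of m absorb; reading the inputs explains
the term `D.size`. The summand besides `totalTime` is the length of the input, included so that the
same bound covers the memory. -/
theorem totalTime_le (hn : 1 ≤ n) (hE : 2 ≤ E) :
    totalTime n E D + (n + E.size + D.size + 2) ≤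
      10000 * (n * (numEntries E * numSamples E D + D.size + 1) * ((numSamples E D).size + 1)) := by
  set k := numEntries E with hk
  set m := numSamples E D with hm
  set B := m.size
  set d := D.size
  have hEk : E * E ≤ k + 4 := by
    rw [hk, numEntries]
    rcases Nat.lt_or_ge 2 E with h | h
    · obtain ⟨F, rfl⟩ := Nat.exists_eq_add_of_lt h
      rw [show 2 + F + 1 - 2 = F + 1 by omega]
      nlinarith
    · obtain rfl : E = 2 := by omega
      norm_num
  have hsE : E.size ≤ E := Nat.size_le.2 Nat.lt_two_pow_self
  have hs0 : 1 ≤ E.size := Nat.size_pos.2 (by omega)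
  have hsk : (E.size + d) * k ≤ m := by
    rw [hm, numSamples]
    exact Nat.le_mul_of_pos_right _ (by norm_num)
  have hkm : k ≤ m := le_trans (Nat.le_mul_of_pos_left _ (by omega)) hsk
  have hmk : m ≤ k * m := by
    -- Without entries there are no samples either, so the inequality survives k = 0.
    rcases Nat.eq_zero_or_pos k with h | h
    · simp [hm, numSamples, ← hk, h]
    · exact Nat.le_mul_of_pos_left _ h
  set W := k * m with hW
  set Z := n * (W + d + 1) * (B + 1) with hZ
  have z1 : n * W + n ≤ Z := by
    calc n * W + n = n * (W + 1) * 1 := by ring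
      _ ≤ n * (W + d + 1) * (B + 1) := by gcongr <;> omega
  have z2 : W * B ≤ Z := by
    calc W * B = 1 * W * B := by ring
      _ ≤ n * (W + d + 1) * (B + 1) := by gcongr <;> omega
  have z3 : W + d + 1 ≤ Z := by
    calc W + d + 1 = 1 * (W + d + 1) * 1 := by ring
      _ ≤ n * (W + d + 1) * (B + 1) := by gcongr; omega
  have z4 : n * m ≤ n * W := Nat.mul_le_mul_left _ hmk
  have z5 : n * k ≤ n * W := Nat.mul_le_mul_left _ (hkm.trans hmk)
  have z6 : E.size * E ≤ E * E := Nat.mul_le_mul_right _ hsE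
  have z7 : E * (E - 2) ≤ E * E := Nat.mul_le_mul_left _ (by omega)
  have z8 : E ≤ E * E := Nat.le_mul_of_pos_left _ (by omega)
  have e1 : learnTime n k m = 186 * (n * W) + 72 * (W * B) + 534 * W + 150 * m + 40 * (n * m) +
      12 * n + 40 := by
    rw [learnTime, passTime, hW]
    ring
  have e2 : E.size * (32 * E + 10) = 32 * (E.size * E) + 10 * E.size := by ring
  have e3 : E * ((E - 2) * 38 + 6) = 38 * (E * (E - 2)) + 6 * E := by ring
  have e4 : (E.size + d) * (k * 2062 + 6) = 2062 * ((E.size + d) * k) + 6 * (E.size + d) := by ring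
  have e5 : k * (16 * n + 24) = 16 * (n * k) + 24 * k := by ring
  rw [totalTime, ← hk, ← hm, e1, e2, e3, e4, e5]
  omega

end

/-! ### The run of the learner -/

section

variable {n : ℕ} {ε δ : ℝ} {D : PMF (Cube n × Bool)}

theorem initial_stk (P : Cmd 20) :
    (initial P n ε δ).stk = (inputSt n ⌈1 / ε⌉₊ ⌈1 / δ⌉₊).fn := by
  funext i
  fin_cases i <;> rfl

theorem encode_injective : Function.Injective encode := fun l l' h =>
  List.map_injective_iff.2 (fun a b h => by cases h; rfl) h

/-- The initial register has trace 1, so the rule for the whole program, tested on the indicator of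
success, is the output probability. The initial table does not depend on the measurements. -/
theorem run_learner (D : PMF (Cube n × Bool)) (hε : 0 < ε) (hk : numEntries ⌈1 / ε⌉₊ < 2 ^ n) :
    ∃ es : List (Entry n), es.length = numEntries ⌈1 / ε⌉₊ ∧ (es.map Prod.fst).Nodup ∧
    (∀ e ∈ es, e.2 = 0) ∧
    (∀ c ∈ branches (mixtureExample D) (totalTime n ⌈1 / ε⌉₊ ⌈1 / δ⌉₊) (initial learner n ε δ),
      c.code = [] ∧ c.copies ≤ 2 * numSamples ⌈1 / ε⌉₊ ⌈1 / δ⌉₊ ∧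
      c.gates ≤ 2 * (numSamples ⌈1 / ε⌉₊ ⌈1 / δ⌉₊ * (n + 1))) ∧
    ∀ (S : Set (Cube n)) [DecidablePred (· ∈ S)], outputProb learner ε δ (mixtureExample D)
      (totalTime n ⌈1 / ε⌉₊ ⌈1 / δ⌉₊) S =
        iidExp (outcomeProb true (mixtureExample D)) (numSamples ⌈1 / ε⌉₊ ⌈1 / δ⌉₊) fun l₁ =>
        iidExp (outcomeProb false (mixtureExample D)) (numSamples ⌈1 / ε⌉₊ ⌈1 / δ⌉₊) fun l₂ =>
          if learn (numSamples ⌈1 / ε⌉₊ ⌈1 / δ⌉₊) (es, zeroCube n) l₁ l₂ ∈ S then 1 else 0 := by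
  classical
  obtain ⟨es, h1, h2, h3, h4⟩ := prob_learner (n := n) (D := ⌈1 / δ⌉₊)
    (E := ⌈1 / ε⌉₊) (Nat.ceil_pos.2 (by positivity)) hk
  set m := numSamples ⌈1 / ε⌉₊ ⌈1 / δ⌉₊
  obtain ⟨L, hL1, hL2, hL3⟩ := h4 (mixtureExample_isHermitian D) []
    (Matrix.single (fun _ => false) (fun _ => false) 1) 0 0
  have hbr : branches (mixtureExample D) (totalTime n ⌈1 / ε⌉₊ ⌈1 / δ⌉₊) (initial learner n ε δ) =
      L.map Prod.fst := by
    refine Reach.branches_eq ?_ ?_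
    · have : initial learner n ε δ = ⟨[learner], (inputSt n ⌈1 / ε⌉₊ ⌈1 / δ⌉₊).fn,
          Matrix.single (fun _ => false) (fun _ => false) 1, 0, 0, 0⟩ := by
        rw [← initial_stk learner]
        rfl
      rw [this]
      exact hL1
    · intro c hc
      obtain ⟨d, hd, rfl⟩ := List.mem_map.1 hc
      exact (hL2 d hd).1
  refine ⟨es, h1, h2, h3, ?_, fun S _ => ?_⟩
  · rw [hbr]
    intro c hc
    obtain ⟨d, hd, rfl⟩ := List.mem_map.1 hc
    obtain ⟨e1, -, e2, e3, -⟩ := hL2 d hd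
    exact ⟨e1, by omega, by omega⟩
  · have hV := hL3 fun l => if learn m (es, zeroCube n) l.1 l.2 ∈ S then 1 else 0
    have htr : (Matrix.single (fun _ => false) (fun _ => false) 1 : QOp (n + 1)).trace.re = 1 := by
      rw [Matrix.trace_single_eq_same]
      simp
    rw [htr, one_mul] at hV
    refine Eq.trans ?_ hV
    rw [outputProb, hbr, List.map_map]
    refine congrArg List.sum (List.map_congr_left fun d hd => ?_)
    obtain ⟨e1, -, -, -, e2⟩ := hL2 d hd
    have hiff : (∃ s ∈ S, d.1.Outputs s) ↔ learn m (es, zeroCube n) d.2.1 d.2.2 ∈ S := by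
      constructor
      · rintro ⟨s, hs, -, h⟩
        have := List.ofFn_injective (encode_injective (h.symm.trans e2))
        rwa [← this]
      · exact fun h => ⟨_, h, e1, e2⟩
    simp only [Function.comp_apply, hiff]
    split_ifs <;> simp

/-! ### Large accuracies -/

/-- The sum factorises over the coordinates; each factor is 2 or 0 according to whether the bits of
`s` and `t` agree. -/
theorem sum_sgn_parity_nonneg (s t : Cube n) : 0 ≤ ∑ x, sgn (parity s x ^^ parity t x) := by
  have h : ∀ x : Cube n, sgn (parity s x ^^ parity t x) =
      ∏ i, sgn ((s i && x i) ^^ (t i && x i)) := by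
    intro x
    rw [sgn_xor, sgn_parity, sgn_parity, ← Finset.prod_mul_distrib]
    exact Finset.prod_congr rfl fun i _ => (sgn_xor _ _).symm
  have h' := Finset.prod_univ_sum (fun _ : Fin n => (Finset.univ : Finset Bool))
    fun i b => sgn ((s i && b) ^^ (t i && b))
  rw [Fintype.piFinset_univ] at h'
  rw [Finset.sum_congr rfl fun x _ => h x, ← h']
  refine Finset.prod_nonneg fun i _ => ?_
  rw [Fintype.sum_bool]
  cases s i <;> cases t i <;> simp [sgn]

/-- The errors differ by at most the probability that the two parities differ, which is at most 1/2
by orthogonality of characters. -/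
theorem err_parity_le (hD : D ∈ uniformMarginal n) (s t : Cube n) :
    err D (parity s) ≤ err D (parity t) + 1 / 2 := by
  have h1 : ∀ x, (D (x, !parity s x)).toReal ≤ (D (x, !parity t x)).toReal +
      (1 / 2 ^ n - 1 / 2 ^ n * sgn (parity s x ^^ parity t x)) / 2 := by
    intro x
    have h2 := toReal_add hD x
    have h3 : 0 ≤ (D (x, true)).toReal := ENNReal.toReal_nonneg
    have h4 : 0 ≤ (D (x, false)).toReal := ENNReal.toReal_nonneg
    cases parity s x <;> cases parity t x <;> simp [sgn] <;>
      simp only [one_div] at h2 <;> linarith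
  have h2 := Finset.sum_le_sum fun x (_ : x ∈ Finset.univ) => h1 x
  have h3 := sum_sgn_parity_nonneg s t
  rw [Finset.sum_add_distrib, ← err_eq, ← err_eq, ← Finset.sum_div, Finset.sum_sub_distrib,
    ← Finset.mul_sum] at h2
  have h4 : ∑ _x : Cube n, (1 : ℝ) / 2 ^ n = 1 := by simp [Fintype.card_pi]
  have h5 : (0 : ℝ) ≤ 1 / 2 ^ n * ∑ x, sgn (parity s x ^^ parity t x) := by positivity
  linarith

end

/-! ### The size of the parameters -/

theorem half_le_log_two : (1 : ℝ) / 2 ≤ Real.log 2 := by linarith [Real.log_two_gt_d9]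

theorem log_two_le_one : Real.log 2 ≤ 1 := by linarith [Real.log_two_lt_d9]

theorem size_le_log {c : ℕ} {x : ℝ} (hc : 0 < c) (hx : (c : ℝ) ≤ x) :
    (c.size : ℝ) ≤ 2 * Real.log x + 1 := by
  have h1 : 0 < c.size := Nat.size_pos.2 hc
  have h2 : 2 ^ (c.size - 1) ≤ c := Nat.lt_size.1 (by omega)
  have h3 : (2 : ℝ) ^ (c.size - 1) ≤ x := le_trans (by exact_mod_cast h2) hx
  have h4 := Real.log_le_log (by positivity) h3
  rw [Real.log_pow, Nat.cast_sub h1, Nat.cast_one] at h4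
  have h5 : (1 : ℝ) ≤ c.size := by exact_mod_cast h1
  nlinarith [half_le_log_two]

section

variable {n : ℕ} {ε δ : ℝ}

theorem ceil_inv_bounds (h0 : 0 < ε) (h1 : ε < 1) :
    2 ≤ ⌈1 / ε⌉₊ ∧ 1 / ε ≤ ⌈1 / ε⌉₊ ∧ (⌈1 / ε⌉₊ : ℝ) < 1 / ε + 1 ∧ (⌈1 / ε⌉₊ : ℝ) ≤ 2 / ε := by
  have h2 : 1 < 1 / ε := by rwa [lt_div_iff₀ h0, one_mul]
  have h3 := Nat.ceil_lt_add_one (a := 1 / ε) (by positivity)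
  refine ⟨?_, Nat.le_ceil _, h3, ?_⟩
  · exact Nat.succ_le_of_lt (Nat.lt_ceil.2 (by exact_mod_cast h2))
  · rw [show (2 : ℝ) / ε = 1 / ε + 1 / ε by ring]
    linarith

theorem size_ceil_inv_le (h0 : 0 < ε) (h1 : ε < 1) :
    ((⌈1 / ε⌉₊).size : ℝ) ≤ 2 * (Real.log 2 - Real.log ε) + 1 := by
  obtain ⟨h2, -, -, h3⟩ := ceil_inv_bounds h0 h1
  have := size_le_log (by omega) h3
  rwa [Real.log_div (by norm_num) h0.ne'] at this

theorem cast_numEntries {E : ℕ} (hE : 2 ≤ E) :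
    (numEntries E : ℝ) = 12 * (((E : ℝ) - 1) ^ 2 - 1) := by
  rw [numEntries]
  push_cast [Nat.cast_sub hE]
  ring

/-- Since E(E - 2) = (E - 1)² - 1 and E - 1 < 1/ε, rounding up costs nothing. A plain multiple of E²
would lose a factor that the condition on ε does not allow for. -/
theorem numEntries_le (h0 : 0 < ε) (h1 : ε < 1) : (numEntries ⌈1 / ε⌉₊ : ℝ) ≤ 12 / ε ^ 2 := by
  obtain ⟨h2, -, h3, -⟩ := ceil_inv_bounds h0 h1
  have h4 : (2 : ℝ) ≤ ⌈1 / ε⌉₊ := by exact_mod_cast h2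
  rw [cast_numEntries h2]
  have h5 : ((⌈1 / ε⌉₊ : ℝ) - 1) ^ 2 ≤ (1 / ε) ^ 2 :=
    pow_le_pow_left₀ (by linarith) (by linarith) 2
  rw [div_pow, one_pow] at h5
  rw [show (12 : ℝ) / ε ^ 2 = 12 * (1 / ε ^ 2) by ring]
  linarith

theorem sixteen_lt (h : (2 : ℝ) ^ (-((n : ℝ) / 2 - 2)) < ε) : 16 < ε ^ 2 * 2 ^ n := by
  have h1 : ((2 : ℝ) ^ (-((n : ℝ) / 2 - 2))) ^ 2 < ε ^ 2 :=
    pow_lt_pow_left₀ h (by positivity) (by norm_num)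
  have h2 : ((2 : ℝ) ^ (-((n : ℝ) / 2 - 2))) ^ 2 * 2 ^ n = 16 := by
    rw [← Real.rpow_natCast, ← Real.rpow_mul (by norm_num), ← Real.rpow_natCast 2 n,
      ← Real.rpow_add (by norm_num)]
    rw [show -((n : ℝ) / 2 - 2) * ((2 : ℕ) : ℝ) + n = (4 : ℕ) by push_cast; ring,
      Real.rpow_natCast]
    norm_num
  rw [← h2]
  exact mul_lt_mul_of_pos_right h1 (by positivity)

/-- The condition on ε says 16/ε² < 2^n, which leaves room for 12/ε² distinct keys. -/
theorem numEntries_lt (h0 : 0 < ε) (h1 : ε < 1) (h : (2 : ℝ) ^ (-((n : ℝ) / 2 - 2)) < ε) :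
    numEntries ⌈1 / ε⌉₊ < 2 ^ n := by
  have h2 := numEntries_le h0 h1
  have h3 := sixteen_lt h
  have h4 : (12 : ℝ) / ε ^ 2 < 2 ^ n := by
    rw [div_lt_iff₀ (by positivity)]
    linarith
  exact_mod_cast h2.trans_lt h4

theorem one_le_of_lt (h0 : 0 < ε) (h1 : ε < 1) (h : (2 : ℝ) ^ (-((n : ℝ) / 2 - 2)) < ε) :
    1 ≤ n := by
  have h3 := sixteen_lt h
  by_contra hn
  obtain rfl : n = 0 := by omega
  nlinarith

theorem log_cplx (h0 : 0 < ε) (hδ : 0 < δ) :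
    Real.log (1 / (δ * ε ^ 2)) = -Real.log δ - 2 * Real.log ε := by
  rw [one_div, Real.log_inv, Real.log_mul hδ.ne' (by positivity), Real.log_pow]
  push_cast
  ring

theorem log_le_cplx (h0 : 0 < ε) (h1 : ε < 1) (hδ : 0 < δ) (hδ1 : δ < 1) :
    -Real.log δ - 2 * Real.log ε ≤ cplx ε δ := by
  have h2 := Real.log_neg h0 h1
  have h3 := Real.log_neg hδ hδ1
  rw [cplx, log_cplx h0 hδ, le_div_iff₀ (by positivity)]
  exact mul_le_of_le_one_right (by linarith) (pow_le_one₀ h0.le h1.le)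

/-- As ε and δ approach 1 the parameter M tends to 0, and a bound C·M then forbids even one copy.
The factor E - 2 makes the learner skip all sampling when ⌈1/ε⌉ = 2. -/
theorem numEntries_eq_zero (h0 : 0 < ε) (h1 : ε < 1) (h2 : 1 / 2 ≤ ε) :
    numEntries ⌈1 / ε⌉₊ = 0 := by
  obtain ⟨h3, -, h4, -⟩ := ceil_inv_bounds h0 h1
  have h5 : 1 / ε ≤ 2 := by rw [div_le_iff₀ h0]; linarith
  have h6 : (⌈1 / ε⌉₊ : ℝ) < (3 : ℕ) := by push_cast; linarith
  have h7 : ⌈1 / ε⌉₊ = 2 := by have := Nat.cast_lt.1 h6; omega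
  rw [h7, numEntries]

theorem numSamples_eq_zero (h0 : 0 < ε) (h1 : ε < 1) (h2 : 1 / 2 ≤ ε) (D : ℕ) :
    numSamples ⌈1 / ε⌉₊ D = 0 := by
  rw [numSamples, numEntries_eq_zero h0 h1 h2, mul_zero, zero_mul]

/-- The additive constants from rounding are absorbed by -log ε ≥ log 2, available because ε < 1/2.
-/
theorem size_add_size_le (h0 : 0 < ε) (h2 : ε < 1 / 2) (hδ : 0 < δ) (hδ1 : δ < 1) :
    ((⌈1 / ε⌉₊).size : ℝ) + (⌈1 / δ⌉₊).size ≤ 5 * (-Real.log δ - 2 * Real.log ε) := by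
  have h3 := size_ceil_inv_le h0 (by linarith)
  have h4 := size_ceil_inv_le hδ hδ1
  have h5 := Real.log_neg hδ hδ1
  have h6 := Real.log_le_log h0 h2.le
  rw [one_div, Real.log_inv] at h6
  linarith [half_le_log_two]

theorem numSamples_le_div (h0 : 0 < ε) (h2 : ε < 1 / 2) (hδ : 0 < δ) (hδ1 : δ < 1) :
    (numSamples ⌈1 / ε⌉₊ ⌈1 / δ⌉₊ : ℝ) ≤ 61440 * (-Real.log δ - 2 * Real.log ε) / ε ^ 2 := by
  have h3 := size_add_size_le h0 h2 hδ hδ1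
  have h4 := numEntries_le h0 (by linarith)
  have h5 := mul_le_mul h3 h4 (Nat.cast_nonneg _) (le_trans (by positivity) h3)
  rw [numSamples]
  push_cast
  calc _ ≤ 5 * (-Real.log δ - 2 * Real.log ε) * (12 / ε ^ 2) * 1024 := by linarith
    _ = _ := by ring

theorem cplx_nonneg (h0 : 0 < ε) (h1 : ε < 1) (hδ : 0 < δ) (hδ1 : δ < 1) : 0 ≤ cplx ε δ := by
  have := log_le_cplx h0 h1 hδ hδ1
  have h2 := Real.log_neg h0 h1
  have h3 := Real.log_neg hδ hδ1
  linarith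

theorem numSamples_le (h0 : 0 < ε) (h1 : ε < 1) (hδ : 0 < δ) (hδ1 : δ < 1) :
    (numSamples ⌈1 / ε⌉₊ ⌈1 / δ⌉₊ : ℝ) ≤ 61440 * cplx ε δ := by
  rcases le_or_gt (1 / 2) ε with h2 | h2
  · rw [numSamples_eq_zero h0 h1 h2, Nat.cast_zero]
    have := cplx_nonneg h0 h1 hδ hδ1
    positivity
  · refine (numSamples_le_div h0 h2 hδ hδ1).trans ?_
    have h3 := Real.log_neg h0 h1
    have h4 := Real.log_neg hδ hδ1
    rw [cplx, log_cplx h0 hδ, ← mul_div_assoc]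
    refine div_le_div_of_nonneg_left (by linarith) (by positivity) ?_
    exact pow_le_pow_of_le_one h0.le h1.le (by norm_num)

/-- Entries times samples give 12/ε² · 61440 log(1/(δε²))/ε², which is 737280 M. The bit length of
1/δ and the constant are paid for by max(1, M). -/
theorem work_le (h0 : 0 < ε) (h1 : ε < 1) (hδ : 0 < δ) (hδ1 : δ < 1) :
    (numEntries ⌈1 / ε⌉₊ * numSamples ⌈1 / ε⌉₊ ⌈1 / δ⌉₊ + (⌈1 / δ⌉₊).size + 1 : ℝ) ≤
      1000000 * max 1 (cplx ε δ) := by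
  have h3 := Real.log_neg h0 h1
  have h4 := Real.log_neg hδ hδ1
  have h5 := log_le_cplx h0 h1 hδ hδ1
  have h6 := size_ceil_inv_le hδ hδ1
  have h7 := le_max_left 1 (cplx ε δ)
  have h8 := le_max_right 1 (cplx ε δ)
  have h9 := log_two_le_one
  suffices (numEntries ⌈1 / ε⌉₊ * numSamples ⌈1 / ε⌉₊ ⌈1 / δ⌉₊ : ℝ) ≤ 737280 * cplx ε δ by
    linarith
  rcases le_or_gt (1 / 2) ε with h2 | h2
  · rw [numEntries_eq_zero h0 h1 h2, Nat.cast_zero, zero_mul]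
    have := cplx_nonneg h0 h1 hδ hδ1
    positivity
  · refine (mul_le_mul (numEntries_le h0 h1) (numSamples_le_div h0 h2 hδ hδ1) (Nat.cast_nonneg _)
      (by positivity)).trans (le_of_eq ?_)
    rw [cplx, log_cplx h0 hδ]
    field_simp
    ring

theorem size_numSamples_le (h0 : 0 < ε) (h1 : ε < 1) (hδ : 0 < δ) (hδ1 : δ < 1) :
    ((numSamples ⌈1 / ε⌉₊ ⌈1 / δ⌉₊).size + 1 : ℝ) ≤ 100 * Real.log (2 + cplx ε δ) := by
  have h2 := cplx_nonneg h0 h1 hδ hδ1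
  have h3 : Real.log 2 ≤ Real.log (2 + cplx ε δ) := Real.log_le_log (by norm_num) (by linarith)
  have h4 := half_le_log_two
  rcases Nat.eq_zero_or_pos (numSamples ⌈1 / ε⌉₊ ⌈1 / δ⌉₊) with h | h
  · rw [h]
    simp only [Nat.size_zero, Nat.cast_zero]
    linarith
  · have h5 := size_le_log h (x := 2 ^ 16 * (2 + cplx ε δ))
      (by linarith [numSamples_le h0 h1 hδ hδ1])
    rw [Real.log_mul (by norm_num) (by linarith), Real.log_pow] at h5
    push_cast at h5
    linarith [log_two_le_one]

theorem four_le_numEntries (h0 : 0 < ε) (h2 : ε < 1 / 2) :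
    4 ≤ (numEntries ⌈1 / ε⌉₊ : ℝ) * ε ^ 2 ∧ 3 ≤ ⌈1 / ε⌉₊ := by
  have h3 : (2 : ℕ) < 1 / ε := by
    rw [lt_div_iff₀ h0]
    push_cast
    linarith
  have h4 : 3 ≤ ⌈1 / ε⌉₊ := Nat.succ_le_of_lt (Nat.lt_ceil.2 h3)
  have h5 : (3 : ℝ) ≤ ⌈1 / ε⌉₊ := by exact_mod_cast h4
  have h6 : 1 / ε ≤ ⌈1 / ε⌉₊ := Nat.le_ceil _
  rw [div_le_iff₀ h0] at h6
  refine ⟨?_, h4⟩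
  rw [cast_numEntries (by omega)]
  have h7 : (1 : ℝ) ≤ (⌈1 / ε⌉₊ * ε) ^ 2 := one_le_pow₀ h6
  -- This says 24 E ≤ 8 E², which is E ≥ 3; it is the reason for the factor 12.
  have h8 : 4 * (⌈1 / ε⌉₊ : ℝ) ^ 2 ≤ 12 * (((⌈1 / ε⌉₊ : ℝ) - 1) ^ 2 - 1) := by nlinarith
  have h9 := mul_le_mul_of_nonneg_right h8 (sq_nonneg ε)
  rw [mul_pow] at h7
  linarith

theorem failure_le (h0 : 0 < ε) (h2 : ε < 1 / 2) (hδ : 0 < δ) (hδ1 : δ < 1) :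
    2 * (numEntries ⌈1 / ε⌉₊ : ℝ) *
      Real.exp (-(ε ^ 2 / 1024 * numSamples ⌈1 / ε⌉₊ ⌈1 / δ⌉₊)) ≤ δ / 2 := by
  obtain ⟨h3, h4⟩ := four_le_numEntries h0 h2
  obtain ⟨h5, h6, -, -⟩ := ceil_inv_bounds hδ hδ1
  set E := ⌈1 / ε⌉₊
  set D := ⌈1 / δ⌉₊
  have h4' : (3 : ℝ) ≤ E := by exact_mod_cast h4
  have h5' : (2 : ℝ) ≤ D := by exact_mod_cast h5
  have h7 : Real.exp (-(ε ^ 2 / 1024 * numSamples E D)) ≤ ((E : ℝ) ^ 4 * (D : ℝ) ^ 4)⁻¹ := by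
    rw [Real.exp_neg]
    refine inv_anti₀ (by positivity) ?_
    -- The factor 1024 in `numSamples` cancels and k ε² ≥ 4 remains, so the exponential is at most
    -- (E D)⁻⁴.
    have h8 : 4 * ((E.size : ℝ) + D.size) ≤ ε ^ 2 / 1024 * numSamples E D := by
      rw [numSamples]
      push_cast
      have : (0 : ℝ) ≤ (E.size : ℝ) + D.size := by positivity
      nlinarith
    have h9 : ∀ c : ℕ, (c : ℝ) ≤ Real.exp c.size := by
      intro c
      have e1 : (c : ℝ) ≤ 2 ^ c.size := by exact_mod_cast (Nat.lt_size_self c).le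
      refine e1.trans ?_
      rw [← Real.exp_one_pow]
      exact pow_le_pow_left₀ (by norm_num) (by linarith [Real.add_one_le_exp (1 : ℝ)]) _
    calc (E : ℝ) ^ 4 * (D : ℝ) ^ 4 ≤ Real.exp E.size ^ 4 * Real.exp D.size ^ 4 := by
          gcongr <;> exact h9 _
      _ = Real.exp (4 * ((E.size : ℝ) + D.size)) := by
          rw [← mul_pow, ← Real.exp_add, ← Real.exp_nat_mul]
          norm_num
      _ ≤ _ := Real.exp_le_exp.2 h8
  have h10 : (numEntries E : ℝ) ≤ 12 * (E : ℝ) ^ 2 := by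
    rw [cast_numEntries (by omega)]
    nlinarith
  rw [div_le_iff₀ hδ] at h6
  -- This is 2 · 12 E² / (E D)⁴ ≤ δ/2 with denominators cleared; it follows from E ≥ 3, D ≥ 2 and D
  -- δ ≥ 1.
  have h11 : (48 : ℝ) * E ^ 2 ≤ δ * (E ^ 4 * D ^ 4) := by
    have e1 : (9 : ℝ) ≤ E ^ 2 := by nlinarith
    have e2 : (8 : ℝ) ≤ D ^ 3 := by
      calc (8 : ℝ) = 2 ^ 3 := by norm_num
        _ ≤ D ^ 3 := pow_le_pow_left₀ (by norm_num) h5' 3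
    have e3 : (72 : ℝ) ≤ E ^ 2 * D ^ 3 := by nlinarith
    have e4 : (72 : ℝ) ≤ E ^ 2 * D ^ 3 * (D * δ) := by nlinarith
    have e5 : (0 : ℝ) ≤ E ^ 2 := by positivity
    calc (48 : ℝ) * E ^ 2 ≤ E ^ 2 * D ^ 3 * (D * δ) * E ^ 2 := by nlinarith
      _ = _ := by ring
  calc _ ≤ 2 * (12 * (E : ℝ) ^ 2) * ((E : ℝ) ^ 4 * (D : ℝ) ^ 4)⁻¹ := by gcongr
    _ ≤ δ / 2 := by
      rw [mul_inv_le_iff₀ (by positivity)]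
      linarith

theorem space_initial : (initial learner n ε δ).space =
    n + (⌈1 / ε⌉₊).size + (⌈1 / δ⌉₊).size + 2 := by
  rw [Config.space, initial_stk, Finset.sum_eq_single sI]
  · simp only [fn_sI, inputSt, List.length_append, List.length_cons, length_encode,
      List.length_replicate, Nat.size_eq_bits_len]
    omega
  · intro i _ hi
    fin_cases i <;> first | rfl | exact absurd rfl hi
  · simp

theorem time_le (h0 : 0 < ε) (h1 : ε < 1) (hδ : 0 < δ) (hδ1 : δ < 1)
    (h : (2 : ℝ) ^ (-((n : ℝ) / 2 - 2)) < ε) :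
    ((totalTime n ⌈1 / ε⌉₊ ⌈1 / δ⌉₊ + (initial learner n ε δ).space : ℕ) : ℝ) ≤
      10 ^ 12 * n * max 1 (cplx ε δ) * Real.log (2 + cplx ε δ) ^ 1 := by
  rw [space_initial]
  have h2 := totalTime_le (D := ⌈1 / δ⌉₊) (one_le_of_lt h0 h1 h) (ceil_inv_bounds h0 h1).1
  have h3 : ((totalTime n ⌈1 / ε⌉₊ ⌈1 / δ⌉₊ +
      (n + (⌈1 / ε⌉₊).size + (⌈1 / δ⌉₊).size + 2) : ℕ) : ℝ) ≤
      10000 * (n * (numEntries ⌈1 / ε⌉₊ * numSamples ⌈1 / ε⌉₊ ⌈1 / δ⌉₊ + (⌈1 / δ⌉₊).size + 1) *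
        ((numSamples ⌈1 / ε⌉₊ ⌈1 / δ⌉₊).size + 1)) := by exact_mod_cast h2
  refine h3.trans ?_
  have h4 := work_le h0 h1 hδ hδ1
  have h5 := size_numSamples_le h0 h1 hδ hδ1
  calc _ ≤ 10000 * (n * (1000000 * max 1 (cplx ε δ)) * (100 * Real.log (2 + cplx ε δ))) := by
        gcongr
    _ = _ := by ring

theorem learner_prob {D : PMF (Cube n × Bool)} (hD : D ∈ uniformMarginal n) (h0 : 0 < ε)
    (h1 : ε < 1) (hδ : 0 < δ) (hδ1 : δ < 1) (h : (2 : ℝ) ^ (-((n : ℝ) / 2 - 2)) < ε)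
    (S : Set (Cube n))
    (hS : ∀ s, err D (parity s) ≤ (⨅ t : Cube n, err D (parity t)) + ε → s ∈ S) :
    1 - δ ≤ outputProb learner ε δ (mixtureExample D) (totalTime n ⌈1 / ε⌉₊ ⌈1 / δ⌉₊) S := by
  classical
  obtain ⟨es, h3, h4, h5, -, h6⟩ := run_learner (δ := δ) D h0 (numEntries_lt h0 h1 h)
  rw [h6]
  rcases le_or_gt (1 / 2) ε with h2 | h2
  · rw [numSamples_eq_zero h0 h1 h2]
    obtain ⟨t, ht⟩ := Finite.exists_min fun t : Cube n => err D (parity t)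
    simp only [iidExp]
    -- With no samples the output is a fixed parity, whose excess error is at most 1/2 ≤ ε.
    rw [if_pos (hS _ ?_)]
    · linarith
    · have := le_ciInf ht
      have := err_parity_le hD (learn 0 (es, zeroCube n) [] []) t
      linarith
  · exact learn_prob hD h0 h2 hδ1 (zeroCube n) h3 h4 h5 (four_le_numEntries h0 h2).1
      (failure_le h0 h2 hδ hδ1) S hS

end

end AgnosticParity

end

/-! ### Resource bounds and the learning guarantee combined. -/

theorem mainTheorem3 :
    ∃ (k : ℕ) (P : Cmd k) (C : ℝ) (a : ℕ),
      ∀ (n : ℕ) (ε δ : ℝ), 0 < ε → ε < 1 → 0 < δ → δ < 1 →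
        (2 : ℝ) ^ (-((n : ℝ) / 2 - 2)) < ε →
        ∃ T : ℕ,
          (T : ℝ) ≤ C * n * max 1 (cplx ε δ) * Real.log (2 + cplx ε δ) ^ a ∧
          (∀ D ∈ uniformMarginal n,
            (∀ c ∈ branches (mixtureExample D) T (initial P n ε δ),
              c.code = [] ∧
              (c.copies : ℝ) ≤ C * cplx ε δ ∧
              (c.gates : ℝ) ≤ C * n * cplx ε δ) ∧
            (∀ t ≤ T, ∀ c ∈ branches (mixtureExample D) t (initial P n ε δ),
              (c.space : ℝ) ≤ C * n * max 1 (cplx ε δ) * Real.log (2 + cplx ε δ) ^ a) ∧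
            1 - δ ≤ outputProb P ε δ (mixtureExample D) T
              {s | err D (parity s) ≤ (⨅ t : Cube n, err D (parity t)) + ε}) ∧
          IsProperAgnosticLearner 1 ε δ (parityClass n) (uniformMarginal n)
            (fun D S => outputProb P ε δ (mixtureExample D) T {s | parity s ∈ S}) := by
  refine ⟨20, learner, 10 ^ 12, 1, fun n ε δ h0 h1 hδ hδ1 h => ?_⟩
  have ht := time_le h0 h1 hδ hδ1 h
  have hm := numSamples_le h0 h1 hδ hδ1
  have hc := cplx_nonneg h0 h1 hδ hδ1
  have hn : (1 : ℝ) ≤ n := by exact_mod_cast one_le_of_lt h0 h1 h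
  refine ⟨totalTime n ⌈1 / ε⌉₊ ⌈1 / δ⌉₊, le_trans (by exact_mod_cast Nat.le_add_right _ _) ht,
    fun D hD => ⟨fun c hb => ?_, fun t htT c hb => ?_, ?_⟩, parityClass n, subset_rfl,
    fun D hD => ?_⟩
  · obtain ⟨-, -, -, -, hbr, -⟩ := run_learner (δ := δ) D h0 (numEntries_lt h0 h1 h)
    obtain ⟨e1, e2, e3⟩ := hbr c hb
    have e2' : (c.copies : ℝ) ≤ 2 * numSamples ⌈1 / ε⌉₊ ⌈1 / δ⌉₊ := by exact_mod_cast e2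
    have e3' : (c.gates : ℝ) ≤ 2 * (numSamples ⌈1 / ε⌉₊ ⌈1 / δ⌉₊ * (n + 1)) := by exact_mod_cast e3
    refine ⟨e1, by linarith, e3'.trans ?_⟩
    -- The label qubit is absorbed by n + 1 ≤ 2n, valid because the condition on ε forces n ≥ 1.
    calc 2 * ((numSamples ⌈1 / ε⌉₊ ⌈1 / δ⌉₊ : ℝ) * (n + 1))
        ≤ 2 * (61440 * cplx ε δ * (n + n)) := by gcongr
      _ = 245760 * (n * cplx ε δ) := by ring
      _ ≤ 10 ^ 12 * (n * cplx ε δ) := by gcongr; norm_num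
      _ = 10 ^ 12 * n * cplx ε δ := by ring
  · refine le_trans ?_ ht
    have := space_branches_le t hb
    exact_mod_cast this.trans (by omega)
  · exact learner_prob hD h0 h1 hδ hδ1 h _ fun s hs => hs
  · refine learner_prob hD h0 h1 hδ hδ1 h _ fun s hs => ⟨⟨s, rfl⟩, ?_⟩
    rwa [opt, parityClass, ← Set.range_comp, one_mul]
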